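/- Let $\mathbb N^*=\{1,2,\dots\}$ (discrete) and let $\bar{\mathbb N}^*=\mathbb N^*\cup\{\infty\}$ be its one-point compactification. Let $\gamma:\mathbb N^*\to(0,\infty)$ satisfy $\sum_{x}\gamma(x)<\infty$, put $\gamma(\infty)=0$, and let $c\ge 0$. On a probability space let $N^{(x)}=(N^{(x)}_t)_{t\ge0}$, $x\in\mathbb N^*$, be i.i.d. Poisson processes of rate $1$, let $\sigma^{(x)}_j$ be the $j$th event time of $N^{(x)}$, and let $T_0$, $T^{(x)}_i$ ($i\ge1$, $x\in\mathbb N^*$) be i.i.d. exponential random variables of rate $1$, independent of the Poisson processes. For $y\in\bar{\mathbb N}^*$ and $t\ge0$ let $$\Gamma^{y}(t)=\gamma(y)T_0+\sum_{x=1}^{\infty}\gamma(x)\sum_{i=1}^{N^{(x)}_t}T^{(x)}_i+ct$$ and $$\tilde X^{c,y}(t)=\begin{cases}y,&\text{if }0\le t<\gamma(y)T_0,\\ x,&\text{if }x\in\mathbb N^*\text{ and }\Gamma^{y}(\sigma^{(x)}_j-)\le t<\Gamma^{y}(\sigma^{(x)}_j)\text{ for some }j\ge1,\\ \infty,&\text{otherwise.}\end{cases}$$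 **Proposition 3.6.** For every $y\in\bar{\mathbb N}^*$ the process $\tilde X^{c,y}$ is almost surely càdlàg. Moreover the processes $\tilde X^{c,y}$ are Markovian with a common transition function: the laws $P_t(y,\cdot):=\mathbb P(\tilde X^{c,y}(t)\in\cdot)$ form a semigroup of Markov kernels on $\bar{\mathbb N}^*$ with $P_0(y,\cdot)=\delta_y$, and for all $y\in\bar{\mathbb N}^*$, $s,t\ge0$ and Borel $B\subseteq\bar{\mathbb N}^*$, $$\mathbb P\big(\tilde X^{c,y}(s+t)\in B\,\big|\,\tilde X^{c,y}(r),\,0\le r\le s\big)=P_t\big(\tilde X^{c,y}(s),B\big)\quad\text{almost surely.}$$ -/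

import Mathlib

open MeasureTheory ProbabilityTheory Filter Topology
open scoped NNReal ENNReal

namespace KConstruction

/-- The state space: the one-point compactification `{1, 2, …} ∪ {∞}` of the discrete space of
positive integers. Its topology is the one given by the metric `|1/x - 1/y|` (`1/∞ = 0`). -/
abbrev State : Type := OnePoint ℕ+

/-- The state space carries its Borel σ-algebra. -/
instance instMeasurableSpaceState : MeasurableSpace State := borel State

instance instBorelSpaceState : BorelSpace State := ⟨rfl⟩

/-! ### Processes in general -/

/-- A path is càdlàg: right-continuous everywhere, with a left limit everywhere (there is nothing
to check on the left of time `0`, where `𝓝[<] 0 = ⊥`). -/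
def IsCadlag {E : Type*} [TopologicalSpace E] (f : ℝ≥0 → E) : Prop :=
  ∀ t, ContinuousWithinAt f (Set.Ici t) t ∧ ∃ l, Tendsto f (𝓝[<] t) (𝓝 l)

/-- A (time-homogeneous, conservative) transition function: a semigroup of Markov kernels.
The equation `add` is the Chapman–Kolmogorov equation. -/
structure IsTransitionSemigroup {E : Type*} [MeasurableSpace E] (κ : ℝ≥0 → Kernel E E) :
    Prop where
  isMarkovKernel : ∀ t, IsMarkovKernel (κ t)
  zero : κ 0 = Kernel.id
  add : ∀ s t, κ (s + t) = κ t ∘ₖ κ s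

/-- The σ-algebra generated by `X r`, `r ≤ s`: the past of the process at time `s`. -/
@[reducible] def pastSigmaAlgebra {Ω E : Type*} [MeasurableSpace E] (X : ℝ≥0 → Ω → E) (s : ℝ≥0) :
    MeasurableSpace Ω :=
  ⨆ r : Set.Iic s, MeasurableSpace.comap (X r) inferInstance

/-- `X` has the Markov property, with transition function `κ`, with respect to its own past:
`P(X (s + t) ∈ B | X r, r ≤ s) = κ t (X s) B` almost surely. The conditional probability is
spelled out through its defining property on the events `A` of the past. -/
structure IsMarkov {Ω E : Type*} [MeasurableSpace Ω] [MeasurableSpace E]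
    (X : ℝ≥0 → Ω → E) (κ : ℝ≥0 → Kernel E E) (P : Measure Ω) : Prop where
  aemeasurable : ∀ t, AEMeasurable (X t) P
  markov : ∀ s t : ℝ≥0, ∀ A : Set Ω, MeasurableSet[pastSigmaAlgebra X s] A →
    ∀ B : Set E, MeasurableSet B →
      P (A ∩ X (s + t) ⁻¹' B) = ∫⁻ ω in A, κ t (X s ω) B ∂P

/-- `N` is a Poisson process of rate `r`: a counting process with independent increments whose
increment over `(s, t]` is Poisson distributed with mean `r (t - s)`. -/
structure IsPoissonProcess {Ω : Type*} [MeasurableSpace Ω] (N : ℝ≥0 → Ω → ℕ) (r : ℝ≥0)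
    (P : Measure Ω) : Prop where
  measurable : ∀ t, Measurable (N t)
  zero : ∀ᵐ ω ∂P, N 0 ω = 0
  mono : ∀ᵐ ω ∂P, Monotone fun t => N t ω
  rightCont : ∀ᵐ ω ∂P, ∀ t, ContinuousWithinAt (fun u => N u ω) (Set.Ici t) t
  indepIncrements : HasIndepIncrements N P
  law : ∀ s t : ℝ≥0, s ≤ t →
    HasLaw (fun ω => N t ω - N s ω) (poissonMeasure (r * (t - s))) P

/-! ### The random input of the construction -/

/-- The random input: i.i.d. Poisson processes `N x` of rate `1`, one for each positive integer
`x`, and, independent of them, a family of i.i.d. exponential variables of rate `1`, where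
`T none` is the variable `T₀` and `T (some (x, i))` is the variable `T⁽ˣ⁾` with number `i + 1`
(`i = 0, 1, 2, …`). -/
structure IsInput {Ω : Type*} [MeasurableSpace Ω] (N : ℕ+ → ℝ≥0 → Ω → ℕ)
    (T : Option (ℕ+ × ℕ) → Ω → ℝ) (P : Measure Ω) : Prop where
  poisson : ∀ x, IsPoissonProcess (N x) 1 P
  indep_poisson : iIndepFun (fun x ω (t : ℝ≥0) => N x t ω) P
  measurable_exp : ∀ k, Measurable (T k)
  law_exp : ∀ k, HasLaw (T k) (expMeasure 1) P
  indep_exp : iIndepFun T P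
  indep : IndepFun (fun ω (x : ℕ+) (t : ℝ≥0) => N x t ω)
    (fun ω (k : Option (ℕ+ × ℕ)) => T k ω) P

/-! ### The construction, for a fixed realization `n`, `τ` of the input -/

/-- The extension of `γ` to the whole state space by `γ(∞) = 0`. -/
def gammaExt (γ : ℕ+ → ℝ) (y : State) : ℝ := y.elim 0 γ

/-- The `j`-th event time (`j ≥ 1`) of a counting path: the first time it reaches `j`.
(Almost surely, a Poisson path does reach every `j`.) -/
noncomputable def eventTime (n : ℝ≥0 → ℕ) (j : ℕ) : ℝ≥0 := sInf {t | j ≤ n t}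

/-- The clock
`Γ(t) = γ(y) T₀ + ∑ₓ γ(x) (T₁⁽ˣ⁾ + ⋯ + T⁽ˣ⁾ with number N⁽ˣ⁾(t)) + c t`.
Almost surely the series converges for all `t` (since `γ` is summable). -/
noncomputable def clock (γ : ℕ+ → ℝ) (c : ℝ) (y : State) (n : ℕ+ → ℝ≥0 → ℕ)
    (τ : Option (ℕ+ × ℕ) → ℝ) (t : ℝ≥0) : ℝ :=
  gammaExt γ y * τ none
    + (∑' x : ℕ+, γ x * ∑ i ∈ Finset.range (n x t), τ (some (x, i))) + c * t

/-- At time `t` the construction sits at `x`: for some `j ≥ 1`, with `σ` the `j`-th event time of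
the `x`-th Poisson process, `Γ(σ-) ≤ t < Γ(σ)`. -/
def SitsAt (γ : ℕ+ → ℝ) (c : ℝ) (y : State) (n : ℕ+ → ℝ≥0 → ℕ)
    (τ : Option (ℕ+ × ℕ) → ℝ) (t : ℝ≥0) (x : ℕ+) : Prop :=
  ∃ j : ℕ, 1 ≤ j ∧
    Function.leftLim (clock γ c y n τ) (eventTime (n x) j) ≤ t ∧
      t < clock γ c y n τ (eventTime (n x) j)

open Classical in
/-- The path of the K-process with parameters `γ` and `c` started at `y`. (Almost surely, at most
one `x` satisfies `SitsAt`, so that the choice below is immaterial.) -/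
noncomputable def path (γ : ℕ+ → ℝ) (c : ℝ) (y : State) (n : ℕ+ → ℝ≥0 → ℕ)
    (τ : Option (ℕ+ × ℕ) → ℝ) (t : ℝ≥0) : State :=
  if t < gammaExt γ y * τ none then y
  else if h : ∃ x : ℕ+, SitsAt γ c y n τ t x then ((h.choose : ℕ+) : State)
  else OnePoint.infty

/-- The K-process with parameters `γ` and `c` started at `y`, built from the random input. -/
noncomputable def process {Ω : Type*} (γ : ℕ+ → ℝ) (c : ℝ) (N : ℕ+ → ℝ≥0 → Ω → ℕ)
    (T : Option (ℕ+ × ℕ) → Ω → ℝ) (y : State) (t : ℝ≥0) (ω : Ω) : State :=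
  path γ c y (fun x s => N x s ω) (fun k => T k ω) t

end KConstruction

/-! Pathwise picture. For a regular realization the clock Γ is strictly increasing, right-continuous
and unbounded, and it jumps exactly at the event times, each time by γ(x) times one holding
variable. The times t ≥ 0 that Γ skips therefore form disjoint holding intervals [Γ(σ-), Γ(σ)),
together with the initial interval [0, γ(y)T₀) (`IsRegular.holds_or`, `IsRegular.holds_unique`). The
path is constant on each interval and equals ∞ at the values of Γ. Each x has finitely many events
in bounded clock time, so wherever the path is not constant on one side of a time, it avoids any
given x close to that time on that side. This is convergence to ∞, and it gives the càdlàg property.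

Markov property. Two invariances of the law of the input carry it. Replacing the input after a fixed
clock time u by an independent copy preserves the law (`IsInput.lintegral_concat`), and the path
after time Γ(u) is then a fresh one started at ∞. Resampling one holding variable also preserves the
law, and lack of memory makes the rest of the interval containing s a fresh holding time,
independent of the past (`IsInput.lintegral_pastPhase_some`).

The first invariance is needed at the random clock time at which Γ passes s. That time is
approximated from the right by grid times, and right continuity of the clock and of the path gives
the limit (`IsInput.lintegral_mul_indicator_position`). So, given the past up to a time s in an
interval labelled z, the path stays at z for γ(z) times an exponential time and then starts afresh
from ∞. This is also the description of the path started at z (`IsInput.measure_position_eq`). If s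
is a value of Γ, the same holds with z = ∞ and no waiting. Summing over the countably many intervals
that may contain s gives the Markov property, and Chapman–Kolmogorov is the case of the sure event.

The path is defined through a choice and real series, so measurability is handled on `position`,
which coincides with it at all times on regular inputs. -/

namespace KConstruction

/-! ### Regular realizations and the one-sided limits of the clock. -/

/-- A realization of the random input: the counting paths and the holding variables. -/
abbrev Input : Type := (ℕ+ → ℝ≥0 → ℕ) × (Option (ℕ+ × ℕ) → ℝ)

/-- The total holding time accumulated at `x` up to clock time `t`, before scaling by `γ x`. -/
noncomputable def load (I : Input) (x : ℕ+) (t : ℝ≥0) : ℝ :=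
  ∑ i ∈ Finset.range (I.1 x t), I.2 (some (x, i))

/-- The pathwise properties of the input that hold almost surely. -/
structure IsRegular (γ : ℕ+ → ℝ) (I : Input) : Prop where
  mono : ∀ x, Monotone (I.1 x)
  zero : ∀ x, I.1 x 0 = 0
  rightCont : ∀ x t, ∃ u, t < u ∧ I.1 x u = I.1 x t
  unbounded : ∀ x k, ∃ t, k ≤ I.1 x t
  jump_le : ∀ x t, 0 < t → ∃ w, w < t ∧ I.1 x t ≤ I.1 x w + 1
  no_common : ∀ x x', x ≠ x' → ∀ t, 0 < t → ∃ w, w < t ∧ (I.1 x w = I.1 x t ∨ I.1 x' w = I.1 x' t)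
  dense : ∀ a b, a < b → ∃ x, I.1 x a < I.1 x b
  pos : ∀ k, 0 < I.2 k
  frequently : ∀ x m, ∃ i, m ≤ i ∧ 1 ≤ I.2 (some (x, i))
  summable : ∀ t, Summable fun x => γ x * load I x t

/-- The counting path of `x` jumps at `v`. -/
def Jumps (I : Input) (x : ℕ+) (v : ℝ≥0) : Prop :=
  0 < v ∧ ∀ w, w < v → I.1 x w < I.1 x v

variable {γ : ℕ+ → ℝ} {c : ℝ} {y : State} {I : Input}

lemma clock_eq (t : ℝ≥0) : clock γ c y I.1 I.2 t
    = gammaExt γ y * I.2 none + (∑' x : ℕ+, γ x * load I x t) + c * t := rfl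

lemma gammaExt_nonneg (hγ : ∀ x, 0 < γ x) (y : State) : 0 ≤ gammaExt γ y := by
  induction y using OnePoint.rec with
  | infty => exact le_rfl
  | coe x => exact (hγ x).le

lemma IsRegular.load_mono (hI : IsRegular γ I) (x : ℕ+) : Monotone (load I x) := by
  intro s t hst
  exact Finset.sum_le_sum_of_subset_of_nonneg (Finset.range_mono (hI.mono x hst))
    fun _ _ _ => (hI.pos _).le

lemma IsRegular.load_nonneg (hI : IsRegular γ I) (x : ℕ+) (t : ℝ≥0) : 0 ≤ load I x t :=
  Finset.sum_nonneg fun _ _ => (hI.pos _).le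

lemma IsRegular.load_lt (hI : IsRegular γ I) {x : ℕ+} {s t : ℝ≥0} (h : I.1 x s < I.1 x t) :
    load I x s < load I x t := by
  unfold load
  refine Finset.sum_lt_sum_of_subset (Finset.range_mono h.le) (i := I.1 x s) ?_ ?_ (hI.pos _)
    fun _ _ _ => (hI.pos _).le
  · simpa using h
  · simp

/-- Strictness comes from the jumps alone, since c may vanish: some process has an event in every
interval, and its holding variable is positive. -/
lemma IsRegular.clock_strictMono (hI : IsRegular γ I) (hγ : ∀ x, 0 < γ x) (hc : 0 ≤ c) :
    StrictMono (clock γ c y I.1 I.2) := by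
  intro s t hst
  simp only [clock_eq]
  obtain ⟨x, hx⟩ := hI.dense s t hst
  have h1 : ∑' x : ℕ+, γ x * load I x s < ∑' x : ℕ+, γ x * load I x t :=
    Summable.tsum_lt_tsum (i := x)
      (fun x => mul_le_mul_of_nonneg_left (hI.load_mono x hst.le) (hγ x).le)
      (mul_lt_mul_of_pos_left (hI.load_lt hx) (hγ x)) (hI.summable s) (hI.summable t)
  have h2 : c * (s : ℝ) ≤ c * t := mul_le_mul_of_nonneg_left (by exact_mod_cast hst.le) hc
  linarith

lemma IsRegular.clock_zero (hI : IsRegular γ I) :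
    clock γ c y I.1 I.2 0 = gammaExt γ y * I.2 none := by
  simp [clock_eq, load, hI.zero]

lemma IsRegular.clock_nonneg (hI : IsRegular γ I) (hγ : ∀ x, 0 < γ x) (hc : 0 ≤ c) (t : ℝ≥0) :
    0 ≤ clock γ c y I.1 I.2 t := by
  refine le_trans ?_ ((hI.clock_strictMono hγ hc).monotone zero_le)
  rw [hI.clock_zero]
  exact mul_nonneg (gammaExt_nonneg hγ y) (hI.pos none).le

/-- The dominated convergence argument behind all one-sided limits of the clock. -/
lemma IsRegular.clock_tendsto (hI : IsRegular γ I) (hγ : ∀ x, 0 < γ x) {l : Filter ℝ≥0}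
    {v b : ℝ≥0} (hl : l ≤ 𝓝 v) (hb : ∀ᶠ u in l, u ≤ b) (m : ℕ+ → ℕ)
    (hm : ∀ x, ∀ᶠ u in l, I.1 x u = m x) :
    Tendsto (clock γ c y I.1 I.2) l (𝓝 (gammaExt γ y * I.2 none
      + (∑' x : ℕ+, γ x * ∑ i ∈ Finset.range (m x), I.2 (some (x, i))) + c * v)) := by
  refine Tendsto.add (Tendsto.add tendsto_const_nhds ?_) ?_
  -- Loads increase in time, so the summable loads at the upper bound b dominate.
  · refine tendsto_tsum_of_dominated_convergence (bound := fun x => γ x * load I x b)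
      (hI.summable b) ?_ ?_
    · intro x
      refine tendsto_const_nhds.congr' ?_
      filter_upwards [hm x] with u hu
      rw [hu]
    · filter_upwards [hb] with u hu x
      change ‖γ x * load I x u‖ ≤ _
      rw [Real.norm_of_nonneg (mul_nonneg (hγ x).le (hI.load_nonneg x u))]
      exact mul_le_mul_of_nonneg_left (hI.load_mono x hu) (hγ x).le
  · exact tendsto_const_nhds.mul ((NNReal.continuous_coe.tendsto v).mono_left hl)

lemma IsRegular.count_eq (hI : IsRegular γ I) {x : ℕ+} {a b u : ℝ≥0} (hau : a ≤ u) (hub : u ≤ b)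
    (h : I.1 x b = I.1 x a) : I.1 x u = I.1 x a :=
  le_antisymm (h ▸ hI.mono x hub) (hI.mono x hau)

lemma IsRegular.eventually_count_right (hI : IsRegular γ I) (x : ℕ+) (t : ℝ≥0) :
    ∀ᶠ u in 𝓝[≥] t, I.1 x u = I.1 x t := by
  obtain ⟨b, hb, h⟩ := hI.rightCont x t
  filter_upwards [Icc_mem_nhdsGE hb] with u hu
  exact hI.count_eq hu.1 hu.2 h

lemma IsRegular.clock_rightCont (hI : IsRegular γ I) (hγ : ∀ x, 0 < γ x) (t : ℝ≥0) :
    ContinuousWithinAt (clock γ c y I.1 I.2) (Set.Ici t) t := by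
  have hb : ∀ᶠ u in 𝓝[≥] t, u ≤ t + 1 := by
    filter_upwards [Icc_mem_nhdsGE (show t < t + 1 by simp)] with u hu using hu.2
  exact hI.clock_tendsto hγ nhdsWithin_le_nhds hb (fun x => I.1 x t)
    (hI.eventually_count_right · t)

lemma IsRegular.eventually_count_left_of_not_jumps (hI : IsRegular γ I) {x : ℕ+} {v : ℝ≥0}
    (hv : 0 < v) (h : ¬ Jumps I x v) : ∀ᶠ u in 𝓝[<] v, I.1 x u = I.1 x v := by
  simp only [Jumps, hv, true_and, not_forall, not_lt] at h
  obtain ⟨w, hw, h⟩ := h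
  filter_upwards [Ico_mem_nhdsLT hw] with u hu
  exact le_antisymm (hI.mono x hu.2.le) (h.trans (hI.mono x hu.1))

/-- Jumps have size exactly one, by `jump_le`. -/
lemma IsRegular.eventually_count_left_of_jumps (hI : IsRegular γ I) {x : ℕ+} {v : ℝ≥0}
    (h : Jumps I x v) : ∀ᶠ u in 𝓝[<] v, I.1 x u = I.1 x v - 1 := by
  obtain ⟨w, hw, h1⟩ := hI.jump_le x v h.1
  filter_upwards [Ico_mem_nhdsLT hw] with u hu
  have := h.2 u hu.2
  have := hI.mono x hu.1
  omega

lemma IsRegular.jumps_unique (hI : IsRegular γ I) {x x' : ℕ+} {v : ℝ≥0}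
    (h : Jumps I x v) (h' : Jumps I x' v) : x = x' := by
  by_contra hne
  obtain ⟨w, hw, h1⟩ := hI.no_common x x' hne v h.1
  rcases h1 with h1 | h1
  · exact (h.2 w hw).ne h1
  · exact (h'.2 w hw).ne h1

lemma eventually_nhdsLT_le (v : ℝ≥0) : ∀ᶠ u in 𝓝[<] v, u ≤ v :=
  eventually_nhdsWithin_of_forall fun _ hu => le_of_lt hu

lemma IsRegular.clock_tendsto_left_of_not_jumps (hI : IsRegular γ I) (hγ : ∀ x, 0 < γ x)
    {v : ℝ≥0} (hv : 0 < v) (h : ∀ x, ¬ Jumps I x v) :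
    Tendsto (clock γ c y I.1 I.2) (𝓝[<] v) (𝓝 (clock γ c y I.1 I.2 v)) :=
  hI.clock_tendsto hγ nhdsWithin_le_nhds (eventually_nhdsLT_le v) (fun x => I.1 x v)
    fun x => hI.eventually_count_left_of_not_jumps hv (h x)

/-- No other process jumps at v, so a single term of the series changes there, and by one holding
variable. Its number is the count minus one because the holding variables are numbered from 0. -/
lemma IsRegular.clock_tendsto_left_of_jumps (hI : IsRegular γ I) (hγ : ∀ x, 0 < γ x)
    {x : ℕ+} {v : ℝ≥0} (h : Jumps I x v) :
    Tendsto (clock γ c y I.1 I.2) (𝓝[<] v)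
      (𝓝 (clock γ c y I.1 I.2 v - γ x * I.2 (some (x, I.1 x v - 1)))) := by
  classical
  have key := hI.clock_tendsto (c := c) (y := y) hγ nhdsWithin_le_nhds (eventually_nhdsLT_le v)
    (fun x' => if x' = x then I.1 x v - 1 else I.1 x' v) (by
      intro x'
      by_cases hx : x' = x
      · subst hx
        simpa using hI.eventually_count_left_of_jumps h
      · simp only [hx, if_false]
        exact hI.eventually_count_left_of_not_jumps h.1 fun h' => hx (hI.jumps_unique h' h))
  convert key using 2
  have hone : 1 ≤ I.1 x v := Nat.one_le_of_lt (h.2 0 h.1)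
  have hd : ∀ x', γ x' * ∑ i ∈ Finset.range (if x' = x then I.1 x v - 1 else I.1 x' v),
      I.2 (some (x', i)) = γ x' * load I x' v
        - (if x' = x then γ x * I.2 (some (x, I.1 x v - 1)) else 0) := by
    intro x'
    by_cases hx : x' = x
    · subst hx
      obtain ⟨k, hk⟩ := Nat.exists_eq_add_of_le' hone
      simp only [if_true, load, hk, Nat.add_sub_cancel, Finset.sum_range_succ]
      ring
    · simp [hx, load]
  have hs : HasSum (fun x' => if x' = x then γ x * I.2 (some (x, I.1 x v - 1)) else 0)
      (γ x * I.2 (some (x, I.1 x v - 1))) := hasSum_ite_eq x _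
  rw [tsum_congr hd, ((hI.summable v).hasSum.sub hs).tsum_eq, clock_eq]
  ring

/-- The row x = 1 suffices: infinitely many of its holding variables are at least 1, and its count
is unbounded. -/
lemma IsRegular.clock_tendsto_atTop (hI : IsRegular γ I) (hγ : ∀ x, 0 < γ x) (hc : 0 ≤ c) (C : ℝ) :
    ∃ t, C < clock γ c y I.1 I.2 t := by
  have hsum : ∀ K : ℕ, ∃ m, (K : ℝ) ≤ ∑ i ∈ Finset.range m, I.2 (some (1, i)) := by
    intro K
    induction K with
    | zero => exact ⟨0, by simp⟩
    | succ K ih =>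
      obtain ⟨m, hm⟩ := ih
      obtain ⟨i, hi, h1⟩ := hI.frequently 1 m
      refine ⟨i + 1, ?_⟩
      rw [Finset.sum_range_succ]
      have : ∑ i ∈ Finset.range m, I.2 (some (1, i)) ≤ ∑ i ∈ Finset.range i, I.2 (some (1, i)) :=
        Finset.sum_le_sum_of_subset_of_nonneg (Finset.range_mono hi) fun i _ _ => (hI.pos _).le
      push_cast
      linarith
  obtain ⟨K, hK⟩ := exists_nat_gt (C / γ 1)
  obtain ⟨m, hm⟩ := hsum K
  obtain ⟨t, ht⟩ := hI.unbounded 1 m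
  refine ⟨t, ?_⟩
  have h1 : (K : ℝ) ≤ load I 1 t := hm.trans
    (Finset.sum_le_sum_of_subset_of_nonneg (Finset.range_mono ht) fun i _ _ => (hI.pos _).le)
  have h2 : γ 1 * load I 1 t ≤ ∑' x : ℕ+, γ x * load I x t :=
    (hI.summable t).le_tsum 1 fun x _ => mul_nonneg (hγ x).le (hI.load_nonneg x t)
  have h3 : C < γ 1 * K := by rwa [div_lt_iff₀' (hγ 1)] at hK
  have h4 := mul_le_mul_of_nonneg_left h1 (hγ 1).le
  have h5 := mul_nonneg (gammaExt_nonneg hγ y) (hI.pos none).le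
  have h6 : 0 ≤ c * (t : ℝ) := mul_nonneg hc t.2
  rw [clock_eq]
  linarith

/-! ### Event times -/

/-- Right continuity makes the infimum in `eventTime` attained, so counts and event times form a
Galois connection. -/
lemma IsRegular.le_count_iff (hI : IsRegular γ I) (x : ℕ+) (j : ℕ) (w : ℝ≥0) :
    j ≤ I.1 x w ↔ eventTime (I.1 x) j ≤ w := by
  have hbdd : BddBelow {t | j ≤ I.1 x t} := OrderBot.bddBelow _
  have hmem : j ≤ I.1 x (eventTime (I.1 x) j) := by
    obtain ⟨b, hb, h⟩ := hI.rightCont x (eventTime (I.1 x) j)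
    obtain ⟨u, hu, hub⟩ := exists_lt_of_csInf_lt (hI.unbounded x j) hb
    exact h ▸ le_trans hu (hI.mono x hub.le)
  exact ⟨fun h => csInf_le hbdd h, fun h => hmem.trans (hI.mono x h)⟩

lemma IsRegular.count_lt_iff (hI : IsRegular γ I) (x : ℕ+) (j : ℕ) (w : ℝ≥0) :
    I.1 x w < j ↔ w < eventTime (I.1 x) j := by
  simpa using (hI.le_count_iff x j w).not

lemma IsRegular.eventTime_pos (hI : IsRegular γ I) (x : ℕ+) (j : ℕ) :
    0 < eventTime (I.1 x) (j + 1) := by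
  rw [← hI.count_lt_iff, hI.zero]
  omega

lemma IsRegular.jumps_eventTime (hI : IsRegular γ I) (x : ℕ+) (j : ℕ) :
    Jumps I x (eventTime (I.1 x) (j + 1)) := by
  refine ⟨hI.eventTime_pos x j, fun w hw => ?_⟩
  exact ((hI.count_lt_iff x _ w).2 hw).trans_le ((hI.le_count_iff x _ _).2 le_rfl)

lemma IsRegular.count_eventTime (hI : IsRegular γ I) (x : ℕ+) (j : ℕ) :
    I.1 x (eventTime (I.1 x) (j + 1)) = j + 1 := by
  have h1 := (hI.le_count_iff x (j + 1) _).2 le_rfl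
  obtain ⟨w, hw, h2⟩ := hI.jump_le x _ (hI.eventTime_pos x j)
  have h3 := (hI.count_lt_iff x _ w).2 hw
  omega

lemma IsRegular.eventTime_of_jumps (hI : IsRegular γ I) {x : ℕ+} {v : ℝ≥0} (h : Jumps I x v) :
    ∃ j, I.1 x v = j + 1 ∧ eventTime (I.1 x) (j + 1) = v := by
  obtain ⟨j, hj⟩ := Nat.exists_eq_add_of_lt (h.2 0 h.1)
  rw [hI.zero, zero_add] at hj
  refine ⟨j, hj, le_antisymm ((hI.le_count_iff x _ v).1 hj.ge) ?_⟩
  by_contra! hlt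
  have := h.2 _ hlt
  rw [hI.count_eventTime, hj] at this
  exact this.false

/-- The left limit of a monotone clock at v > 0 is at most t exactly when all earlier values are.
This form avoids left limits and event numbers altogether. -/
lemma IsRegular.sitsAt_iff (hI : IsRegular γ I) (hγ : ∀ x, 0 < γ x) (hc : 0 ≤ c) (t : ℝ≥0)
    (x : ℕ+) : SitsAt γ c y I.1 I.2 t x ↔ ∃ v, Jumps I x v ∧
      (∀ w, w < v → clock γ c y I.1 I.2 w ≤ t) ∧ t < clock γ c y I.1 I.2 v := by
  have hmono : Monotone (clock γ c y I.1 I.2) := (hI.clock_strictMono hγ hc).monotone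
  have hlim : ∀ v : ℝ≥0, 0 < v → (Function.leftLim (clock γ c y I.1 I.2) v ≤ t ↔
      ∀ w, w < v → clock γ c y I.1 I.2 w ≤ t) := by
    intro v hv
    refine ⟨fun h w hw => (hmono.le_leftLim hw).trans h, fun h => ?_⟩
    have : (𝓝[<] v).NeBot := nhdsLT_neBot_of_exists_lt ⟨0, hv⟩
    exact le_of_tendsto (hmono.tendsto_leftLim v) (eventually_nhdsWithin_of_forall h)
  constructor
  · rintro ⟨j, hj, h1, h2⟩
    obtain ⟨i, rfl⟩ := Nat.exists_eq_add_of_le' hj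
    exact ⟨_, hI.jumps_eventTime x i, (hlim _ (hI.eventTime_pos x i)).1 h1, h2⟩
  · rintro ⟨v, hv, h1, h2⟩
    obtain ⟨j, -, rfl⟩ := hI.eventTime_of_jumps hv
    exact ⟨j + 1, by omega, (hlim _ hv.1).2 h1, h2⟩

end KConstruction

namespace KConstruction

/-! ### Holding intervals and a measurable version of the path -/

/-- The clock as an extended nonnegative number. -/
noncomputable def eclock (γ : ℕ+ → ℝ) (c : ℝ) (y : State) (I : Input) (t : ℝ≥0) : ℝ≥0∞ :=
  ENNReal.ofReal (gammaExt γ y * I.2 none) + (∑' x : ℕ+, ENNReal.ofReal (γ x * load I x t))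
    + ENNReal.ofReal (c * t)

/-- The left endpoint of the holding interval with holding variable number `k`: the left limit of
the clock at the corresponding event time. -/
noncomputable def start (γ : ℕ+ → ℝ) (c : ℝ) (y : State) :
    Option (ℕ+ × ℕ) → Input → ℝ
  | none, _ => 0
  | some (x, j), I => (⨆ q : ℕ, if I.1 x (TopologicalSpace.denseSeq ℝ≥0 q) ≤ j then
      eclock γ c y I (TopologicalSpace.denseSeq ℝ≥0 q) else 0).toReal

/-- The mean length of a holding interval. -/
def weight (γ : ℕ+ → ℝ) (y : State) : Option (ℕ+ × ℕ) → ℝ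
  | none => gammaExt γ y
  | some (x, _) => γ x

/-- The state occupied during a holding interval. -/
def label (y : State) : Option (ℕ+ × ℕ) → State
  | none => y
  | some (x, _) => (x : State)

/-- The right endpoint of a holding interval. -/
noncomputable def finish (γ : ℕ+ → ℝ) (c : ℝ) (y : State) (k : Option (ℕ+ × ℕ)) (I : Input) : ℝ :=
  start γ c y k I + weight γ y k * I.2 k

/-- The time `t` belongs to the holding interval number `k`. -/
def Holds (γ : ℕ+ → ℝ) (c : ℝ) (y : State) (k : Option (ℕ+ × ℕ)) (t : ℝ) (I : Input) : Prop :=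
  start γ c y k I ≤ t ∧ t < finish γ c y k I

open Classical in
/-- The least element of a set of positive integers, `∞` if there is none. -/
noncomputable def leastState (p : ℕ+ → Prop) : State :=
  if h : ∃ x, p x then ((PNat.find h : ℕ+) : State) else OnePoint.infty

open Classical in
/-- A measurable version of the path, with real time parameter. -/
noncomputable def position (γ : ℕ+ → ℝ) (c : ℝ) (y : State) (t : ℝ) (I : Input) : State :=
  if Holds γ c y none t I then y
  else leastState fun x => ∃ j, Holds γ c y (some (x, j)) t I

variable {γ : ℕ+ → ℝ} {c : ℝ} {y : State} {I : Input}

lemma weight_eq_gammaExt_label (k : Option (ℕ+ × ℕ)) : weight γ y k = gammaExt γ (label y k) := by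
  rcases k with _ | ⟨x, j⟩ <;> rfl

lemma IsRegular.eclock_eq (hI : IsRegular γ I) (hγ : ∀ x, 0 < γ x) (hc : 0 ≤ c) (t : ℝ≥0) :
    eclock γ c y I t = ENNReal.ofReal (clock γ c y I.1 I.2 t) := by
  have h0 : 0 ≤ gammaExt γ y * I.2 none := mul_nonneg (gammaExt_nonneg hγ y) (hI.pos none).le
  have h1 : ∀ x, 0 ≤ γ x * load I x t := fun x => mul_nonneg (hγ x).le (hI.load_nonneg x t)
  have h2 : 0 ≤ ∑' x, γ x * load I x t := tsum_nonneg h1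
  rw [clock_eq, ENNReal.ofReal_add (add_nonneg h0 h2) (mul_nonneg hc t.coe_nonneg),
    ENNReal.ofReal_add h0 h2, ENNReal.ofReal_tsum_of_nonneg h1 (hI.summable t)]
  rfl

/-- The left endpoint of a holding interval is the left limit of the clock. -/
lemma IsRegular.start_some (hI : IsRegular γ I) (hγ : ∀ x, 0 < γ x) (hc : 0 ≤ c) {x : ℕ+} {j : ℕ}
    {L : ℝ} (hL : Tendsto (clock γ c y I.1 I.2) (𝓝[<] eventTime (I.1 x) (j + 1)) (𝓝 L)) :
    start γ c y (some (x, j)) I = L := by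
  set v := eventTime (I.1 x) (j + 1) with hv
  have hvpos : 0 < v := hI.eventTime_pos x j
  have hne : (𝓝[<] v).NeBot := nhdsLT_neBot_of_exists_lt ⟨0, hvpos⟩
  have hmono : StrictMono (clock γ c y I.1 I.2) := hI.clock_strictMono hγ hc
  have hle : ∀ w, w < v → clock γ c y I.1 I.2 w ≤ L := by
    intro w hw
    refine ge_of_tendsto hL ?_
    filter_upwards [Ico_mem_nhdsLT hw] with u hu using hmono.monotone hu.1
  have hL0 : 0 ≤ L := (hI.clock_nonneg hγ hc 0).trans (hle 0 hvpos)
  have hiff : ∀ q, I.1 x (TopologicalSpace.denseSeq ℝ≥0 q) ≤ j ↔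
      TopologicalSpace.denseSeq ℝ≥0 q < v := by
    intro q
    rw [hv, ← hI.count_lt_iff, Nat.lt_succ_iff]
  -- The condition on the count selects the points of the dense sequence before v. By monotonicity
  -- of the clock, the supremum over them is its left limit.
  have hsup : (⨆ q : ℕ, if I.1 x (TopologicalSpace.denseSeq ℝ≥0 q) ≤ j then
      eclock γ c y I (TopologicalSpace.denseSeq ℝ≥0 q) else 0) = ENNReal.ofReal L := by
    refine le_antisymm (iSup_le fun q => ?_) ?_
    · split_ifs with h
      · rw [hI.eclock_eq hγ hc]
        exact ENNReal.ofReal_le_ofReal (hle _ ((hiff q).1 h))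
      · exact zero_le
    · refine le_of_tendsto (ENNReal.continuous_ofReal.continuousAt.tendsto.comp hL) ?_
      refine eventually_nhdsWithin_of_forall fun w hw => ?_
      obtain ⟨_, ⟨q, rfl⟩, hq⟩ :=
        (TopologicalSpace.denseRange_denseSeq ℝ≥0).exists_between (show w < v from hw)
      refine le_trans ?_ (le_iSup _ q)
      rw [if_pos ((hiff q).2 hq.2), hI.eclock_eq hγ hc]
      exact ENNReal.ofReal_le_ofReal (hmono.monotone hq.1.le)
  change ENNReal.toReal _ = L
  rw [hsup, ENNReal.toReal_ofReal hL0]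

lemma IsRegular.finish_some (hI : IsRegular γ I) (hγ : ∀ x, 0 < γ x) (hc : 0 ≤ c) (x : ℕ+)
    (j : ℕ) : finish γ c y (some (x, j)) I = clock γ c y I.1 I.2 (eventTime (I.1 x) (j + 1)) := by
  have h := hI.start_some hγ hc (hI.clock_tendsto_left_of_jumps (c := c) (y := y) hγ
    (hI.jumps_eventTime x j))
  rw [hI.count_eventTime, Nat.add_sub_cancel] at h
  rw [finish, h, weight]
  ring

lemma IsRegular.finish_none (hI : IsRegular γ I) :
    finish γ c y none I = clock γ c y I.1 I.2 0 := by
  rw [hI.clock_zero, finish, start, weight, zero_add]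

lemma IsRegular.start_le_iff (hI : IsRegular γ I) (hγ : ∀ x, 0 < γ x) (hc : 0 ≤ c) (x : ℕ+)
    (j : ℕ) (t : ℝ) : start γ c y (some (x, j)) I ≤ t ↔
      ∀ w, w < eventTime (I.1 x) (j + 1) → clock γ c y I.1 I.2 w ≤ t := by
  have hj := hI.jumps_eventTime x j
  have hlim := hI.clock_tendsto_left_of_jumps (c := c) (y := y) hγ hj
  rw [hI.start_some hγ hc hlim]
  have hne : (𝓝[<] eventTime (I.1 x) (j + 1)).NeBot := nhdsLT_neBot_of_exists_lt ⟨0, hj.1⟩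
  constructor
  · intro h w hw
    refine (ge_of_tendsto hlim ?_).trans h
    filter_upwards [Ico_mem_nhdsLT hw] with u hu
    exact (hI.clock_strictMono hγ hc).monotone hu.1
  · exact fun h => le_of_tendsto hlim (eventually_nhdsWithin_of_forall h)

lemma IsRegular.holds_some_iff (hI : IsRegular γ I) (hγ : ∀ x, 0 < γ x) (hc : 0 ≤ c) (x : ℕ+)
    (j : ℕ) (t : ℝ) : Holds γ c y (some (x, j)) t I ↔
      (∀ w, w < eventTime (I.1 x) (j + 1) → clock γ c y I.1 I.2 w ≤ t) ∧
        t < clock γ c y I.1 I.2 (eventTime (I.1 x) (j + 1)) := by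
  rw [Holds, hI.start_le_iff hγ hc, hI.finish_some hγ hc]

lemma IsRegular.exists_holds_iff (hI : IsRegular γ I) (hγ : ∀ x, 0 < γ x) (hc : 0 ≤ c) (x : ℕ+)
    (t : ℝ) : (∃ j, Holds γ c y (some (x, j)) t I) ↔ ∃ v, Jumps I x v ∧
      (∀ w, w < v → clock γ c y I.1 I.2 w ≤ t) ∧ t < clock γ c y I.1 I.2 v := by
  constructor
  · rintro ⟨j, hj⟩
    exact ⟨_, hI.jumps_eventTime x j, (hI.holds_some_iff hγ hc x j t).1 hj⟩
  · rintro ⟨v, hv, h⟩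
    obtain ⟨j, -, rfl⟩ := hI.eventTime_of_jumps hv
    exact ⟨j, (hI.holds_some_iff hγ hc x j t).2 h⟩

/-- Every holding interval ends at a value of the clock, from below which the clock does not
exceed any time of the interval. -/
lemma IsRegular.holds_finish (hI : IsRegular γ I) (hγ : ∀ x, 0 < γ x) (hc : 0 ≤ c)
    {k : Option (ℕ+ × ℕ)} {t : ℝ} (h : Holds γ c y k t I) :
    ∃ v, finish γ c y k I = clock γ c y I.1 I.2 v ∧ (∀ w, w < v → clock γ c y I.1 I.2 w ≤ t) := by
  rcases k with _ | ⟨x, j⟩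
  · exact ⟨0, hI.finish_none, fun w hw => absurd hw not_lt_zero⟩
  · exact ⟨_, hI.finish_some hγ hc x j, ((hI.holds_some_iff hγ hc x j t).1 h).1⟩

/-- Such a v is the first clock time at which the clock exceeds t. -/
lemma gap_unique {t : ℝ} {v v' : ℝ≥0}
    (h1 : ∀ w, w < v → clock γ c y I.1 I.2 w ≤ t) (h2 : t < clock γ c y I.1 I.2 v)
    (h1' : ∀ w, w < v' → clock γ c y I.1 I.2 w ≤ t) (h2' : t < clock γ c y I.1 I.2 v') :
    v = v' := by
  rcases lt_trichotomy v v' with h | h | h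
  · exact absurd (h1' v h) (not_le.2 h2)
  · exact h
  · exact absurd (h1 v' h) (not_le.2 h2')

/-- Both intervals end at the first passage of the clock above t. Only one process jumps there, and
its count at that moment fixes the number of the interval. -/
lemma IsRegular.holds_unique (hI : IsRegular γ I) (hγ : ∀ x, 0 < γ x) (hc : 0 ≤ c)
    {k l : Option (ℕ+ × ℕ)} {t : ℝ} (hk : Holds γ c y k t I) (hl : Holds γ c y l t I) : k = l := by
  have hnone : ∀ x j, Holds γ c y none t I → ¬ Holds γ c y (some (x, j)) t I := by
    intro x j h h'
    have h1 := h.2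
    rw [hI.finish_none] at h1
    exact absurd (((hI.holds_some_iff hγ hc x j t).1 h').1 0 (hI.eventTime_pos x j)) (not_le.2 h1)
  rcases k with _ | ⟨x, j⟩ <;> rcases l with _ | ⟨x', j'⟩
  · rfl
  · exact absurd hl (hnone _ _ hk)
  · exact absurd hk (hnone _ _ hl)
  · rw [hI.holds_some_iff hγ hc] at hk hl
    have hv := gap_unique hk.1 hk.2 hl.1 hl.2
    have hJ := hI.jumps_eventTime x j
    have hx : x = x' := hI.jumps_unique hJ (hv ▸ hI.jumps_eventTime x' j')
    subst hx
    have hj := hI.count_eventTime x j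
    rw [hv, hI.count_eventTime] at hj
    rw [Nat.succ_injective hj]

/-- A time is in a holding interval, or a value of the clock. -/
lemma IsRegular.holds_or (hI : IsRegular γ I) (hγ : ∀ x, 0 < γ x) (hc : 0 ≤ c) {t : ℝ}
    (ht : 0 ≤ t) : (∃ k, Holds γ c y k t I) ∨
      ((∀ k, ¬ Holds γ c y k t I) ∧ ∃ v, clock γ c y I.1 I.2 v = t) := by
  have hmono : StrictMono (clock γ c y I.1 I.2) := hI.clock_strictMono hγ hc
  -- Here v is the passage time of the clock above t. Either Γ(v) = t, or Γ skips t at v: then v = 0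
  -- gives the initial interval, and otherwise some process jumps at v, since Γ would else be
  -- left-continuous there.
  set S : Set ℝ≥0 := {v | t < clock γ c y I.1 I.2 v} with hS
  have hSne : S.Nonempty := hI.clock_tendsto_atTop hγ hc t
  set v := sInf S with hv
  have h1 : ∀ w, w < v → clock γ c y I.1 I.2 w ≤ t := fun w hw =>
    not_lt.1 fun h => (csInf_le (OrderBot.bddBelow S) h).not_gt hw
  have h2 : ∀ w, v < w → t < clock γ c y I.1 I.2 w := by
    intro w hw
    obtain ⟨u, hu, huw⟩ := exists_lt_of_csInf_lt hSne hw
    exact lt_trans hu (hmono huw)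
  have h3 : t ≤ clock γ c y I.1 I.2 v := by
    have hT := (hI.clock_rightCont (c := c) (y := y) hγ v).mono_left
      (nhdsWithin_mono v Set.Ioi_subset_Ici_self)
    exact ge_of_tendsto hT (eventually_nhdsWithin_of_forall fun w hw => (h2 w hw).le)
  rcases h3.eq_or_lt with h3 | h3
  · right
    refine ⟨fun k hk => ?_, v, h3.symm⟩
    obtain ⟨v', hv', hlt⟩ := hI.holds_finish hγ hc hk
    have h4 : t < clock γ c y I.1 I.2 v' := hv' ▸ hk.2
    rw [h3, hmono.lt_iff_lt] at h4
    obtain ⟨w, hw⟩ := exists_between h4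
    exact absurd (h2 w hw.1) (not_lt.2 (hlt w hw.2))
  · left
    rcases eq_or_ne v 0 with hv0 | hv0
    · refine ⟨none, ht, ?_⟩
      rw [hI.finish_none, ← hv0]
      exact h3
    · have hvpos : 0 < v := pos_iff_ne_zero.2 hv0
      have hne : (𝓝[<] v).NeBot := nhdsLT_neBot_of_exists_lt ⟨0, hvpos⟩
      have hx : ∃ x, Jumps I x v := by
        by_contra! hx
        exact absurd (le_of_tendsto (hI.clock_tendsto_left_of_not_jumps hγ hvpos hx)
          (eventually_nhdsWithin_of_forall h1)) (not_le.2 h3)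
      obtain ⟨x, hx⟩ := hx
      obtain ⟨j, hj⟩ := (hI.exists_holds_iff hγ hc x t).2 ⟨v, hx, h1, h3⟩
      exact ⟨_, hj⟩

lemma IsRegular.position_of_holds (hI : IsRegular γ I) (hγ : ∀ x, 0 < γ x) (hc : 0 ≤ c)
    {k : Option (ℕ+ × ℕ)} {t : ℝ} (h : Holds γ c y k t I) : position γ c y t I = label y k := by
  classical
  unfold position
  rcases k with _ | ⟨x, j⟩
  · rw [if_pos h]
    rfl
  · have hn : ¬ Holds γ c y none t I := fun h' => by simpa using hI.holds_unique hγ hc h' h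
    have hex : ∃ x : ℕ+, ∃ j, Holds γ c y (some (x, j)) t I := ⟨x, j, h⟩
    rw [if_neg hn, leastState, dif_pos hex]
    obtain ⟨j', hj'⟩ := PNat.find_spec hex
    have := hI.holds_unique hγ hc hj' h
    simp only [Option.some.injEq, Prod.mk.injEq] at this
    rw [this.1]
    rfl

lemma position_of_not_holds {t : ℝ} (h : ∀ k, ¬ Holds γ c y k t I) :
    position γ c y t I = OnePoint.infty := by
  unfold position
  rw [if_neg (h none), leastState, dif_neg]
  rintro ⟨x, j, hj⟩
  exact h _ hj

lemma IsRegular.position_eq_coe_iff (hI : IsRegular γ I) (hγ : ∀ x, 0 < γ x) (hc : 0 ≤ c)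
    {t : ℝ} (x : ℕ+) :
    position γ c y t I = x ↔ ∃ k, Holds γ c y k t I ∧ label y k = x := by
  constructor
  · intro h
    by_cases hk : ∃ k, Holds γ c y k t I
    · obtain ⟨k, hk⟩ := hk
      exact ⟨k, hk, (hI.position_of_holds hγ hc hk).symm.trans h⟩
    · rw [position_of_not_holds (not_exists.1 hk)] at h
      exact absurd h (OnePoint.infty_ne_coe x)
  · rintro ⟨k, hk, hx⟩
    rw [hI.position_of_holds hγ hc hk, hx]

lemma not_holds_none_infty {t : ℝ} : ¬ Holds γ c OnePoint.infty none t I := by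
  rintro ⟨h1, h2⟩
  have : finish γ c OnePoint.infty none I = 0 := by
    change 0 + 0 * I.2 none = 0
    ring
  rw [this] at h2
  exact absurd h2 (not_lt.2 h1)

/-- At most one state is eligible at any time, so the arbitrary choice in `path` and the least
element in `position` agree. -/
lemma IsRegular.path_eq (hI : IsRegular γ I) (hγ : ∀ x, 0 < γ x) (hc : 0 ≤ c) (t : ℝ≥0) :
    path γ c y I.1 I.2 t = position γ c y t I := by
  unfold path
  by_cases h0 : Holds γ c y none t I
  · have : (t : ℝ) < gammaExt γ y * I.2 none := by
      have := h0.2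
      rwa [hI.finish_none, hI.clock_zero] at this
    rw [if_pos this, hI.position_of_holds hγ hc h0]
    rfl
  · have hn : ¬ (t : ℝ) < gammaExt γ y * I.2 none := fun h => h0 ⟨t.2, by
      rwa [hI.finish_none, hI.clock_zero]⟩
    rw [if_neg hn]
    by_cases h : ∃ x : ℕ+, SitsAt γ c y I.1 I.2 t x
    · rw [dif_pos h]
      obtain ⟨j, hj⟩ := (hI.exists_holds_iff hγ hc _ t).2
        ((hI.sitsAt_iff hγ hc t _).1 h.choose_spec)
      exact (hI.position_of_holds hγ hc hj).symm
    · rw [dif_neg h, position_of_not_holds]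
      rintro (_ | ⟨x, j⟩) hk
      · exact h0 hk
      · exact h ⟨x, (hI.sitsAt_iff hγ hc t x).2 ((hI.exists_holds_iff hγ hc x t).1 ⟨j, hk⟩)⟩

/-! ### Right continuity and left limits -/

/-- Compact sets of the discrete space are finite, so a neighbourhood of ∞ excludes only finitely
many integers. -/
lemma tendsto_infty_of_forall_ne {α : Type*} {f : α → State} {l : Filter α}
    (h : ∀ x : ℕ+, ∀ᶠ a in l, f a ≠ x) : Tendsto f l (𝓝 OnePoint.infty) := by
  rw [OnePoint.hasBasis_nhds_infty.tendsto_right_iff]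
  rintro s ⟨-, hs⟩
  have hfin : s.Finite := hs.finite_of_discrete
  filter_upwards [(hfin.eventually_all).2 fun x _ => h x] with a ha
  by_cases hinf : f a = OnePoint.infty
  · exact Or.inr hinf
  · obtain ⟨x, hx⟩ := OnePoint.ne_infty_iff_exists.1 hinf
    refine Or.inl ⟨x, fun hxs => ha x hxs hx.symm, hx⟩

/-- Inside a holding interval the path is constant to the right. If t = Γ(v), the process of x has
no event in (v, b] for some b > v, so the path avoids x on [t, Γ(b)). -/
lemma IsRegular.position_rightCont (hI : IsRegular γ I) (hγ : ∀ x, 0 < γ x) (hc : 0 ≤ c) {t : ℝ}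
    (ht : 0 ≤ t) : ContinuousWithinAt (fun t => position γ c y t I) (Set.Ici t) t := by
  have hmono : StrictMono (clock γ c y I.1 I.2) := hI.clock_strictMono hγ hc
  change Tendsto _ _ (𝓝 (position γ c y t I))
  rcases hI.holds_or (c := c) (y := y) hγ hc ht with ⟨k, hk⟩ | ⟨hn, v, hv⟩
  · rw [hI.position_of_holds hγ hc hk]
    refine tendsto_const_nhds.congr' ?_
    filter_upwards [Ico_mem_nhdsGE hk.2] with u hu
    exact (hI.position_of_holds hγ hc ⟨hk.1.trans hu.1, hu.2⟩).symm
  · rw [position_of_not_holds hn]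
    refine tendsto_infty_of_forall_ne fun x => ?_
    obtain ⟨b, hb, hxb⟩ := hI.rightCont x v
    have htb : t < clock γ c y I.1 I.2 b := hv ▸ hmono hb
    filter_upwards [Ico_mem_nhdsGE htb] with u hu hux
    obtain ⟨k, hk, hkx⟩ := (hI.position_eq_coe_iff hγ hc x).1 hux
    rcases k with _ | ⟨x', j⟩
    · have h1 := hk.2
      rw [hI.finish_none] at h1
      have h2 := hmono.monotone (zero_le (a := v))
      linarith [hu.1]
    · obtain rfl : x' = x := OnePoint.coe_injective hkx
      obtain ⟨v', hJ, h1, h2⟩ := (hI.exists_holds_iff hγ hc x' u).1 ⟨j, hk⟩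
      have hvv : v < v' := hmono.lt_iff_lt.1 (by linarith [hu.1])
      have hvb : v' ≤ b := by
        by_contra! hlt
        linarith [h1 b hlt, hu.2]
      have h3 := hJ.2 v hvv
      have h4 := hI.mono x' hvb
      omega

/-- If t lies in (start, finish] of some interval, the path is constant just before t. Otherwise let
v be the first clock time with Γ(v) ≥ t: the clock comes arbitrarily close to t before v, and x has
no event in some (w, v), so the path avoids x on [Γ(w), t). -/
lemma IsRegular.position_leftLim (hI : IsRegular γ I) (hγ : ∀ x, 0 < γ x) (hc : 0 ≤ c) {t : ℝ}
    (ht : 0 < t) : ∃ l, Tendsto (fun t => position γ c y t I) (𝓝[<] t) (𝓝 l) := by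
  have hmono : StrictMono (clock γ c y I.1 I.2) := hI.clock_strictMono hγ hc
  by_cases hex : ∃ k, start γ c y k I < t ∧ t ≤ finish γ c y k I
  · obtain ⟨k, hk1, hk2⟩ := hex
    refine ⟨label y k, tendsto_const_nhds.congr' ?_⟩
    filter_upwards [Ico_mem_nhdsLT hk1] with u hu
    exact (hI.position_of_holds hγ hc ⟨hu.1, hu.2.trans_le hk2⟩).symm
  · push Not at hex
    refine ⟨OnePoint.infty, tendsto_infty_of_forall_ne fun x => ?_⟩
    set S : Set ℝ≥0 := {v | t ≤ clock γ c y I.1 I.2 v} with hS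
    obtain ⟨v₀, hv₀⟩ := hI.clock_tendsto_atTop (c := c) (y := y) hγ hc t
    have hSne : S.Nonempty := ⟨v₀, hv₀.le⟩
    set v := sInf S with hv
    have h1 : ∀ w, w < v → clock γ c y I.1 I.2 w < t := fun w hw =>
      not_le.1 fun h => (csInf_le (OrderBot.bddBelow S) h).not_gt hw
    have h3 : t ≤ clock γ c y I.1 I.2 v := by
      have hT := (hI.clock_rightCont (c := c) (y := y) hγ v).mono_left
        (nhdsWithin_mono v Set.Ioi_subset_Ici_self)
      refine ge_of_tendsto hT (eventually_nhdsWithin_of_forall fun w hw => ?_)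
      obtain ⟨u, hu, huw⟩ := exists_lt_of_csInf_lt hSne hw
      exact le_trans hu (hmono huw).le
    have h0 := hex none ht
    rw [hI.finish_none] at h0
    have hvpos : 0 < v := hmono.lt_iff_lt.1 (h0.trans_le h3)
    have hne : (𝓝[<] v).NeBot := nhdsLT_neBot_of_exists_lt ⟨0, hvpos⟩
    -- the clock reaches `t` from the left at `v`
    have hlim : ∀ s, s < t → ∃ w, w < v ∧ s < clock γ c y I.1 I.2 w := by
      intro s hs
      by_cases hx : ∃ x, Jumps I x v
      · obtain ⟨x, hx⟩ := hx
        obtain ⟨j, -, hj⟩ := hI.eventTime_of_jumps hx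
        have hst : t ≤ start γ c y (some (x, j)) I := by
          by_contra! hlt
          have := hex _ hlt
          rw [hI.finish_some hγ hc, hj] at this
          linarith
        by_contra! hcon
        rw [← hj] at hcon
        linarith [(hI.start_le_iff hγ hc x j s).2 hcon]
      · push Not at hx
        have hl := hI.clock_tendsto_left_of_not_jumps (c := c) (y := y) hγ hvpos hx
        obtain ⟨w, hw1, hw2⟩ := ((hl.eventually (lt_mem_nhds (hs.trans_le h3))).and
          (eventually_mem_nhdsWithin (a := v) (s := Set.Iio v))).exists
        exact ⟨w, hw2, hw1⟩
    have hcount : ∃ w, w < v ∧ ∀ u, w < u → u < v → I.1 x u = I.1 x w := by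
      obtain ⟨m, hm⟩ : ∃ m, ∀ᶠ u in 𝓝[<] v, I.1 x u = m := by
        by_cases hx : Jumps I x v
        · exact ⟨_, hI.eventually_count_left_of_jumps hx⟩
        · exact ⟨_, hI.eventually_count_left_of_not_jumps hvpos hx⟩
      obtain ⟨a, ha, ham⟩ := (mem_nhdsLT_iff_exists_Ioo_subset' hvpos).1 hm
      obtain ⟨w, haw, hwv⟩ := exists_between (show a < v from ha)
      exact ⟨w, hwv, fun u h1 h2 => (ham ⟨haw.trans h1, h2⟩ : I.1 x u = m).trans
        (ham ⟨haw, hwv⟩ : I.1 x w = m).symm⟩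
    obtain ⟨w, hwv, hw⟩ := hcount
    filter_upwards [Ico_mem_nhdsLT (h1 w hwv)] with u hu hux
    obtain ⟨k, hk, hkx⟩ := (hI.position_eq_coe_iff hγ hc x).1 hux
    rcases k with _ | ⟨x', j⟩
    · have h1 := hk.2
      rw [hI.finish_none] at h1
      have h2 := hmono.monotone (zero_le (a := w))
      linarith [hu.1]
    · obtain rfl : x' = x := OnePoint.coe_injective hkx
      obtain ⟨v', hJ, h4, h5⟩ := (hI.exists_holds_iff hγ hc x' u).1 ⟨j, hk⟩
      have hwv' : w < v' := hmono.lt_iff_lt.1 (by linarith [hu.1])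
      have hv'v : v' < v := by
        by_contra! hle
        obtain ⟨w', hw', hlt⟩ := hlim u hu.2
        linarith [h4 w' (hw'.trans_le hle)]
      have h6 := hJ.2 w hwv'
      have h7 := hw v' hwv' hv'v
      omega

lemma IsRegular.isCadlag_path (hI : IsRegular γ I) (hγ : ∀ x, 0 < γ x) (hc : 0 ≤ c) :
    IsCadlag fun t => path γ c y I.1 I.2 t := by
  simp only [hI.path_eq hγ hc]
  intro t
  constructor
  · refine ContinuousWithinAt.comp (t := Set.Ici (t : ℝ)) (hI.position_rightCont hγ hc t.2)
      NNReal.continuous_coe.continuousWithinAt fun u hu => ?_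
    exact_mod_cast hu
  · rcases eq_or_ne t 0 with rfl | ht
    -- The left neighbourhood filter at 0 is trivial, so any state serves as a limit.
    · exact ⟨y, by simp⟩
    · obtain ⟨l, hl⟩ := hI.position_leftLim (c := c) (y := y) hγ hc
        (show (0 : ℝ) < t by exact_mod_cast pos_iff_ne_zero.2 ht)
      refine ⟨l, hl.comp ?_⟩
      refine tendsto_nhdsWithin_iff.2 ⟨(NNReal.continuous_coe.tendsto t).mono_left
        nhdsWithin_le_nhds, eventually_nhdsWithin_of_forall fun u hu => ?_⟩
      exact_mod_cast hu

end KConstruction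

namespace KConstruction

variable {γ : ℕ+ → ℝ} {c : ℝ} {y : State} {I J : Input}

/-! ### Inputs that agree up to some clock time -/

lemma IsRegular.eventTime_congr (hI : IsRegular γ I) (hJ : IsRegular γ J) {u : ℝ≥0} {x : ℕ+}
    (hn : ∀ w, w ≤ u → I.1 x w = J.1 x w) {j : ℕ} (hj : eventTime (I.1 x) (j + 1) ≤ u) :
    eventTime (J.1 x) (j + 1) = eventTime (I.1 x) (j + 1) := by
  refine eq_of_forall_ge_iff fun w => ?_
  rw [← hI.le_count_iff, ← hJ.le_count_iff]
  rcases le_total w u with h | h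
  · rw [hn w h]
  · have h1 := (hI.le_count_iff x (j + 1) u).2 hj
    exact iff_of_true ((hn u le_rfl ▸ h1).trans (hJ.mono x h)) (h1.trans (hI.mono x h))

lemma IsRegular.start_congr (hI : IsRegular γ I) (hJ : IsRegular γ J) (hγ : ∀ x, 0 < γ x)
    (hc : 0 ≤ c) {x : ℕ+} {j : ℕ}
    (hv : eventTime (J.1 x) (j + 1) = eventTime (I.1 x) (j + 1))
    (hΓ : ∀ w, w < eventTime (I.1 x) (j + 1) → clock γ c y I.1 I.2 w = clock γ c y J.1 J.2 w) :
    start γ c y (some (x, j)) J = start γ c y (some (x, j)) I := by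
  have h := hI.clock_tendsto_left_of_jumps (c := c) (y := y) hγ (hI.jumps_eventTime x j)
  rw [hI.start_some hγ hc h]
  refine hJ.start_some hγ hc ?_
  rw [hv]
  exact h.congr' (eventually_nhdsWithin_of_forall hΓ)

/-- An interval meeting times below Γ(u) has its event time at most u, so only the input up to u
matters. Agreement is asked of the clock and not of the holding variables, which lets the lemma
serve both `concat` and `setHolding`. -/
lemma IsRegular.holds_congr (hI : IsRegular γ I) (hJ : IsRegular γ J) (hγ : ∀ x, 0 < γ x)
    (hc : 0 ≤ c) {u : ℝ≥0} {r : ℝ} (hn : ∀ x w, w ≤ u → I.1 x w = J.1 x w)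
    (hΓ : ∀ w, w ≤ u → clock γ c y I.1 I.2 w = clock γ c y J.1 J.2 w)
    (hr : r < clock γ c y I.1 I.2 u) {k : Option (ℕ+ × ℕ)} (hk : Holds γ c y k r I) :
    Holds γ c y k r J ∧ finish γ c y k J = finish γ c y k I := by
  have key : start γ c y k J = start γ c y k I ∧ finish γ c y k J = finish γ c y k I := by
    rcases k with _ | ⟨x, j⟩
    · exact ⟨rfl, by rw [hI.finish_none, hJ.finish_none, hΓ 0 zero_le]⟩
    · have hv : eventTime (I.1 x) (j + 1) ≤ u := by
        by_contra! hlt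
        exact absurd (((hI.holds_some_iff hγ hc x j r).1 hk).1 u hlt) (not_le.2 hr)
      have hvJ := hI.eventTime_congr hJ (hn x) hv
      refine ⟨hI.start_congr hJ hγ hc hvJ fun w hw => hΓ w (hw.le.trans hv), ?_⟩
      rw [hI.finish_some hγ hc, hJ.finish_some hγ hc, hvJ, hΓ _ hv]
  refine ⟨?_, key.2⟩
  rw [Holds, key.1, key.2]
  exact hk

lemma IsRegular.holds_congr_iff (hI : IsRegular γ I) (hJ : IsRegular γ J) (hγ : ∀ x, 0 < γ x)
    (hc : 0 ≤ c) {u : ℝ≥0} {r : ℝ} (hn : ∀ x w, w ≤ u → I.1 x w = J.1 x w)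
    (hΓ : ∀ w, w ≤ u → clock γ c y I.1 I.2 w = clock γ c y J.1 J.2 w)
    (hr : r < clock γ c y I.1 I.2 u) (k : Option (ℕ+ × ℕ)) :
    Holds γ c y k r J ↔ Holds γ c y k r I :=
  ⟨fun h => (hJ.holds_congr hI hγ hc (fun x w hw => (hn x w hw).symm)
    (fun w hw => (hΓ w hw).symm) (hΓ u le_rfl ▸ hr) h).1,
    fun h => (hI.holds_congr hJ hγ hc hn hΓ hr h).1⟩

lemma position_congr {r r' : ℝ} (h : ∀ k, Holds γ c y k r J ↔ Holds γ c y k r' I) :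
    position γ c y r J = position γ c y r' I := by
  have h1 : (fun x : ℕ+ => ∃ j, Holds γ c y (some (x, j)) r J)
      = fun x => ∃ j, Holds γ c y (some (x, j)) r' I := by simp only [h]
  unfold position
  rw [h1]
  by_cases h0 : Holds γ c y none r' I
  · rw [if_pos h0, if_pos ((h none).2 h0)]
  · rw [if_neg h0, if_neg (mt (h none).1 h0)]

/-! ### The path after a clock time -/

/-- Translation by u in clock time and by Γ(u) in real time matches the jumps and intervals of J
with those of I after u. The comparison path starts at ∞ because γ(∞) = 0 leaves it no initial
interval. -/
lemma IsRegular.position_shift (hI : IsRegular γ I) (hJ : IsRegular γ J) (hγ : ∀ x, 0 < γ x)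
    (hc : 0 ≤ c) {u : ℝ≥0} (hn : ∀ x w, I.1 x (u + w) = I.1 x u + J.1 x w)
    (hΓ : ∀ w, clock γ c y I.1 I.2 (u + w)
      = clock γ c y I.1 I.2 u + clock γ c OnePoint.infty J.1 J.2 w) {ρ : ℝ} (hρ : 0 ≤ ρ) :
    position γ c y (clock γ c y I.1 I.2 u + ρ) I = position γ c OnePoint.infty ρ J := by
  have hmono : StrictMono (clock γ c y I.1 I.2) := hI.clock_strictMono hγ hc
  set a := clock γ c y I.1 I.2 u with ha
  have key : ∀ x : ℕ+, (∃ j, Holds γ c y (some (x, j)) (a + ρ) I) ↔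
      ∃ j, Holds γ c OnePoint.infty (some (x, j)) ρ J := by
    intro x
    rw [hI.exists_holds_iff hγ hc, hJ.exists_holds_iff hγ hc]
    constructor
    · rintro ⟨v, hv, h1, h2⟩
      have huv : u < v := hmono.lt_iff_lt.1 (by linarith)
      obtain ⟨v', rfl⟩ := exists_add_of_le huv.le
      have hv' : 0 < v' := by simpa using huv
      refine ⟨v', ⟨hv', fun w hw => ?_⟩, fun w hw => ?_, ?_⟩
      · have := hv.2 (u + w) (by gcongr)
        rw [hn, hn] at this
        omega
      · have := h1 (u + w) (by gcongr)
        rw [hΓ] at this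
        linarith
      · rw [hΓ] at h2
        linarith
    · rintro ⟨v, hv, h1, h2⟩
      -- Times w ≤ u are covered by w' = 0, so monotonicity reduces everything before u + v to times
      -- after u.
      have hlt : ∀ w, w < u + v → ∃ w', w' < v ∧ w ≤ u + w' := by
        intro w hw
        rcases le_total w u with h | h
        · exact ⟨0, hv.1, by simpa using h⟩
        · obtain ⟨w', rfl⟩ := exists_add_of_le h
          exact ⟨w', by simpa using hw, le_rfl⟩
      refine ⟨u + v, ⟨add_pos_of_nonneg_of_pos zero_le hv.1, fun w hw => ?_⟩, fun w hw => ?_, ?_⟩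
      · obtain ⟨w', hw', hle⟩ := hlt w hw
        have h3 := hI.mono x hle
        have h4 := hv.2 w' hw'
        rw [hn] at h3 ⊢
        omega
      · obtain ⟨w', hw', hle⟩ := hlt w hw
        have h3 := hmono.monotone hle
        have h4 := h1 w' hw'
        rw [hΓ] at h3
        linarith
      · rw [hΓ]
        linarith
  have hnone : ¬ Holds γ c y none (a + ρ) I := by
    rintro ⟨-, h⟩
    rw [hI.finish_none] at h
    have := hmono.monotone (zero_le (a := u))
    linarith
  unfold position
  rw [if_neg hnone, if_neg not_holds_none_infty]
  simp only [key]

/-- This is the shift at clock time u = 0: after its initial holding time, the path is the one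
started at ∞. -/
lemma IsRegular.position_infty_update_none (hI : IsRegular γ I) (hJ : IsRegular γ J)
    (hγ : ∀ x, 0 < γ x) (hc : 0 ≤ c) (h1 : I.1 = J.1) (h2 : ∀ k, I.2 (some k) = J.2 (some k))
    {ρ : ℝ} (hρ : 0 ≤ ρ) :
    position γ c y (gammaExt γ y * I.2 none + ρ) I = position γ c OnePoint.infty ρ J := by
  have hl : ∀ x t, load I x t = load J x t := fun x t => by simp only [load, h1, h2]
  rw [← hI.clock_zero (c := c)]
  refine hI.position_shift hJ hγ hc (fun x w => by rw [zero_add, hI.zero, zero_add, h1])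
    (fun w => ?_) hρ
  rw [zero_add, hI.clock_zero, clock_eq, clock_eq]
  simp only [hl]
  have : gammaExt γ OnePoint.infty = 0 := rfl
  rw [this]
  ring

lemma IsRegular.position_of_lt (hI : IsRegular γ I) (hγ : ∀ x, 0 < γ x) (hc : 0 ≤ c) {t : ℝ}
    (ht : 0 ≤ t) (h : t < gammaExt γ y * I.2 none) : position γ c y t I = y :=
  hI.position_of_holds hγ hc (k := none) ⟨ht, by rwa [hI.finish_none, hI.clock_zero]⟩

/-! ### Concatenation of inputs -/

/-- The input that follows `I` up to the clock time `u`, and a fresh input `J` afterwards. -/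
def concat (u : ℝ≥0) (I J : Input) : Input :=
  (fun x t => I.1 x (min t u) + J.1 x (t - u),
   fun k => match k with
    | none => I.2 none
    | some (x, i) => if i < I.1 x u then I.2 (some (x, i)) else J.2 (some (x, i - I.1 x u)))

lemma IsRegular.concat_count_of_le (hJ : IsRegular γ J) {u t : ℝ≥0} (h : t ≤ u) (x : ℕ+) :
    (concat u I J).1 x t = I.1 x t := by
  simp [concat, h, hJ.zero, tsub_eq_zero_of_le h]

lemma concat_count_add (u t : ℝ≥0) (x : ℕ+) :
    (concat u I J).1 x (u + t) = I.1 x u + J.1 x t := by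
  simp [concat]

lemma concat_load_add (u t : ℝ≥0) (x : ℕ+) :
    load (concat u I J) x (u + t) = load I x u + load J x t := by
  unfold load
  rw [concat_count_add, Finset.sum_range_add]
  congr 1
  · refine Finset.sum_congr rfl fun i hi => ?_
    simp [concat, Finset.mem_range.1 hi]
  · refine Finset.sum_congr rfl fun i _ => ?_
    simp [concat]

lemma IsRegular.concat_load_of_le (hI : IsRegular γ I) (hJ : IsRegular γ J) {u t : ℝ≥0}
    (h : t ≤ u) (x : ℕ+) : load (concat u I J) x t = load I x t := by
  unfold load
  rw [hJ.concat_count_of_le h]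
  refine Finset.sum_congr rfl fun i hi => ?_
  have : i < I.1 x u := (Finset.mem_range.1 hi).trans_le (hI.mono x h)
  simp [concat, this]

lemma IsRegular.concat_clock_of_le (hI : IsRegular γ I) (hJ : IsRegular γ J) {u t : ℝ≥0}
    (h : t ≤ u) : clock γ c y (concat u I J).1 (concat u I J).2 t = clock γ c y I.1 I.2 t := by
  simp only [clock_eq, hI.concat_load_of_le hJ h]
  rfl

lemma IsRegular.concat_clock_add (hI : IsRegular γ I) (hJ : IsRegular γ J) (u t : ℝ≥0) :
    clock γ c y (concat u I J).1 (concat u I J).2 (u + t)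
      = clock γ c y I.1 I.2 u + clock γ c OnePoint.infty J.1 J.2 t := by
  simp only [clock_eq, concat_load_add, mul_add]
  rw [(hI.summable u).tsum_add (hJ.summable t)]
  have h1 : gammaExt γ OnePoint.infty = 0 := rfl
  have h2 : (concat u I J).2 none = I.2 none := rfl
  rw [h1, h2]
  push_cast
  ring

/-- At the seam t = u, conditions looking to the right are read off J at 0, and those looking to the
left off I at u. Hence the different case splits. -/
lemma IsRegular.concat (hI : IsRegular γ I) (hJ : IsRegular γ J) (u : ℝ≥0) :
    IsRegular γ (concat u I J) where
  mono x s t h := add_le_add (hI.mono x (min_le_min_right u h)) (hJ.mono x (tsub_le_tsub_right h u))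
  zero x := by simp [KConstruction.concat, hI.zero, hJ.zero]
  rightCont x t := by
    rcases lt_or_ge t u with h | h
    · obtain ⟨b, hb, h1⟩ := hI.rightCont x t
      refine ⟨min b u, lt_min hb h, ?_⟩
      rw [hJ.concat_count_of_le (min_le_right _ _), hJ.concat_count_of_le h.le]
      exact hI.count_eq (le_min hb.le h.le) (min_le_left _ _) h1
    · obtain ⟨t', rfl⟩ := exists_add_of_le h
      obtain ⟨b, hb, h1⟩ := hJ.rightCont x t'
      exact ⟨u + b, by gcongr, by rw [concat_count_add, concat_count_add, h1]⟩
  unbounded x k := by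
    obtain ⟨t, ht⟩ := hJ.unbounded x k
    exact ⟨u + t, by rw [concat_count_add]; omega⟩
  jump_le x t ht := by
    rcases le_or_gt t u with h | h
    · obtain ⟨w, hw, h1⟩ := hI.jump_le x t ht
      refine ⟨w, hw, ?_⟩
      rwa [hJ.concat_count_of_le h, hJ.concat_count_of_le (hw.le.trans h)]
    · obtain ⟨t', rfl⟩ := exists_add_of_le h.le
      obtain ⟨w, hw, h1⟩ := hJ.jump_le x t' (by simpa using h)
      refine ⟨u + w, by gcongr, ?_⟩
      rw [concat_count_add, concat_count_add]
      omega
  no_common x x' hx t ht := by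
    rcases le_or_gt t u with h | h
    · obtain ⟨w, hw, h1⟩ := hI.no_common x x' hx t ht
      refine ⟨w, hw, ?_⟩
      rwa [hJ.concat_count_of_le h, hJ.concat_count_of_le (hw.le.trans h),
        hJ.concat_count_of_le h, hJ.concat_count_of_le (hw.le.trans h)]
    · obtain ⟨t', rfl⟩ := exists_add_of_le h.le
      obtain ⟨w, hw, h1⟩ := hJ.no_common x x' hx t' (by simpa using h)
      refine ⟨u + w, by gcongr, ?_⟩
      simp only [concat_count_add]
      omega
  dense a b hab := by
    rcases lt_or_ge a u with h | h
    · obtain ⟨x, hx⟩ := hI.dense a (min b u) (lt_min hab h)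
      refine ⟨x, ?_⟩
      rw [hJ.concat_count_of_le h.le]
      exact hx.trans_le (Nat.le_add_right _ _)
    · obtain ⟨a', rfl⟩ := exists_add_of_le h
      obtain ⟨b', rfl⟩ := exists_add_of_le (h.trans hab.le)
      obtain ⟨x, hx⟩ := hJ.dense a' b' (by simpa using hab)
      exact ⟨x, by simpa [concat_count_add] using hx⟩
  pos k := by
    rcases k with _ | ⟨x, i⟩
    · exact hI.pos none
    · simp only [KConstruction.concat]
      split_ifs
      · exact hI.pos _
      · exact hJ.pos _
  frequently x m := by
    obtain ⟨i, hi, h1⟩ := hJ.frequently x m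
    refine ⟨I.1 x u + i, by omega, ?_⟩
    simpa [KConstruction.concat] using h1
  summable t := by
    rcases le_total t u with h | h
    · simpa only [hI.concat_load_of_le hJ h] using hI.summable t
    · obtain ⟨t', rfl⟩ := exists_add_of_le h
      simpa only [concat_load_add, mul_add] using (hI.summable u).add (hJ.summable t')

lemma IsRegular.concat_holds_iff (hI : IsRegular γ I) (hJ : IsRegular γ J) (hγ : ∀ x, 0 < γ x)
    (hc : 0 ≤ c) {u : ℝ≥0} {r : ℝ} (hr : r < clock γ c y I.1 I.2 u) (k : Option (ℕ+ × ℕ)) :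
    Holds γ c y k r (KConstruction.concat u I J) ↔ Holds γ c y k r I :=
  hI.holds_congr_iff (hI.concat hJ u) hγ hc (fun x _ hw => (hJ.concat_count_of_le hw x).symm)
    (fun _ hw => (hI.concat_clock_of_le hJ hw).symm) hr k

lemma IsRegular.concat_finish (hI : IsRegular γ I) (hJ : IsRegular γ J) (hγ : ∀ x, 0 < γ x)
    (hc : 0 ≤ c) {u : ℝ≥0} {r : ℝ} (hr : r < clock γ c y I.1 I.2 u) {k : Option (ℕ+ × ℕ)}
    (hk : Holds γ c y k r I) :
    finish γ c y k (KConstruction.concat u I J) = finish γ c y k I :=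
  (hI.holds_congr (hI.concat hJ u) hγ hc (fun x _ hw => (hJ.concat_count_of_le hw x).symm)
    (fun _ hw => (hI.concat_clock_of_le hJ hw).symm) hr hk).2

lemma IsRegular.concat_position (hI : IsRegular γ I) (hJ : IsRegular γ J) (hγ : ∀ x, 0 < γ x)
    (hc : 0 ≤ c) {u : ℝ≥0} {r : ℝ} (hr : r < clock γ c y I.1 I.2 u) :
    position γ c y r (KConstruction.concat u I J) = position γ c y r I :=
  position_congr (hI.concat_holds_iff hJ hγ hc hr)

lemma IsRegular.concat_position_after (hI : IsRegular γ I) (hJ : IsRegular γ J)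
    (hγ : ∀ x, 0 < γ x) (hc : 0 ≤ c) (u : ℝ≥0) {ρ : ℝ} (hρ : 0 ≤ ρ) :
    position γ c y (clock γ c y I.1 I.2 u + ρ) (KConstruction.concat u I J)
      = position γ c OnePoint.infty ρ J := by
  have h0 : clock γ c y (KConstruction.concat u I J).1 (KConstruction.concat u I J).2 u
      = clock γ c y I.1 I.2 u := hI.concat_clock_of_le hJ le_rfl
  rw [← h0]
  refine (hI.concat hJ u).position_shift hJ hγ hc (fun x w => ?_) (fun w => ?_) hρ
  · rw [concat_count_add, hJ.concat_count_of_le le_rfl]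
  · rw [hI.concat_clock_add hJ, h0]

/-! ### Changing one holding variable -/

/-- The input `I` with the holding variable number `k` replaced by `e`. -/
def setHolding (k : Option (ℕ+ × ℕ)) (e : ℝ) (I : Input) : Input :=
  (I.1, Function.update I.2 k e)

lemma setHolding_load_of_le {x₀ : ℕ+} {j : ℕ} {t : ℝ≥0} (h : I.1 x₀ t ≤ j) (e : ℝ) (x : ℕ+) :
    load (setHolding (some (x₀, j)) e I) x t = load I x t := by
  refine Finset.sum_congr rfl fun i hi => ?_
  have hi' : i < I.1 x t := Finset.mem_range.1 hi
  refine Function.update_of_ne ?_ _ _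
  rintro heq
  simp only [Option.some.injEq, Prod.mk.injEq] at heq
  obtain ⟨rfl, rfl⟩ := heq
  omega

lemma setHolding_load_of_ne {k : Option (ℕ+ × ℕ)} {x : ℕ+} (h : ∀ i, some (x, i) ≠ k) (e : ℝ)
    (t : ℝ≥0) : load (setHolding k e I) x t = load I x t :=
  Finset.sum_congr rfl fun i _ => Function.update_of_ne (h i) _ _

/-- One changed entry affects neither the tail of a row nor the series of loads outside a single
row. -/
lemma IsRegular.setHolding (hI : IsRegular γ I) (k : Option (ℕ+ × ℕ)) {e : ℝ} (he : 0 < e) :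
    IsRegular γ (setHolding k e I) where
  mono := hI.mono
  zero := hI.zero
  rightCont := hI.rightCont
  unbounded := hI.unbounded
  jump_le := hI.jump_le
  no_common := hI.no_common
  dense := hI.dense
  pos l := by
    by_cases h : l = k
    · subst h
      simpa [KConstruction.setHolding] using he
    · simpa [KConstruction.setHolding, Function.update_of_ne h] using hI.pos l
  frequently x m := by
    obtain ⟨M, hM⟩ : ∃ M : ℕ, ∀ i, M ≤ i → some (x, i) ≠ k := by
      rcases k with _ | ⟨x', j⟩
      · exact ⟨0, by simp⟩
      · refine ⟨j + 1, fun i hi h => ?_⟩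
        simp only [Option.some.injEq, Prod.mk.injEq] at h
        omega
    obtain ⟨i, hi, h1⟩ := hI.frequently x (max m M)
    refine ⟨i, (le_max_left _ _).trans hi, ?_⟩
    simpa [KConstruction.setHolding,
      Function.update_of_ne (hM i ((le_max_right _ _).trans hi))] using h1
  summable t := by
    rcases k with _ | ⟨x₀, j⟩
    · simpa only [setHolding_load_of_ne (I := I) (k := none) (fun i => Option.some_ne_none _)]
        using hI.summable t
    · refine (hI.summable t).congr_cofinite ?_
      filter_upwards [(Set.finite_singleton x₀).compl_mem_cofinite] with x hx
      rw [setHolding_load_of_ne]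
      rintro i h
      simp only [Option.some.injEq, Prod.mk.injEq] at h
      exact hx h.1

lemma setHolding_clock_of_le {x₀ : ℕ+} {j : ℕ} {t : ℝ≥0} (h : I.1 x₀ t ≤ j) (e : ℝ) :
    clock γ c y (setHolding (some (x₀, j)) e I).1 (setHolding (some (x₀, j)) e I).2 t
      = clock γ c y I.1 I.2 t := by
  simp only [clock_eq, setHolding_load_of_le h]
  simp [setHolding]

/-- A holding variable enters the clock only from its own event time on, hence not in the left limit
there. -/
lemma IsRegular.setHolding_start (hI : IsRegular γ I) (hγ : ∀ x, 0 < γ x)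
    (hc : 0 ≤ c) (k : Option (ℕ+ × ℕ)) {e : ℝ} (he : 0 < e) :
    start γ c y k (KConstruction.setHolding k e I) = start γ c y k I := by
  rcases k with _ | ⟨x, j⟩
  · rfl
  · refine hI.start_congr (hI.setHolding _ he) hγ hc rfl fun w hw => ?_
    rw [setHolding_clock_of_le]
    exact Nat.lt_succ_iff.1 ((hI.count_lt_iff x _ w).2 hw)

lemma IsRegular.setHolding_finish (hI : IsRegular γ I) (hγ : ∀ x, 0 < γ x)
    (hc : 0 ≤ c) (k : Option (ℕ+ × ℕ)) {e : ℝ} (he : 0 < e) :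
    finish γ c y k (KConstruction.setHolding k e I) = start γ c y k I + weight γ y k * e := by
  rw [finish, hI.setHolding_start hγ hc k he]
  simp [KConstruction.setHolding]

/-- The path up to a time of the holding interval number `k` does not depend on the value of the
holding variable number `k`, as long as the interval contains that time. -/
lemma IsRegular.setHolding_position (hI : IsRegular γ I) (hγ : ∀ x, 0 < γ x)
    (hc : 0 ≤ c) {k : Option (ℕ+ × ℕ)} {e e' s r : ℝ} (he : 0 < e) (he' : 0 < e')
    (hs : s < start γ c y k I + weight γ y k * e) (hs' : s < start γ c y k I + weight γ y k * e')
    (hr : 0 ≤ r) (hrs : r ≤ s) :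
    position γ c y r (KConstruction.setHolding k e I)
      = position γ c y r (KConstruction.setHolding k e' I) := by
  have hE := hI.setHolding k he
  have hE' := hI.setHolding k he'
  rcases le_or_gt (start γ c y k I) r with h | h
  · rw [hE.position_of_holds hγ hc (k := k), hE'.position_of_holds hγ hc (k := k)]
    · rw [Holds, hI.setHolding_start hγ hc k he', hI.setHolding_finish hγ hc k he']
      exact ⟨h, hrs.trans_lt hs'⟩
    · rw [Holds, hI.setHolding_start hγ hc k he, hI.setHolding_finish hγ hc k he]
      exact ⟨h, hrs.trans_lt hs⟩
  · rcases k with _ | ⟨x, j⟩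
    · exact absurd hr (not_le.2 h)
    -- Before the interval starts, r lies below Γ(u) for some u before the event time, and the clock
    -- up to u does not involve variable k.
    · obtain ⟨u, hu, hru⟩ : ∃ u, u < eventTime (I.1 x) (j + 1) ∧ r < clock γ c y I.1 I.2 u := by
        by_contra! hcon
        exact absurd ((hI.start_le_iff hγ hc x j r).2 hcon) (not_le.2 h)
      have hle : ∀ w, w ≤ u → I.1 x w ≤ j := fun w hw =>
        Nat.lt_succ_iff.1 ((hI.count_lt_iff x _ w).2 (hw.trans_lt hu))
      refine position_congr fun l => ?_
      refine hE'.holds_congr_iff hE hγ hc (u := u) (fun _ _ _ => rfl) (fun w hw => ?_) ?_ l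
      · rw [setHolding_clock_of_le (hle w hw), setHolding_clock_of_le (hle w hw)]
      · rwa [setHolding_clock_of_le (hle u le_rfl)]

end KConstruction

namespace KConstruction

variable {γ : ℕ+ → ℝ} {c : ℝ} {y : State}

/-! ### Measurability -/

/-- Serves for sums of random length and for holding variables with a random index. -/
lemma measurable_of_countable_index {α ι β : Type*} [MeasurableSpace α] [MeasurableSpace β]
    [MeasurableSpace ι] [Countable ι] [MeasurableSingletonClass ι] {m : α → ι} (hm : Measurable m)
    {f : ι → α → β} (hf : ∀ i, Measurable (f i)) : Measurable fun a => f (m a) a := by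
  have : Measurable fun p : ι × α => f p.1 p.2 := measurable_from_prod_countable_right hf
  exact this.comp (hm.prodMk measurable_id)

lemma measurable_count (x : ℕ+) (t : ℝ≥0) : Measurable fun I : Input => I.1 x t := by fun_prop

lemma measurable_holding (k : Option (ℕ+ × ℕ)) : Measurable fun I : Input => I.2 k := by fun_prop

lemma measurable_load (x : ℕ+) (t : ℝ≥0) : Measurable fun I : Input => load I x t :=
  measurable_of_countable_index (f := fun n (I : Input) => ∑ i ∈ Finset.range n, I.2 (some (x, i)))
    (measurable_count x t) fun _ => Finset.measurable_sum _ fun _ _ => measurable_holding _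

/-- A countable sum in `ℝ≥0∞` is measurable without any summability, which is the reason for the
extended clock. -/
lemma measurable_eclock (t : ℝ≥0) : Measurable fun I : Input => eclock γ c y I t := by
  unfold eclock
  have h : Measurable fun I : Input => ∑' x : ℕ+, ENNReal.ofReal (γ x * load I x t) :=
    Measurable.tsum fun x => ((measurable_load x t).const_mul _).ennreal_ofReal
  exact ((((measurable_holding none).const_mul _).ennreal_ofReal).add h).add measurable_const

lemma measurable_start (k : Option (ℕ+ × ℕ)) : Measurable (start γ c y k) := by
  rcases k with _ | ⟨x, j⟩
  · exact measurable_const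
  · refine Measurable.ennreal_toReal (Measurable.iSup fun q => ?_)
    exact Measurable.ite (measurableSet_le (measurable_count x _) measurable_const)
      (measurable_eclock _) measurable_const

lemma measurable_finish (k : Option (ℕ+ × ℕ)) : Measurable (finish γ c y k) :=
  (measurable_start k).add ((measurable_holding k).const_mul _)

lemma measurableSet_holds (k : Option (ℕ+ × ℕ)) :
    MeasurableSet {p : ℝ × Input | Holds γ c y k p.1 p.2} :=
  (measurableSet_le ((measurable_start k).comp measurable_snd) measurable_fst).inter
    (measurableSet_lt measurable_fst ((measurable_finish k).comp measurable_snd))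

instance : Countable State := inferInstanceAs (Countable (Option ℕ+))

lemma leastState_eq_coe_iff {p : ℕ+ → Prop} (x : ℕ+) :
    leastState p = x ↔ p x ∧ ∀ x', x' < x → ¬ p x' := by
  classical
  unfold leastState
  by_cases h : ∃ x, p x
  · rw [dif_pos h, OnePoint.coe_eq_coe, PNat.find_eq_iff]
  · rw [dif_neg h]
    exact iff_of_false (OnePoint.infty_ne_coe x) fun h' => h ⟨x, h'.1⟩

lemma leastState_eq_infty_iff {p : ℕ+ → Prop} :
    leastState p = OnePoint.infty ↔ ∀ x, ¬ p x := by
  unfold leastState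
  by_cases h : ∃ x, p x
  · rw [dif_pos h]
    exact iff_of_false (OnePoint.coe_ne_infty _) fun h' => h.elim h'
  · rw [dif_neg h]
    exact iff_of_true rfl (not_exists.1 h)

/-- Taking the least candidate makes each fibre a countable Boolean combination of the given events,
which an unspecified choice would not. -/
lemma measurable_leastState {α : Type*} [MeasurableSpace α] {p : α → ℕ+ → Prop}
    (hp : ∀ x, MeasurableSet {a | p a x}) : Measurable fun a => leastState (p a) := by
  refine measurable_to_countable' fun z => ?_
  induction z using OnePoint.rec with
  | infty =>
    have : (fun a => leastState (p a)) ⁻¹' {OnePoint.infty} = ⋂ x, {a | p a x}ᶜ := by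
      ext a
      simp [leastState_eq_infty_iff]
    rw [this]
    exact MeasurableSet.iInter fun x => (hp x).compl
  | coe x =>
    have : (fun a => leastState (p a)) ⁻¹' {(x : State)}
        = {a | p a x} ∩ ⋂ x', ⋂ (_ : x' < x), {a | p a x'}ᶜ := by
      ext a
      simp [leastState_eq_coe_iff]
    rw [this]
    exact (hp x).inter (MeasurableSet.iInter fun x' => MeasurableSet.iInter fun _ => (hp x').compl)

lemma measurable_position_uncurry :
    Measurable fun p : ℝ × Input => position γ c y p.1 p.2 := by
  refine Measurable.ite (measurableSet_holds none) measurable_const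
    (measurable_leastState fun x => ?_)
  rw [Set.ofPred_exists]
  exact MeasurableSet.iUnion fun j => measurableSet_holds _

lemma measurable_position (t : ℝ) : Measurable (position γ c y t) :=
  measurable_position_uncurry.comp (measurable_const.prodMk measurable_id)

lemma measurable_concat (u : ℝ≥0) : Measurable fun p : Input × Input => concat u p.1 p.2 := by
  refine Measurable.prodMk ?_ ?_
  · refine measurable_pi_lambda _ fun x => measurable_pi_lambda _ fun t => ?_
    exact ((measurable_count x _).comp measurable_fst).add
      ((measurable_count x _).comp measurable_snd)
  · refine measurable_pi_lambda _ fun k => ?_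
    rcases k with _ | ⟨x, i⟩
    · exact (measurable_holding none).comp measurable_fst
    · have hm : Measurable fun p : Input × Input => p.1.1 x u :=
        (measurable_count x u).comp measurable_fst
      refine Measurable.ite (measurableSet_lt measurable_const hm)
        ((measurable_holding _).comp measurable_fst) ?_
      exact measurable_of_countable_index
        (f := fun n (p : Input × Input) => p.2.2 (some (x, i - n))) hm
        fun n => (measurable_holding _).comp measurable_snd

lemma measurable_setHolding (k : Option (ℕ+ × ℕ)) :
    Measurable fun p : ℝ × Input => setHolding k p.1 p.2 := by
  refine Measurable.prodMk (measurable_fst.comp measurable_snd) ?_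
  refine measurable_pi_lambda _ fun l => ?_
  by_cases h : l = k
  · subst h
    simpa using measurable_fst
  · simp only [Function.update_of_ne h]
    exact (measurable_holding l).comp measurable_snd

end KConstruction

namespace KConstruction

/-! ### Product measures -/

/-- Coordinatewise maps of pairs of independent families. -/
lemma map_infinitePi_prod {ι X Y Z : Type*} [MeasurableSpace X] [MeasurableSpace Y]
    [MeasurableSpace Z] (μ : ι → Measure X) (ν : ι → Measure Y) (ρ : ι → Measure Z)
    [∀ i, IsProbabilityMeasure (μ i)] [∀ i, IsProbabilityMeasure (ν i)]
    [∀ i, IsProbabilityMeasure (ρ i)] {g : X × Y → Z} (hg : Measurable g)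
    (h : ∀ i, ((μ i).prod (ν i)).map g = ρ i) :
    ((Measure.infinitePi μ).prod (Measure.infinitePi ν)).map (fun p i => g (p.1 i, p.2 i))
      = Measure.infinitePi ρ := by
  refine Measure.eq_infinitePi ρ fun s t ht => ?_
  have hm : Measurable fun (p : (ι → X) × (ι → Y)) i => g (p.1 i, p.2 i) := by fun_prop
  rw [Measure.map_apply hm (MeasurableSet.pi s.countable_toSet fun i _ => ht i)]
  -- Only the coordinates in s matter. On them the pair of families becomes a family of pairs, so
  -- the finite product formula applies.
  have hset : (fun (p : (ι → X) × (ι → Y)) i => g (p.1 i, p.2 i)) ⁻¹' (Set.pi s t)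
      = Prod.map s.restrict s.restrict ⁻¹' ((MeasurableEquiv.arrowProdEquivProdArrow X Y s).symm ⁻¹'
        (Set.univ.pi fun i : s => g ⁻¹' t i)) := by
    ext p
    simp [MeasurableEquiv.arrowProdEquivProdArrow, Equiv.arrowProdEquivProdArrow]
  have hbox : MeasurableSet (Set.univ.pi fun i : s => g ⁻¹' t i) :=
    MeasurableSet.univ_pi fun i => hg (ht i)
  rw [hset, ← Measure.map_apply (by fun_prop)
    ((MeasurableEquiv.arrowProdEquivProdArrow X Y s).symm.measurable hbox),
    ← Measure.map_prod_map _ _ (by fun_prop) (by fun_prop), Measure.infinitePi_map_restrict,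
    Measure.infinitePi_map_restrict,
    ((measurePreserving_arrowProdEquivProdArrow X Y s (fun i => μ i) (fun i => ν i)).symm
      ).measure_preimage hbox.nullMeasurableSet, Measure.pi_pi, ← Finset.prod_coe_sort s]
  refine Finset.prod_congr rfl fun i _ => ?_
  rw [← Measure.map_apply hg (ht i), h]

/-- Replacing one coordinate of an independent family by an independent copy. -/
lemma map_infinitePi_update {ι X : Type*} [DecidableEq ι] [MeasurableSpace X] (μ : ι → Measure X)
    [∀ i, IsProbabilityMeasure (μ i)] (k : ι) :
    ((μ k).prod (Measure.infinitePi μ)).map (fun p => Function.update p.2 k p.1)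
      = Measure.infinitePi μ := by
  refine Measure.eq_infinitePi μ fun s t ht => ?_
  have hm : Measurable fun p : X × (ι → X) => Function.update p.2 k p.1 := by fun_prop
  rw [Measure.map_apply hm (MeasurableSet.pi s.countable_toSet fun i _ => ht i)]
  by_cases hk : k ∈ s
  · have hset : (fun p : X × (ι → X) => Function.update p.2 k p.1) ⁻¹' (Set.pi s t)
        = t k ×ˢ Set.pi (s.erase k : Finset ι) t := by
      ext p
      simp only [Set.mem_preimage, Set.mem_pi, Finset.mem_coe, Set.mem_prod, Finset.mem_erase]
      constructor
      · intro h
        refine ⟨by simpa using h k hk, fun i hi => ?_⟩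
        simpa [Function.update_of_ne hi.1] using h i hi.2
      · rintro ⟨h1, h2⟩ i hi
        by_cases hik : i = k
        · subst hik
          simpa using h1
        · simpa [Function.update_of_ne hik] using h2 i ⟨hik, hi⟩
    rw [hset, Measure.prod_prod, Measure.infinitePi_pi _ fun i _ => ht i,
      Finset.mul_prod_erase s (fun i => μ i (t i)) hk]
  · have hset : (fun p : X × (ι → X) => Function.update p.2 k p.1) ⁻¹' (Set.pi s t)
        = Set.univ ×ˢ Set.pi s t := by
      ext p
      simp only [Set.mem_preimage, Set.mem_pi, Finset.mem_coe, Set.mem_prod, Set.mem_univ, true_and]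
      refine forall₂_congr fun i hi => ?_
      have hik : i ≠ k := by
        rintro rfl
        exact hk hi
      rw [Function.update_of_ne hik]
    rw [hset, Measure.prod_prod, Measure.infinitePi_pi _ fun i _ => ht i, measure_univ, one_mul]

/-- Splicing two independent i.i.d. families: in each row `x` the first `m x` entries are taken from
the first family, the others from the second one, in order. -/
lemma map_infinitePi_splice {X : Type*} [MeasurableSpace X] (μ : Measure X)
    [IsProbabilityMeasure μ] (m : ℕ+ → ℕ) :
    ((Measure.infinitePi fun _ : Option (ℕ+ × ℕ) => μ).prod
      (Measure.infinitePi fun _ : Option (ℕ+ × ℕ) => μ)).map (fun p k => match k with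
        | none => p.1 none
        | some (x, i) => if i < m x then p.1 (some (x, i)) else p.2 (some (x, i - m x)))
      = Measure.infinitePi fun _ : Option (ℕ+ × ℕ) => μ := by
  classical
  refine Measure.eq_infinitePi _ fun s t ht => ?_
  -- `low` marks the entries taken from the first family; `down` gives the index in the second
  -- family of the other entries, and `up` inverts it there. As `down` is injective on those
  -- entries, a box pulls back to a product of two boxes.
  let low : Option (ℕ+ × ℕ) → Prop := fun k => ∀ x i, k = some (x, i) → i < m x
  let down : Option (ℕ+ × ℕ) → Option (ℕ+ × ℕ) := Option.map fun a => (a.1, a.2 - m a.1)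
  let up : Option (ℕ+ × ℕ) → Option (ℕ+ × ℕ) := Option.map fun a => (a.1, a.2 + m a.1)
  have hup : ∀ k, ¬ low k → up (down k) = k := by
    rintro (_ | ⟨x, i⟩) hk
    · rfl
    · have hi : m x ≤ i := by
        by_contra! hlt
        refine hk fun x' i' h => ?_
        simp only [Option.some.injEq, Prod.mk.injEq] at h
        obtain ⟨rfl, rfl⟩ := h
        exact hlt
      simp [up, down, Nat.sub_add_cancel hi]
  set s₁ := s.filter low
  set s₂ := s.filter fun k => ¬ low k
  have hm : Measurable fun (p : (Option (ℕ+ × ℕ) → X) × (Option (ℕ+ × ℕ) → X))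
      (k : Option (ℕ+ × ℕ)) => (match k with
        | none => p.1 none
        | some (x, i) => if i < m x then p.1 (some (x, i)) else p.2 (some (x, i - m x))) := by
    refine measurable_pi_lambda _ fun k => ?_
    rcases k with _ | ⟨x, i⟩
    · fun_prop
    · by_cases h : i < m x
      · simp only [h, if_true]
        fun_prop
      · simp only [h, if_false]
        fun_prop
  rw [Measure.map_apply hm (MeasurableSet.pi s.countable_toSet fun i _ => ht i)]
  have hset : (fun (p : (Option (ℕ+ × ℕ) → X) × (Option (ℕ+ × ℕ) → X))
      (k : Option (ℕ+ × ℕ)) => (match k with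
        | none => p.1 none
        | some (x, i) => if i < m x then p.1 (some (x, i)) else p.2 (some (x, i - m x))))
        ⁻¹' (Set.pi s t) = Set.pi s₁ t ×ˢ Set.pi (s₂.image down : Finset _) (fun k => t (up k)) := by
    ext p
    have hv : ∀ k, (match k with
        | none => p.1 none
        | some (x, i) => if i < m x then p.1 (some (x, i)) else p.2 (some (x, i - m x)))
        = if low k then p.1 k else p.2 (down k) := by
      rintro (_ | ⟨x, i⟩)
      · rw [if_pos]
        rintro x i h
        cases h
      · have : low (some (x, i)) ↔ i < m x := by
          refine ⟨fun h => h x i rfl, fun h x' i' h' => ?_⟩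
          simp only [Option.some.injEq, Prod.mk.injEq] at h'
          obtain ⟨rfl, rfl⟩ := h'
          exact h
        simp only [this]
        rfl
    simp only [Set.mem_preimage, Set.mem_pi, Finset.mem_coe, Set.mem_prod, Finset.mem_image, hv,
      forall_exists_index, and_imp, s₁, s₂, Finset.mem_filter]
    constructor
    · intro h
      refine ⟨fun k hk hl => by simpa [hl] using h k hk, fun k' k hk hl he => ?_⟩
      subst he
      rw [hup k hl]
      simpa [hl] using h k hk
    · rintro ⟨h1, h2⟩ k hk
      by_cases hl : low k
      · simpa [hl] using h1 k hk hl
      · have := h2 _ k hk hl rfl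
        rw [hup k hl] at this
        simpa [hl] using this
  have hinj : Set.InjOn down s₂ := by
    intro k hk l hl h
    rw [← hup k (Finset.mem_filter.1 hk).2, ← hup l (Finset.mem_filter.1 hl).2, h]
  rw [hset, Measure.prod_prod, Measure.infinitePi_pi _ fun i _ => ht i,
    Measure.infinitePi_pi _ fun i _ => ht _, Finset.prod_image hinj,
    ← Finset.prod_filter_mul_prod_filter_not s low]
  congr 1
  refine Finset.prod_congr rfl fun k hk => ?_
  rw [hup k (Finset.mem_filter.1 hk).2]

end KConstruction

namespace KConstruction

variable {Ω : Type*} [MeasurableSpace Ω] {P : Measure Ω}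

/-! ### The law of a Poisson process on path space -/

/-- The increments of a Poisson process of rate `r` along any finite monotone sequence of times. -/
def HasPoissonIncrements {Ω : Type*} [MeasurableSpace Ω] (Z : ℝ≥0 → Ω → ℕ) (r : ℝ≥0)
    (P : Measure Ω) : Prop :=
  ∀ n, ∀ t : Fin (n + 1) → ℝ≥0, Monotone t →
    P.map (fun ω (i : Fin n) => Z (t i.succ) ω - Z (t i.castSucc) ω)
      = Measure.pi fun i => poissonMeasure (r * (t i.succ - t i.castSucc))

lemma IsPoissonProcess.hasPoissonIncrements {Z : ℝ≥0 → Ω → ℕ} {r : ℝ≥0}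
    (hZ : IsPoissonProcess Z r P) : HasPoissonIncrements Z r P := by
  intro n t ht
  exact (iIndepFun.hasLaw_pi (fun i => hZ.law _ _ (ht i.castSucc_le_succ))
    (hZ.indepIncrements n t ht)).map_eq

instance : IsProbabilityMeasure (expMeasure 1) := isProbabilityMeasure_expMeasure one_pos

lemma IsInput.measurable_counts {N : ℕ+ → ℝ≥0 → Ω → ℕ} {T : Option (ℕ+ × ℕ) → Ω → ℝ}
    (h : IsInput N T P) : Measurable fun ω x t => N x t ω :=
  measurable_pi_lambda _ fun x => measurable_pi_lambda _ fun t => (h.poisson x).measurable t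

/-- The input as a random element. -/
def inputOf (N : ℕ+ → ℝ≥0 → Ω → ℕ) (T : Option (ℕ+ × ℕ) → Ω → ℝ) (ω : Ω) : Input :=
  (fun x t => N x t ω, fun k => T k ω)

lemma IsInput.measurable_inputOf {N : ℕ+ → ℝ≥0 → Ω → ℕ} {T : Option (ℕ+ × ℕ) → Ω → ℝ}
    (h : IsInput N T P) : Measurable (inputOf N T) :=
  h.measurable_counts.prodMk (measurable_pi_lambda _ h.measurable_exp)

variable [IsProbabilityMeasure P]

/-- The law of a counting process on path space is determined by its increments. -/
lemma map_eq_of_hasPoissonIncrements {Ω' : Type*} [MeasurableSpace Ω'] {P' : Measure Ω'}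
    [IsProbabilityMeasure P'] {Z : ℝ≥0 → Ω → ℕ} {Z' : ℝ≥0 → Ω' → ℕ} {r : ℝ≥0}
    (hm : ∀ t, Measurable (Z t)) (hm' : ∀ t, Measurable (Z' t))
    (h0 : ∀ᵐ ω ∂P, Z 0 ω = 0) (h0' : ∀ᵐ ω ∂P', Z' 0 ω = 0)
    (hmono : ∀ᵐ ω ∂P, Monotone fun t => Z t ω) (hmono' : ∀ᵐ ω ∂P', Monotone fun t => Z' t ω)
    (h : HasPoissonIncrements Z r P) (h' : HasPoissonIncrements Z' r P') :
    P.map (fun ω t => Z t ω) = P'.map (fun ω t => Z' t ω) := by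
  have hM : Measurable fun ω t => Z t ω := measurable_pi_lambda _ hm
  have hM' : Measurable fun ω t => Z' t ω := measurable_pi_lambda _ hm'
  have : IsProbabilityMeasure (P.map fun ω t => Z t ω) := Measure.isProbabilityMeasure_map hM.aemeasurable
  have hfin : ∀ K : Finset ℝ≥0, IsFiniteMeasure ((P.map fun ω t => Z t ω).map K.restrict) :=
    fun K => inferInstance
  refine IsProjectiveLimit.unique (P := fun K => (P.map fun ω t => Z t ω).map K.restrict)
    (fun K => rfl) (fun K => ?_)
  -- Prefixing time 0, where the path vanishes, lets the partial sums F of the increments recover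
  -- the values of the path on K.
  let t : Fin (K.card + 1) → ℝ≥0 := Fin.cons 0 (K.orderEmbOfFin rfl)
  have ht : Monotone t := by
    intro i j hij
    induction i using Fin.cases with
    | zero => exact zero_le
    | succ i =>
      induction j using Fin.cases with
      | zero => exact absurd hij (by simp)
      | succ j => simpa [t] using hij
  let F : (Fin K.card → ℕ) → (K → ℕ) := fun d s => ∑ j ≤ (K.orderIsoOfFin rfl).symm s, d j
  have hF : Measurable F := measurable_of_countable F
  have key : ∀ f : ℝ≥0 → ℕ, f 0 = 0 → Monotone f →
      K.restrict f = F fun i => f (t i.succ) - f (t i.castSucc) := by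
    intro f hf0 hf
    ext s
    -- The sum telescopes in ℤ; monotonicity makes the truncated differences in ℕ true ones.
    have h1 := Fin.sum_Iic_sub ((K.orderIsoOfFin rfl).symm s) (fun i => (f (t i) : ℤ))
    have h2 : t ((K.orderIsoOfFin rfl).symm s).succ = s := by
      simp only [t, Fin.cons_succ]
      rw [← Finset.coe_orderIsoOfFin_apply, OrderIso.apply_symm_apply]
    rw [h2] at h1
    have h3 : f (t 0) = 0 := hf0
    rw [h3] at h1
    have h4 : ((F (fun i => f (t i.succ) - f (t i.castSucc)) s : ℕ) : ℤ) = (f s : ℤ) := by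
      simp only [F]
      push_cast [Nat.cast_sub (hf (ht (Fin.castSucc_le_succ _)))]
      simpa using h1
    exact_mod_cast h4.symm
  change Measure.map K.restrict _ = Measure.map K.restrict _
  rw [Measure.map_map (by fun_prop) hM', Measure.map_map (by fun_prop) hM]
  have e1 : P.map (K.restrict ∘ fun ω t => Z t ω)
      = (P.map fun ω (i : Fin K.card) => Z (t i.succ) ω - Z (t i.castSucc) ω).map F := by
    rw [Measure.map_map hF (by fun_prop)]
    refine Measure.map_congr ?_
    filter_upwards [h0, hmono] with ω hω hω' using key _ hω hω'
  have e2 : P'.map (K.restrict ∘ fun ω t => Z' t ω)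
      = (P'.map fun ω (i : Fin K.card) => Z' (t i.succ) ω - Z' (t i.castSucc) ω).map F := by
    rw [Measure.map_map hF (by fun_prop)]
    refine Measure.map_congr ?_
    filter_upwards [h0', hmono'] with ω hω hω' using key _ hω hω'
  rw [e1, e2, h _ t ht, h' _ t ht]

/-- Each increment is the sum of one over the part of the interval before u and one, from the
independent copy, over the part after u. Poisson laws convolve, and the two lengths add up. -/
lemma IsPoissonProcess.hasPoissonIncrements_concat {Z : ℝ≥0 → Ω → ℕ} {r : ℝ≥0}
    (hZ : IsPoissonProcess Z r P) (u : ℝ≥0) :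
    HasPoissonIncrements (fun t (p : Ω × Ω) => Z (min t u) p.1 + Z (t - u) p.2) r (P.prod P) := by
  intro n t ht
  have hm := hZ.measurable
  have h1 := hZ.hasPoissonIncrements n (fun i => min (t i) u)
    (fun i j hij => min_le_min_right u (ht hij))
  have h2 := hZ.hasPoissonIncrements n (fun i => t i - u)
    (fun i j hij => tsub_le_tsub_right (ht hij) u)
  have h3 : (P.prod P).map (fun p (i : Fin n) =>
      (Z (min (t i.succ) u) p.1 + Z (t i.succ - u) p.2)
        - (Z (min (t i.castSucc) u) p.1 + Z (t i.castSucc - u) p.2))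
      = ((P.prod P).map (Prod.map
          (fun ω (i : Fin n) => Z (min (t i.succ) u) ω - Z (min (t i.castSucc) u) ω)
          (fun ω (i : Fin n) => Z (t i.succ - u) ω - Z (t i.castSucc - u) ω))).map
        (fun p i => (fun q : ℕ × ℕ => q.1 + q.2) (p.1 i, p.2 i)) := by
    rw [Measure.map_map (by fun_prop) (by fun_prop)]
    refine Measure.map_congr ?_
    filter_upwards [Measure.quasiMeasurePreserving_fst.ae hZ.mono,
      Measure.quasiMeasurePreserving_snd.ae hZ.mono] with p hp hp'
    ext i
    have e1 := hp (min_le_min_right u (ht i.castSucc_le_succ))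
    have e2 := hp' (tsub_le_tsub_right (ht i.castSucc_le_succ) u)
    simp only [Function.comp, Prod.map] at e1 e2 ⊢
    omega
  rw [h3, ← Measure.map_prod_map _ _ (by fun_prop) (by fun_prop), h1, h2,
    ← Measure.infinitePi_eq_pi, ← Measure.infinitePi_eq_pi, ← Measure.infinitePi_eq_pi]
  refine map_infinitePi_prod _ _ _ (g := fun q : ℕ × ℕ => q.1 + q.2) (by fun_prop) fun i => ?_
  have e := ht i.castSucc_le_succ
  change (poissonMeasure _).conv (poissonMeasure _) = _
  rw [poissonMeasure_conv_poissonMeasure]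
  congr 1
  rw [← mul_add]
  congr 1
  rcases le_total (t i.succ) u with hu | hu
  · rw [min_eq_left hu, min_eq_left (e.trans hu), tsub_eq_zero_of_le hu, zero_tsub, add_zero]
  · rcases le_total (t i.castSucc) u with hu' | hu'
    · rw [min_eq_right hu, min_eq_left hu', tsub_eq_zero_of_le hu', tsub_zero, add_comm,
        tsub_add_tsub_cancel hu hu']
    · rw [min_eq_right hu, min_eq_right hu', tsub_self, zero_add, tsub_tsub_tsub_cancel_right hu']

lemma IsPoissonProcess.map_concat {Z : ℝ≥0 → Ω → ℕ} {r : ℝ≥0}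
    (hZ : IsPoissonProcess Z r P) (u : ℝ≥0) :
    ((P.map fun ω t => Z t ω).prod (P.map fun ω t => Z t ω)).map
      (fun p t => p.1 (min t u) + p.2 (t - u)) = P.map fun ω t => Z t ω := by
  have hm := hZ.measurable
  rw [Measure.map_prod_map _ _ (by fun_prop) (by fun_prop),
    Measure.map_map (by fun_prop) (by fun_prop)]
  refine map_eq_of_hasPoissonIncrements (Z := fun t (p : Ω × Ω) => Z (min t u) p.1 + Z (t - u) p.2)
    (r := r) (by fun_prop) hm ?_ hZ.zero ?_ hZ.mono (hZ.hasPoissonIncrements_concat u)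
    hZ.hasPoissonIncrements
  · filter_upwards [Measure.quasiMeasurePreserving_fst.ae hZ.zero,
      Measure.quasiMeasurePreserving_snd.ae hZ.zero] with p hp hp'
    simp [hp, hp']
  · filter_upwards [Measure.quasiMeasurePreserving_fst.ae hZ.mono,
      Measure.quasiMeasurePreserving_snd.ae hZ.mono] with p hp hp' s t hst
    exact add_le_add (hp (min_le_min_right u hst)) (hp' (tsub_le_tsub_right hst u))

/-! ### The law of the input -/

variable {N : ℕ+ → ℝ≥0 → Ω → ℕ} {T : Option (ℕ+ × ℕ) → Ω → ℝ}

/-- The law of the family of holding variables. -/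
noncomputable abbrev holdingLaw : Measure (Option (ℕ+ × ℕ) → ℝ) :=
  Measure.infinitePi fun _ => expMeasure 1

/-- The law of the counts stays unspecified: its invariance under concatenation is all that the
Markov property takes from it. -/
lemma IsInput.map_inputOf (h : IsInput N T P) : P.map (inputOf N T)
    = (P.map fun ω x t => N x t ω).prod holdingLaw := by
  have hT : Measurable fun ω k => T k ω := measurable_pi_lambda _ h.measurable_exp
  have e := (indepFun_iff_map_prod_eq_prod_map_map h.measurable_counts.aemeasurable
    hT.aemeasurable).1 h.indep
  rw [(iIndepFun.hasLaw_infinitePi h.law_exp h.indep_exp hT.aemeasurable).map_eq] at e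
  exact e

lemma IsInput.map_counts_concat (h : IsInput N T P) (u : ℝ≥0) :
    ((P.map fun ω x t => N x t ω).prod (P.map fun ω x t => N x t ω)).map
      (fun p x t => p.1 x (min t u) + p.2 x (t - u)) = P.map fun ω x t => N x t ω := by
  have h1 := fun x => (h.poisson x).measurable
  have hM : ∀ x, Measurable fun ω t => N x t ω := fun x => measurable_pi_lambda _ (h1 x)
  have : ∀ x, IsProbabilityMeasure (P.map fun ω t => N x t ω) := fun x =>
    Measure.isProbabilityMeasure_map (hM x).aemeasurable
  have e := (iIndepFun.hasLaw_infinitePi (fun x => ⟨(hM x).aemeasurable, rfl⟩) h.indep_poisson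
    h.measurable_counts.aemeasurable).map_eq
  rw [e]
  exact map_infinitePi_prod _ _ _ (g := fun (q : (ℝ≥0 → ℕ) × (ℝ≥0 → ℕ)) t =>
    q.1 (min t u) + q.2 (t - u)) (by fun_prop) fun x => (h.poisson x).map_concat u

/-- Markov property of the input at the clock time `u`: following a fresh copy of the input from
then on does not change the law. -/
lemma IsInput.lintegral_concat (h : IsInput N T P) (u : ℝ≥0) {F : Input → ℝ≥0∞}
    (hF : Measurable F) : ∫⁻ ω, F (inputOf N T ω) ∂P
      = ∫⁻ ω, ∫⁻ ω', F (concat u (inputOf N T ω) (inputOf N T ω')) ∂P ∂P := by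
  have hI := h.measurable_inputOf
  have hFc : Measurable fun p : Input × Input => F (concat u p.1 p.2) :=
    hF.comp (measurable_concat u)
  have hN := h.measurable_counts
  set ν : Measure (ℕ+ → ℝ≥0 → ℕ) := P.map fun ω x t => N x t ω with hν
  have : IsProbabilityMeasure ν := Measure.isProbabilityMeasure_map hN.aemeasurable
  have e1 : ∫⁻ ω, ∫⁻ ω', F (concat u (inputOf N T ω) (inputOf N T ω')) ∂P ∂P
      = ∫⁻ I, ∫⁻ J, F (concat u I J) ∂(ν.prod holdingLaw) ∂(ν.prod holdingLaw) := by
    rw [← h.map_inputOf, lintegral_map hFc.lintegral_prod_right' hI]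
    refine lintegral_congr fun ω => ?_
    rw [lintegral_map (f := fun J => F (concat u (inputOf N T ω) J))
      (hFc.comp measurable_prodMk_left) hI]
  rw [e1, ← lintegral_map (f := F) hF hI, h.map_inputOf, lintegral_prod _ hF.aemeasurable,
    lintegral_prod _ hFc.lintegral_prod_right'.aemeasurable]
  -- Counts and holding variables are independent, so the counts can be frozen; the splicing
  -- positions n x u are then deterministic.
  have hsplice : ∀ n n' : ℕ+ → ℝ≥0 → ℕ, ∫⁻ τ, ∫⁻ τ', F (concat u (n, τ) (n', τ'))
      ∂holdingLaw ∂holdingLaw = ∫⁻ τ, F (fun x t => n x (min t u) + n' x (t - u), τ)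
        ∂holdingLaw := by
    intro n n'
    have hs : (holdingLaw.prod holdingLaw).map (fun p => (concat u (n, p.1) (n', p.2)).2)
        = holdingLaw := map_infinitePi_splice (expMeasure 1) (fun x => n x u)
    have hmeas : Measurable fun p : (Option (ℕ+ × ℕ) → ℝ) × (Option (ℕ+ × ℕ) → ℝ) =>
        concat u (n, p.1) (n', p.2) :=
      (measurable_concat u).comp (f := fun p : (Option (ℕ+ × ℕ) → ℝ) × (Option (ℕ+ × ℕ) → ℝ) =>
        (((n, p.1) : Input), ((n', p.2) : Input))) (by fun_prop)
    have hG : Measurable fun τ => F (fun x t => n x (min t u) + n' x (t - u), τ) :=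
      hF.comp measurable_prodMk_left
    conv_rhs => rw [← hs]
    rw [lintegral_map hG hmeas.snd]
    exact (lintegral_prod _ (hG.comp hmeas.snd).aemeasurable).symm
  have hcounts : ∫⁻ n, ∫⁻ τ, F (n, τ) ∂holdingLaw ∂ν
      = ∫⁻ n, ∫⁻ n', ∫⁻ τ, F (fun x t => n x (min t u) + n' x (t - u), τ) ∂holdingLaw ∂ν ∂ν := by
    have hG : Measurable fun n => ∫⁻ τ, F (n, τ) ∂holdingLaw := hF.lintegral_prod_right'
    have hmix : Measurable fun p : (ℕ+ → ℝ≥0 → ℕ) × (ℕ+ → ℝ≥0 → ℕ) =>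
        (fun x t => p.1 x (min t u) + p.2 x (t - u) : ℕ+ → ℝ≥0 → ℕ) := by fun_prop
    conv_lhs => rw [hν, ← h.map_counts_concat u]
    rw [lintegral_map hG hmix]
    exact lintegral_prod _ (hG.comp hmix).aemeasurable
  rw [hcounts]
  refine lintegral_congr fun n => ?_
  have hm3 : Measurable fun p : (Option (ℕ+ × ℕ) → ℝ) × ((ℕ+ → ℝ≥0 → ℕ) × (Option (ℕ+ × ℕ) → ℝ)) =>
      F (concat u (n, p.1) p.2) :=
    hFc.comp (f := fun p : (Option (ℕ+ × ℕ) → ℝ) × Input => (((n, p.1) : Input), p.2)) (by fun_prop)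
  have hm4 : Measurable fun p : (Option (ℕ+ × ℕ) → ℝ) × (ℕ+ → ℝ≥0 → ℕ) =>
      ∫⁻ τ', F (concat u (n, p.1) (p.2, τ')) ∂holdingLaw := by
    refine Measurable.lintegral_prod_right' (f := fun q : ((Option (ℕ+ × ℕ) → ℝ) ×
      (ℕ+ → ℝ≥0 → ℕ)) × (Option (ℕ+ × ℕ) → ℝ) => F (concat u (n, q.1.1) (q.1.2, q.2))) ?_
    exact hm3.comp (f := fun q : ((Option (ℕ+ × ℕ) → ℝ) × (ℕ+ → ℝ≥0 → ℕ)) ×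
      (Option (ℕ+ × ℕ) → ℝ) => (q.1.1, (q.1.2, q.2))) (by fun_prop)
  calc ∫⁻ n', ∫⁻ τ, F (fun x t => n x (min t u) + n' x (t - u), τ) ∂holdingLaw ∂ν
      = ∫⁻ n', ∫⁻ τ, ∫⁻ τ', F (concat u (n, τ) (n', τ')) ∂holdingLaw ∂holdingLaw ∂ν :=
        lintegral_congr fun n' => (hsplice n n').symm
    _ = ∫⁻ τ, ∫⁻ n', ∫⁻ τ', F (concat u (n, τ) (n', τ')) ∂holdingLaw ∂ν ∂holdingLaw :=
        (lintegral_lintegral_swap hm4.aemeasurable).symm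
    _ = ∫⁻ τ, ∫⁻ J, F (concat u (n, τ) J) ∂(ν.prod holdingLaw) ∂holdingLaw :=
        lintegral_congr fun τ =>
          (lintegral_prod _ (hm3.comp measurable_prodMk_left).aemeasurable).symm

/-- Resampling one holding variable does not change the law of the input. -/
lemma IsInput.lintegral_setHolding (h : IsInput N T P) (k : Option (ℕ+ × ℕ)) {F : Input → ℝ≥0∞}
    (hF : Measurable F) : ∫⁻ ω, F (inputOf N T ω) ∂P
      = ∫⁻ ω, ∫⁻ e, F (setHolding k e (inputOf N T ω)) ∂expMeasure 1 ∂P := by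
  have hI := h.measurable_inputOf
  have hFs : Measurable fun p : ℝ × Input => F (setHolding k p.1 p.2) :=
    hF.comp (measurable_setHolding k)
  have hN := h.measurable_counts
  set ν : Measure (ℕ+ → ℝ≥0 → ℕ) := P.map fun ω x t => N x t ω with hν
  have : IsProbabilityMeasure ν := Measure.isProbabilityMeasure_map hN.aemeasurable
  rw [← lintegral_map (f := F) hF hI, ← lintegral_map hFs.lintegral_prod_left' hI,
    h.map_inputOf, lintegral_prod _ hF.aemeasurable,
    lintegral_prod _ hFs.lintegral_prod_left'.aemeasurable]
  refine lintegral_congr fun n => ?_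
  have hG : Measurable fun τ => F (n, τ) := hF.comp measurable_prodMk_left
  have hup : Measurable fun p : ℝ × (Option (ℕ+ × ℕ) → ℝ) => Function.update p.2 k p.1 := by
    fun_prop
  conv_lhs => rw [holdingLaw, ← map_infinitePi_update (fun _ => expMeasure 1) k]
  rw [lintegral_map hG hup]
  exact lintegral_prod_symm _ (hG.comp hup).aemeasurable

end KConstruction

namespace KConstruction

/-! ### Almost sure regularity of the input -/

lemma expMeasure_real_Iic {x : ℝ} (hx : 0 ≤ x) :
    (expMeasure 1).real (Set.Iic x) = 1 - Real.exp (-x) := by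
  rw [← cdf_eq_real, cdf_expMeasure_eq one_pos, if_pos hx, one_mul]

lemma expMeasure_Ioi {x : ℝ} (hx : 0 ≤ x) :
    expMeasure 1 (Set.Ioi x) = ENNReal.ofReal (Real.exp (-x)) := by
  rw [← Set.compl_Iic, ← ofReal_measureReal, probReal_compl_eq_one_sub measurableSet_Iic,
    expMeasure_real_Iic hx, sub_sub_cancel]

lemma ae_pos_expMeasure : ∀ᵐ e ∂expMeasure 1, 0 < e := by
  have : (expMeasure 1) (Set.Iic 0) = 0 := by
    rw [← ofReal_measureReal, expMeasure_real_Iic le_rfl]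
    simp
  filter_upwards [measure_eq_zero_iff_ae_notMem.1 this] with e he using not_le.1 he

/-- The mean is bounded by the sum of the tails P(e > n), a geometric series. -/
lemma lintegral_ofReal_expMeasure_ne_top : ∫⁻ e, ENNReal.ofReal e ∂expMeasure 1 ≠ ∞ := by
  have hle : ∀ e : ℝ, ENNReal.ofReal e ≤ ∑' n : ℕ, (Set.Ioi (n : ℝ)).indicator 1 e := by
    intro e
    calc ENNReal.ofReal e ≤ ENNReal.ofReal (⌈e⌉₊ : ℝ) := ENNReal.ofReal_le_ofReal (Nat.le_ceil e)
      _ = ∑ n ∈ Finset.range ⌈e⌉₊, (Set.Ioi (n : ℝ)).indicator (1 : ℝ → ℝ≥0∞) e := by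
        rw [Finset.sum_congr rfl (g := fun _ => 1)]
        · simp
        · intro n hn
          exact Set.indicator_of_mem (Nat.lt_ceil.1 (Finset.mem_range.1 hn)) _
      _ ≤ _ := ENNReal.sum_le_tsum _
  have hs : Summable fun n : ℕ => Real.exp (-(n : ℝ)) := Real.summable_exp_neg_nat
  refine ne_top_of_le_ne_top ?_ (lintegral_mono hle)
  rw [lintegral_tsum fun n => (measurable_one.indicator measurableSet_Ioi).aemeasurable]
  simp only [lintegral_indicator_one measurableSet_Ioi, expMeasure_Ioi (Nat.cast_nonneg _)]
  rw [← ENNReal.ofReal_tsum_of_nonneg (fun n => (Real.exp_pos _).le) hs]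
  exact ENNReal.ofReal_ne_top

/-- With n ≤ 2 ^ n, the mean is bounded by the exponential series at 2r. -/
lemma lintegral_poissonMeasure_ne_top (r : ℝ≥0) : ∫⁻ n, (n : ℝ≥0∞) ∂poissonMeasure r ≠ ∞ := by
  have h1 : ∫⁻ n, (n : ℝ≥0∞) ∂poissonMeasure r
      = ∑' n : ℕ, ENNReal.ofReal (Real.exp (-r) * r ^ n / n.factorial) * n := by
    simp [poissonMeasure, lintegral_sum_measure, lintegral_smul_measure]
  have hs : Summable fun n : ℕ => (2 * r : ℝ) ^ n / n.factorial :=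
    Real.summable_pow_div_factorial _
  rw [h1]
  refine ne_top_of_le_ne_top (b := ∑' n : ℕ, ENNReal.ofReal ((2 * r : ℝ) ^ n / n.factorial)) ?_
    (ENNReal.tsum_le_tsum fun n => ?_)
  · rw [← ENNReal.ofReal_tsum_of_nonneg (fun n => by positivity) hs]
    exact ENNReal.ofReal_ne_top
  · rw [← ENNReal.ofReal_natCast, ← ENNReal.ofReal_mul (by positivity)]
    refine ENNReal.ofReal_le_ofReal ?_
    rw [div_mul_eq_mul_div]
    refine div_le_div_of_nonneg_right ?_ (by positivity)
    have h2 : (n : ℝ) ≤ 2 ^ n := by exact_mod_cast Nat.lt_two_pow_self.le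
    have h3 : Real.exp (-(r : ℝ)) ≤ 1 := by simp
    rw [mul_pow, mul_right_comm]
    refine mul_le_mul_of_nonneg_right ?_ (by positivity)
    calc Real.exp (-(r : ℝ)) * n ≤ 1 * n := mul_le_mul_of_nonneg_right h3 (Nat.cast_nonneg n)
      _ ≤ 2 ^ n := by rwa [one_mul]

lemma poissonMeasure_real_zero (r : ℝ≥0) : (poissonMeasure r).real {0} = Real.exp (-r) := by
  simp [poissonMeasure_real_singleton]

lemma poissonMeasure_one_le (r : ℝ≥0) : poissonMeasure r {n | 1 ≤ n} ≤ ENNReal.ofReal r := by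
  have : {n : ℕ | 1 ≤ n} = {0}ᶜ := by
    ext n
    simp [Nat.one_le_iff_ne_zero]
  rw [this, ← ofReal_measureReal, probReal_compl_eq_one_sub (MeasurableSet.singleton 0),
    poissonMeasure_real_zero]
  refine ENNReal.ofReal_le_ofReal ?_
  linarith [Real.add_one_le_exp (-(r : ℝ))]

/-- The probability is 1 - (1 + r) exp(-r), and exp(-r) ≥ 1 - r bounds it by 1 - (1 + r)(1 - r) =
r². -/
lemma poissonMeasure_two_le (r : ℝ≥0) :
    poissonMeasure r {n | 2 ≤ n} ≤ ENNReal.ofReal ((r : ℝ) ^ 2) := by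
  have hset : {n : ℕ | 2 ≤ n} = ({0} ∪ {1})ᶜ := by
    ext n
    simp only [Set.mem_ofPred_eq, Set.mem_compl_iff, Set.mem_union, Set.mem_singleton_iff]
    omega
  rw [hset, ← ofReal_measureReal, probReal_compl_eq_one_sub (by measurability),
    measureReal_union (by simp) (MeasurableSet.singleton 1), poissonMeasure_real_singleton,
    poissonMeasure_real_singleton]
  refine ENNReal.ofReal_le_ofReal ?_
  simp only [pow_zero, mul_one, Nat.factorial_zero, Nat.cast_one, div_one, pow_one,
    Nat.factorial_one]
  have h1 := Real.add_one_le_exp (-(r : ℝ))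
  have h2 := mul_le_mul_of_nonneg_right h1 (show (0 : ℝ) ≤ 1 + r by positivity)
  nlinarith

/-! ### Almost sure properties from independence and fine grids. -/

variable {Ω : Type*} [MeasurableSpace Ω] {P : Measure Ω}

/-- Infinitely many independent events of probability at most `q < 1` do not all occur. -/
lemma ae_exists_of_iIndepFun {ι E : Type*} [MeasurableSpace E] {f : ι → Ω → E}
    (h : iIndepFun f P) {A : Set E} (hA : MeasurableSet A) {q : ℝ≥0∞}
    (hq : q < 1) {S : Set ι} (hS : S.Infinite) (hle : ∀ i ∈ S, P (f i ⁻¹' A) ≤ q) :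
    ∀ᵐ ω ∂P, ∃ i ∈ S, f i ω ∉ A := by
  have hnull : P {ω | ∀ i ∈ S, f i ω ∈ A} = 0 := by
    refine le_antisymm (ge_of_tendsto' (ENNReal.tendsto_pow_atTop_nhds_zero_of_lt_one hq)
      fun n => ?_) zero_le
    obtain ⟨s, hs, hcard⟩ := hS.exists_subset_card_eq n
    calc P {ω | ∀ i ∈ S, f i ω ∈ A} ≤ P (⋂ i ∈ s, f i ⁻¹' A) :=
          measure_mono fun ω hω => by simpa using fun i hi => hω i (hs hi)
      _ = ∏ i ∈ s, P (f i ⁻¹' A) := h.meas_biInter fun i _ => ⟨A, hA, rfl⟩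
      _ ≤ ∏ i ∈ s, q := Finset.prod_le_prod' fun i hi => hle i (hs hi)
      _ = q ^ n := by rw [Finset.prod_const, hcard]
  filter_upwards [measure_eq_zero_iff_ae_notMem.1 hnull] with ω hω
  simpa using hω

/-- Events of probability `O(h²)` for each cell of a grid of mesh `h` do not occur at all on a
sufficiently fine grid. -/
lemma ae_exists_grid {A : ℕ → ℕ → Set Ω}
    (h : ∀ m i, P (A m i) ≤ ENNReal.ofReal ((1 / (m + 1 : ℝ)) ^ 2)) (K : ℕ) :
    ∀ᵐ ω ∂P, ∃ m, ∀ i, i < K * (m + 1) → ω ∉ A m i := by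
  -- Union bound: K(m + 1) cells of probability at most (m + 1)⁻² give K / (m + 1).
  have hnull : P {ω | ∀ m, ∃ i, i < K * (m + 1) ∧ ω ∈ A m i} = 0 := by
    have hlim : Tendsto (fun m : ℕ => ENNReal.ofReal (K * (1 / (m + 1 : ℝ)))) atTop (𝓝 0) := by
      have := (tendsto_one_div_add_atTop_nhds_zero_nat (𝕜 := ℝ)).const_mul (K : ℝ)
      simpa using ENNReal.tendsto_ofReal this
    refine le_antisymm (ge_of_tendsto' hlim fun m => ?_) zero_le
    calc P {ω | ∀ m, ∃ i, i < K * (m + 1) ∧ ω ∈ A m i}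
        ≤ P (⋃ i ∈ Finset.range (K * (m + 1)), A m i) := measure_mono fun ω hω => by
          obtain ⟨i, hi, hA⟩ := hω m
          simp only [Set.mem_iUnion, Finset.mem_range]
          exact ⟨i, hi, hA⟩
      _ ≤ ∑ i ∈ Finset.range (K * (m + 1)), P (A m i) := measure_biUnion_finset_le _ _
      _ ≤ ∑ i ∈ Finset.range (K * (m + 1)), ENNReal.ofReal ((1 / (m + 1 : ℝ)) ^ 2) :=
          Finset.sum_le_sum fun i _ => h m i
      _ = ENNReal.ofReal (K * (1 / (m + 1 : ℝ))) := by
          rw [Finset.sum_const, Finset.card_range, nsmul_eq_mul, ← ENNReal.ofReal_natCast,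
            ← ENNReal.ofReal_mul (Nat.cast_nonneg _)]
          congr 1
          push_cast
          field_simp
  filter_upwards [measure_eq_zero_iff_ae_notMem.1 hnull] with ω hω
  simpa using hω

/-- The grid cell containing a time. -/
lemma exists_grid_cell {K : ℕ} {t : ℝ≥0} (ht : 0 < t) (hK : t ≤ K) (m : ℕ) :
    ∃ i : ℕ, i < K * (m + 1) ∧ (i : ℝ≥0) / (m + 1) < t ∧ t ≤ (i + 1 : ℕ) / (m + 1) := by
  have hm : (0 : ℝ≥0) < m + 1 := by positivity
  have hpos : 0 < ⌈t * (m + 1)⌉₊ := Nat.ceil_pos.2 (mul_pos ht hm)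
  -- The cell number is ⌈t(m + 1)⌉ - 1: cells are open on the left, so that the left endpoint lies
  -- strictly before t.
  obtain ⟨i, hi⟩ := Nat.exists_eq_add_of_lt hpos
  rw [zero_add] at hi
  refine ⟨i, ?_, ?_, ?_⟩
  · have : ⌈t * (m + 1)⌉₊ ≤ K * (m + 1) := Nat.ceil_le.2 (by
      push_cast
      exact mul_le_mul_of_nonneg_right hK hm.le)
    omega
  · rw [div_lt_iff₀ hm]
    exact Nat.lt_ceil.1 (by omega)
  · rw [le_div_iff₀ hm, ← hi]
    exact Nat.le_ceil _

lemma IsPoissonProcess.measure_increment {Z : ℝ≥0 → Ω → ℕ} (hZ : IsPoissonProcess Z 1 P)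
    {s t : ℝ≥0} (hst : s ≤ t) (A : Set ℕ) :
    P {ω | Z t ω - Z s ω ∈ A} = poissonMeasure (t - s) A := by
  have h := (hZ.law s t hst).map_eq
  rw [one_mul] at h
  have hm : Measurable fun ω => Z t ω - Z s ω := (hZ.measurable t).sub (hZ.measurable s)
  rw [← h, Measure.map_apply hm MeasurableSet.of_discrete]
  rfl

lemma grid_mesh (m i : ℕ) : ((i + 1 : ℕ) / (m + 1) - (i : ℝ≥0) / (m + 1) : ℝ≥0) = 1 / (m + 1) := by
  rw [← NNReal.sub_div]
  push_cast
  rw [add_tsub_cancel_left]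

lemma grid_le (m i : ℕ) : (i : ℝ≥0) / (m + 1) ≤ (i + 1 : ℕ) / (m + 1) := by
  gcongr
  exact Nat.le_succ i

/-- Two events in one cell of length h have probability at most h². On a fine enough grid this never
happens, and w is the left end of the cell of t. -/
lemma IsPoissonProcess.ae_jump_le {Z : ℝ≥0 → Ω → ℕ} (hZ : IsPoissonProcess Z 1 P) :
    ∀ᵐ ω ∂P, ∀ t, 0 < t → ∃ w, w < t ∧ Z t ω ≤ Z w ω + 1 := by
  have hgrid := fun K => ae_exists_grid (P := P) (A := fun m i =>
    {ω | Z ((i + 1 : ℕ) / (m + 1)) ω - Z ((i : ℝ≥0) / (m + 1)) ω ∈ {n | 2 ≤ n}}) (fun m i => by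
      rw [hZ.measure_increment (grid_le m i), grid_mesh]
      refine (poissonMeasure_two_le _).trans_eq ?_
      push_cast
      rfl) K
  filter_upwards [hZ.mono, ae_all_iff.2 hgrid] with ω hmono hω t ht
  obtain ⟨K, hK⟩ := exists_nat_ge t
  obtain ⟨m, hm⟩ := hω K
  obtain ⟨i, hi, h1, h2⟩ := exists_grid_cell ht hK m
  refine ⟨_, h1, ?_⟩
  have h3 := hm i hi
  have h4 := hmono h2
  simp only at h3 h4
  omega

variable {N : ℕ+ → ℝ≥0 → Ω → ℕ} {T : Option (ℕ+ × ℕ) → Ω → ℝ}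

/-- By independence, both processes have an event in a given cell of length h with probability at
most h · h. -/
lemma IsInput.ae_no_common (h : IsInput N T P) {x x' : ℕ+} (hx : x ≠ x') :
    ∀ᵐ ω ∂P, ∀ t, 0 < t → ∃ w, w < t ∧ (N x w ω = N x t ω ∨ N x' w ω = N x' t ω) := by
  have hgrid := fun K => ae_exists_grid (P := P) (A := fun m i =>
    {ω | N x ((i + 1 : ℕ) / (m + 1)) ω - N x ((i : ℝ≥0) / (m + 1)) ω ∈ {n | 1 ≤ n}} ∩
    {ω | N x' ((i + 1 : ℕ) / (m + 1)) ω - N x' ((i : ℝ≥0) / (m + 1)) ω ∈ {n | 1 ≤ n}})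
    (fun m i => by
      have hφ : Measurable fun n : ℝ≥0 → ℕ => n ((i + 1 : ℕ) / (m + 1)) - n ((i : ℝ≥0) / (m + 1)) :=
        by fun_prop
      have hind := (h.indep_poisson.indepFun hx).comp hφ hφ
      have := hind.measure_inter_preimage_eq_mul {n | 1 ≤ n} {n | 1 ≤ n}
        (MeasurableSet.of_discrete) (MeasurableSet.of_discrete)
      refine (this.le.trans (mul_le_mul' ?_ ?_)).trans_eq (b := ENNReal.ofReal (1 / (m + 1 : ℝ))
        * ENNReal.ofReal (1 / (m + 1 : ℝ))) ?_
      · refine ((h.poisson x).measure_increment (grid_le m i) _).trans_le ?_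
        rw [grid_mesh]
        refine (poissonMeasure_one_le _).trans_eq ?_
        push_cast
        rfl
      · refine ((h.poisson x').measure_increment (grid_le m i) _).trans_le ?_
        rw [grid_mesh]
        refine (poissonMeasure_one_le _).trans_eq ?_
        push_cast
        rfl
      · rw [← ENNReal.ofReal_mul (by positivity), sq]) K
  filter_upwards [(h.poisson x).mono, (h.poisson x').mono, ae_all_iff.2 hgrid]
    with ω hmono hmono' hω t ht
  obtain ⟨K, hK⟩ := exists_nat_ge t
  obtain ⟨m, hm⟩ := hω K
  obtain ⟨i, hi, h1, h2⟩ := exists_grid_cell ht hK m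
  refine ⟨_, h1, ?_⟩
  have h3 := hm i hi
  have h4 := hmono h2
  have h5 := hmono' h2
  have h6 := hmono h1.le
  have h7 := hmono' h1.le
  simp only [Set.mem_inter_iff, Set.mem_ofPred_eq] at h3 h4 h5 h6 h7
  omega

lemma ofReal_exp_neg_lt_one {r : ℝ} (hr : 0 < r) : ENNReal.ofReal (Real.exp (-r)) < 1 := by
  rw [ENNReal.ofReal_lt_one]
  simpa using hr

lemma IsPoissonProcess.measure_increment_zero {Z : ℝ≥0 → Ω → ℕ} (hZ : IsPoissonProcess Z 1 P)
    {s t : ℝ≥0} (hst : s ≤ t) :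
    P {ω | Z t ω - Z s ω ∈ ({0} : Set ℕ)} = ENNReal.ofReal (Real.exp (-(t - s : ℝ≥0))) := by
  rw [hZ.measure_increment hst, ← ofReal_measureReal, poissonMeasure_real_zero]

/-- The increments over unit intervals are independent and vanish with the same probability exp(-1),
so nonzero ones occur beyond every m. -/
lemma IsPoissonProcess.ae_unbounded {Z : ℝ≥0 → Ω → ℕ} (hZ : IsPoissonProcess Z 1 P) :
    ∀ᵐ ω ∂P, ∀ k, ∃ t, k ≤ Z t ω := by
  have hmono : Monotone fun i : ℕ => (i : ℝ≥0) := Nat.mono_cast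
  have h := fun m : ℕ => ae_exists_of_iIndepFun (hZ.indepIncrements.nat hmono)
    (MeasurableSet.singleton 0) (ofReal_exp_neg_lt_one one_pos) (Set.Ici_infinite m) (fun i _ => by
      refine (hZ.measure_increment_zero (hmono (Nat.le_succ i))).trans_le ?_
      simp)
  filter_upwards [hZ.mono, ae_all_iff.2 h] with ω hω hex k
  induction k with
  | zero => exact ⟨0, Nat.zero_le _⟩
  | succ k ih =>
    obtain ⟨t, ht⟩ := ih
    obtain ⟨m, hm⟩ := exists_nat_ge t
    obtain ⟨i, hi, h1⟩ := hex m
    refine ⟨(i + 1 : ℕ), ?_⟩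
    have h2 : Z t ω ≤ Z i ω := hω (hm.trans (Nat.cast_le.2 hi))
    rw [Set.mem_singleton_iff] at h1
    omega

/-- Between two points of a countable dense set, infinitely many independent processes would all
have to be idle, each with the same probability below 1. -/
lemma IsInput.ae_dense (h : IsInput N T P) :
    ∀ᵐ ω ∂P, ∀ a b, a < b → ∃ x, N x a ω < N x b ω := by
  have hq : ∀ p q : ℕ, ∀ᵐ ω ∂P, TopologicalSpace.denseSeq ℝ≥0 p < TopologicalSpace.denseSeq ℝ≥0 q →
      ∃ x, N x (TopologicalSpace.denseSeq ℝ≥0 p) ω < N x (TopologicalSpace.denseSeq ℝ≥0 q) ω := by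
    intro p q
    set a := TopologicalSpace.denseSeq ℝ≥0 p
    set b := TopologicalSpace.denseSeq ℝ≥0 q
    by_cases hab : a < b
    · have hind := h.indep_poisson.comp (fun _ n => n b - n a) (fun _ => by fun_prop)
      have := ae_exists_of_iIndepFun hind (MeasurableSet.singleton 0)
        (ofReal_exp_neg_lt_one (r := (b - a : ℝ≥0)) (by exact_mod_cast tsub_pos_of_lt hab))
        (Set.infinite_univ (α := ℕ+))
        (fun x _ => ((h.poisson x).measure_increment_zero hab.le).le)
      filter_upwards [this] with ω hω _
      obtain ⟨x, -, hx⟩ := hω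
      refine ⟨x, ?_⟩
      simp only [Function.comp, Set.mem_singleton_iff] at hx
      omega
    · exact Eventually.of_forall fun ω h => absurd h hab
  filter_upwards [ae_all_iff.2 fun x => (h.poisson x).mono,
    ae_all_iff.2 fun p => ae_all_iff.2 (hq p)] with ω hmono hω a b hab
  have hd := TopologicalSpace.denseRange_denseSeq ℝ≥0
  obtain ⟨_, ⟨p, rfl⟩, hp⟩ := hd.exists_between hab
  obtain ⟨_, ⟨q, rfl⟩, hq⟩ := hd.exists_between hp.2
  obtain ⟨x, hx⟩ := hω p q hq.1
  exact ⟨x, ((hmono x hp.1.le).trans_lt hx).trans_le (hmono x hq.2.le)⟩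

lemma IsInput.ae_pos (h : IsInput N T P) : ∀ᵐ ω ∂P, ∀ k, 0 < T k ω := by
  refine ae_all_iff.2 fun k => ?_
  have := (h.law_exp k).map_eq ▸ ae_pos_expMeasure
  exact ae_of_ae_map (h.measurable_exp k).aemeasurable this

lemma IsInput.ae_frequently (h : IsInput N T P) (x : ℕ+) :
    ∀ᵐ ω ∂P, ∀ m, ∃ i, m ≤ i ∧ 1 ≤ T (some (x, i)) ω := by
  refine ae_all_iff.2 fun m => ?_
  have hind : iIndepFun (fun i => T (some (x, i))) P :=
    h.indep_exp.precomp (g := fun i : ℕ => some (x, i)) fun i j hij => by simpa using hij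
  have hq : ENNReal.ofReal (1 - Real.exp (-1)) < 1 := by
    rw [ENNReal.ofReal_lt_one]
    linarith [Real.exp_pos (-1)]
  have := ae_exists_of_iIndepFun hind measurableSet_Iic hq (Set.Ici_infinite m) (A := Set.Iic 1)
    (fun i _ => by
      rw [← Measure.map_apply (h.measurable_exp _) measurableSet_Iic, (h.law_exp _).map_eq,
        ← ofReal_measureReal, expMeasure_real_Iic zero_le_one])
  filter_upwards [this] with ω hω
  obtain ⟨i, hi, h1⟩ := hω
  exact ⟨i, hi, (not_le.1 h1).le⟩

variable [IsProbabilityMeasure P]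

/-- Wald's identity as a bound: with the counts frozen, the load is a sum of N exponential
variables. -/
lemma IsInput.lintegral_load_le (h : IsInput N T P) (x : ℕ+) (t : ℝ≥0) :
    ∫⁻ ω, ENNReal.ofReal (load (inputOf N T ω) x t) ∂P
      ≤ (∫⁻ n, (n : ℝ≥0∞) ∂poissonMeasure t) * ∫⁻ e, ENNReal.ofReal e ∂expMeasure 1 := by
  have hF : Measurable fun I : Input => ENNReal.ofReal (load I x t) :=
    (measurable_load x t).ennreal_ofReal
  have hN := h.measurable_counts
  rw [← lintegral_map hF h.measurable_inputOf, h.map_inputOf, lintegral_prod _ hF.aemeasurable]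
  have hinner : ∀ n : ℕ+ → ℝ≥0 → ℕ, ∫⁻ τ, ENNReal.ofReal (load (n, τ) x t) ∂holdingLaw
      ≤ (n x t : ℝ≥0∞) * ∫⁻ e, ENNReal.ofReal e ∂expMeasure 1 := by
    intro n
    calc ∫⁻ τ, ENNReal.ofReal (load (n, τ) x t) ∂holdingLaw
        ≤ ∫⁻ τ, ∑ i ∈ Finset.range (n x t), ENNReal.ofReal (τ (some (x, i))) ∂holdingLaw :=
          lintegral_mono fun τ => Finset.le_sum_of_subadditive ENNReal.ofReal
            ENNReal.ofReal_zero.le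
            (fun _ _ => ENNReal.ofReal_add_le) _ _
      _ = ∑ i ∈ Finset.range (n x t), ∫⁻ τ, ENNReal.ofReal (τ (some (x, i))) ∂holdingLaw :=
          lintegral_finsetSum _ fun i _ => (measurable_pi_apply _).ennreal_ofReal
      _ = ∑ i ∈ Finset.range (n x t), ∫⁻ e, ENNReal.ofReal e ∂expMeasure 1 := by
          refine Finset.sum_congr rfl fun i _ => ?_
          exact (measurePreserving_eval_infinitePi (fun _ : Option (ℕ+ × ℕ) => expMeasure 1)
            (some (x, i))).lintegral_comp ENNReal.measurable_ofReal
      _ = _ := by simp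
  refine (lintegral_mono hinner).trans_eq ?_
  have hmn : Measurable fun n : ℕ+ → ℝ≥0 → ℕ => (n x t : ℝ≥0∞) :=
    (measurable_of_countable _).comp (by fun_prop : Measurable fun n : ℕ+ → ℝ≥0 → ℕ => n x t)
  rw [lintegral_mul_const _ hmn, lintegral_map hmn hN]
  congr 1
  have hlaw := ((h.poisson x).law 0 t zero_le).map_eq
  rw [one_mul, tsub_zero] at hlaw
  have hm : Measurable fun ω => N x t ω - N x 0 ω :=
    ((h.poisson x).measurable t).sub ((h.poisson x).measurable 0)
  rw [← hlaw, lintegral_map (measurable_of_countable _) hm]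
  refine lintegral_congr_ae ?_
  filter_upwards [(h.poisson x).zero] with ω hω
  rw [hω, Nat.sub_zero]

variable {γ : ℕ+ → ℝ}

/-- The expected series is finite because γ is summable and the loads have a common mean bound.
Integer times suffice, as loads increase in time. -/
lemma IsInput.ae_summable (h : IsInput N T P) (hγ : ∀ x, 0 < γ x) (hs : Summable γ) :
    ∀ᵐ ω ∂P, ∀ t, Summable fun x => γ x * load (inputOf N T ω) x t := by
  have hnat : ∀ t : ℕ, ∀ᵐ ω ∂P,
      ∑' x, ENNReal.ofReal (γ x) * ENNReal.ofReal (load (inputOf N T ω) x t) < ∞ := by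
    intro t
    have hm : ∀ x, Measurable fun ω => ENNReal.ofReal (γ x)
        * ENNReal.ofReal (load (inputOf N T ω) x t) := fun x =>
      (((measurable_load x t).comp h.measurable_inputOf).ennreal_ofReal).const_mul _
    refine ae_lt_top (Measurable.tsum hm) ?_
    rw [lintegral_tsum fun x => (hm x).aemeasurable]
    refine ne_top_of_le_ne_top ?_ (ENNReal.tsum_le_tsum fun x => ?_)
      (b := ∑' x, ENNReal.ofReal (γ x) * ((∫⁻ n, (n : ℝ≥0∞) ∂poissonMeasure t)
        * ∫⁻ e, ENNReal.ofReal e ∂expMeasure 1))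
    · rw [ENNReal.tsum_mul_right, ← ENNReal.ofReal_tsum_of_nonneg (fun x => (hγ x).le) hs]
      exact ENNReal.mul_ne_top ENNReal.ofReal_ne_top
        (ENNReal.mul_ne_top (lintegral_poissonMeasure_ne_top _) lintegral_ofReal_expMeasure_ne_top)
    · have hl : Measurable fun ω => ENNReal.ofReal (load (inputOf N T ω) x t) :=
        ((measurable_load x t).comp h.measurable_inputOf).ennreal_ofReal
      rw [lintegral_const_mul _ hl]
      exact mul_le_mul_right (h.lintegral_load_le x t) _
  filter_upwards [ae_all_iff.2 hnat, ae_all_iff.2 fun x => (h.poisson x).mono, h.ae_pos]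
    with ω hω hmono hpos t
  obtain ⟨K, hK⟩ := exists_nat_ge t
  have hload : ∀ x s, 0 ≤ load (inputOf N T ω) x s := fun x s =>
    Finset.sum_nonneg fun i _ => (hpos _).le
  have hsum := ENNReal.summable_toReal (hω K).ne
  refine Summable.of_nonneg_of_le (fun x => mul_nonneg (hγ x).le (hload x t)) (fun x => ?_) hsum
  rw [ENNReal.toReal_mul, ENNReal.toReal_ofReal (hγ x).le, ENNReal.toReal_ofReal (hload x K)]
  exact mul_le_mul_of_nonneg_left (Finset.sum_le_sum_of_subset_of_nonneg
    (Finset.range_mono (hmono x hK)) fun i _ _ => (hpos _).le) (hγ x).le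

lemma exists_gt_eq_of_continuousWithinAt {f : ℝ≥0 → ℕ} {t : ℝ≥0}
    (h : ContinuousWithinAt f (Set.Ici t) t) : ∃ u, t < u ∧ f u = f t := by
  have h1 : ∀ᶠ u in 𝓝[>] t, f u = f t :=
    (h.mono_left (nhdsWithin_mono t Set.Ioi_subset_Ici_self)).eventually
      (eventually_of_mem (by simp : {f t} ∈ 𝓝 (f t)) fun _ hu => hu)
  obtain ⟨u, hu, htu⟩ := (h1.and eventually_mem_nhdsWithin).exists
  exact ⟨u, htu, hu⟩

theorem IsInput.ae_isRegular (h : IsInput N T P) (hγ : ∀ x, 0 < γ x) (hs : Summable γ) :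
    ∀ᵐ ω ∂P, IsRegular γ (inputOf N T ω) := by
  filter_upwards [ae_all_iff.2 fun x => (h.poisson x).mono,
    ae_all_iff.2 fun x => (h.poisson x).zero, ae_all_iff.2 fun x => (h.poisson x).rightCont,
    ae_all_iff.2 fun x => (h.poisson x).ae_unbounded,
    ae_all_iff.2 fun x => (h.poisson x).ae_jump_le,
    ae_all_iff.2 fun x => ae_all_iff.2 fun x' => ae_all_iff.2 fun hx : x ≠ x' => h.ae_no_common hx,
    h.ae_dense, h.ae_pos, ae_all_iff.2 h.ae_frequently, h.ae_summable hγ hs]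
    with ω h1 h2 h3 h4 h5 h6 h7 h8 h9 h10
  exact ⟨h1, h2, fun x t => exists_gt_eq_of_continuousWithinAt (h3 x t), h4, h5, h6, h7, h8, h9,
    h10⟩

end KConstruction

namespace KConstruction

/-! ### The memoryless property -/

lemma map_sub_restrict_expMeasure {a : ℝ} (ha : 0 ≤ a) :
    ((expMeasure 1).restrict (Set.Ioi a)).map (fun e => e - a)
      = expMeasure 1 (Set.Ioi a) • expMeasure 1 := by
  have : IsFiniteMeasure (expMeasure 1 (Set.Ioi a) • expMeasure 1) :=
    Measure.smul_finite _ (measure_ne_top _ _)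
  refine Measure.ext_of_Iic _ _ fun x => ?_
  have hset : (fun e => e - a) ⁻¹' Set.Iic x ∩ Set.Ioi a = Set.Iic (x + a) \ Set.Iic a := by
    ext e
    simp [and_comm]
  have hm : Measurable fun e : ℝ => e - a := by fun_prop
  rw [Measure.map_apply hm measurableSet_Iic, Measure.restrict_apply (hm measurableSet_Iic), hset,
    Measure.smul_apply, smul_eq_mul]
  rcases le_or_gt 0 x with hx | hx
  · rw [expMeasure_Ioi ha, ← ofReal_measureReal (s := Set.Iic x), expMeasure_real_Iic hx,
      ← ENNReal.ofReal_mul (Real.exp_pos _).le, ← ofReal_measureReal,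
      measureReal_sdiff (Set.Iic_subset_Iic.2 (by linarith)) measurableSet_Iic,
      expMeasure_real_Iic (by linarith), expMeasure_real_Iic ha, neg_add, Real.exp_add]
    congr 1
    ring
  · have h0 : expMeasure 1 (Set.Iic x) = 0 := by
      refine measure_mono_null (Set.Iic_subset_Iic.2 hx.le) ?_
      rw [← ofReal_measureReal, expMeasure_real_Iic le_rfl]
      simp
    have h1 : Set.Iic (x + a) \ Set.Iic a = ∅ :=
      Set.sdiff_eq_empty.2 (Set.Iic_subset_Iic.2 (by linarith))
    rw [h0, h1, measure_empty, mul_zero]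

lemma setLIntegral_expMeasure_sub {a : ℝ} (ha : 0 ≤ a) {g : ℝ → ℝ≥0∞} (hg : Measurable g) :
    ∫⁻ e in Set.Ioi a, g (e - a) ∂expMeasure 1
      = expMeasure 1 (Set.Ioi a) * ∫⁻ e, g e ∂expMeasure 1 := by
  rw [← lintegral_map hg (by fun_prop : Measurable fun e : ℝ => e - a),
    map_sub_restrict_expMeasure ha, lintegral_smul_measure, smul_eq_mul]

/-! ### The path after the holding interval of a given time -/

variable {Ω : Type*} [MeasurableSpace Ω] {P : Measure Ω} [IsProbabilityMeasure P]
  {N : ℕ+ → ℝ≥0 → Ω → ℕ} {T : Option (ℕ+ × ℕ) → Ω → ℝ} {γ : ℕ+ → ℝ} {c : ℝ} {y : State}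

/-- The probability that the path occupies `x` at time `t`, if it stays in `z` up to time `ρ` and
starts afresh from `∞` at that time. -/
noncomputable def residual (N : ℕ+ → ℝ≥0 → Ω → ℕ) (T : Option (ℕ+ × ℕ) → Ω → ℝ) (P : Measure Ω)
    (γ : ℕ+ → ℝ) (c : ℝ) (t : ℝ) (x : ℕ+) (z : State) (ρ : ℝ) : ℝ≥0∞ :=
  if t < ρ then ({(x : State)} : Set State).indicator 1 z
  else P {ω | position γ c OnePoint.infty (t - ρ) (inputOf N T ω) = x}

lemma measurableSet_position_eq (t : ℝ) (z : State) :
    MeasurableSet {I : Input | position γ c y t I = z} :=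
  measurable_position t (measurableSet_singleton z)

lemma indicator_position (t : ℝ) (z : State) (I : Input) :
    {I : Input | position γ c y t I = z}.indicator (1 : Input → ℝ≥0∞) I
      = ({z} : Set State).indicator 1 (position γ c y t I) := rfl

lemma IsInput.measurable_residual (h : IsInput N T P) (t : ℝ) (x : ℕ+) (z : State) :
    Measurable (residual N T P γ c t x z) := by
  refine Measurable.ite (measurableSet_lt measurable_const measurable_id) measurable_const ?_
  have hm : Measurable fun p : ℝ × Ω =>
      position γ c OnePoint.infty (t - p.1) (inputOf N T p.2) :=
    measurable_position_uncurry.comp ((measurable_const.sub measurable_fst).prodMk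
      (h.measurable_inputOf.comp measurable_snd))
  exact measurable_measure_prodMk_left (hm (measurableSet_singleton (x : State)))

/-- The law of the position, by conditioning on the initial holding time. -/
lemma IsInput.measure_position_eq (h : IsInput N T P) (hγ : ∀ x, 0 < γ x) (hs : Summable γ)
    (hc : 0 ≤ c) {t : ℝ} (ht : 0 ≤ t) (x : ℕ+) (z : State) :
    P {ω | position γ c z t (inputOf N T ω) = x}
      = ∫⁻ e, residual N T P γ c t x z (gammaExt γ z * e) ∂expMeasure 1 := by
  have hI := h.measurable_inputOf
  have hS := measurableSet_position_eq (γ := γ) (c := c) (y := z) t x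
  have hF : Measurable ({I : Input | position γ c z t I = x}.indicator (1 : Input → ℝ≥0∞)) :=
    measurable_one.indicator hS
  have e1 : P {ω | position γ c z t (inputOf N T ω) = x}
      = ∫⁻ ω, {I : Input | position γ c z t I = x}.indicator 1 (inputOf N T ω) ∂P :=
    (lintegral_indicator_one (hI hS)).symm
  have hm2 : Measurable fun p : Ω × ℝ => {I : Input | position γ c z t I = x}.indicator
      (1 : Input → ℝ≥0∞) (setHolding none p.2 (inputOf N T p.1)) :=
    hF.comp ((measurable_setHolding none).comp (measurable_snd.prodMk (hI.comp measurable_fst)))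
  rw [e1, h.lintegral_setHolding none hF, lintegral_lintegral_swap hm2.aemeasurable]
  refine lintegral_congr_ae ?_
  filter_upwards [ae_pos_expMeasure] with e he
  unfold residual
  split_ifs with hte
  · have : ∀ᵐ ω ∂P, {I : Input | position γ c z t I = x}.indicator (1 : Input → ℝ≥0∞)
        (setHolding none e (inputOf N T ω)) = ({(x : State)} : Set State).indicator 1 z := by
      filter_upwards [h.ae_isRegular hγ hs] with ω hω
      have hp : position γ c z t (setHolding none e (inputOf N T ω)) = z :=
        (hω.setHolding none he).position_of_lt hγ hc ht (by simpa [setHolding] using hte)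
      by_cases hz : z = x
      · rw [Set.indicator_of_mem (by simpa [hz] using hp), Set.indicator_of_mem (by simpa using hz)]
        rfl
      · rw [Set.indicator_of_notMem (by simpa [hp] using hz),
          Set.indicator_of_notMem (by simpa using hz)]
    rw [lintegral_congr_ae this]
    simp
  · have : ∀ᵐ ω ∂P, {I : Input | position γ c z t I = x}.indicator (1 : Input → ℝ≥0∞)
        (setHolding none e (inputOf N T ω))
        = {ω | position γ c OnePoint.infty (t - gammaExt γ z * e) (inputOf N T ω) = x}.indicator
          1 ω := by
      filter_upwards [h.ae_isRegular hγ hs] with ω hω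
      have hp := (hω.setHolding none he).position_infty_update_none (c := c) (y := z) hω hγ hc rfl
        (fun k => by simp [setHolding]) (ρ := t - gammaExt γ z * e) (by linarith)
      have ht' : gammaExt γ z * (setHolding none e (inputOf N T ω)).2 none
          + (t - gammaExt γ z * e) = t := by simp [setHolding]
      rw [ht'] at hp
      rw [indicator_position, hp]
      rfl
    rw [lintegral_congr_ae this]
    exact lintegral_indicator_one (hI (measurableSet_position_eq _ _))

/-! ### Passage of the clock over a level, along grids. -/

/-- The number of the first point of the grid of mesh `1 / (m + 1)` at which the clock
exceeds `s` is `i`. -/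
def firstAbove (γ : ℕ+ → ℝ) (c : ℝ) (y : State) (s : ℝ) (m i : ℕ) : Set Input :=
  {I | s < (eclock γ c y I ((i : ℝ≥0) / (m + 1))).toReal ∧
    ∀ i' : ℕ, i' < i → (eclock γ c y I ((i' : ℝ≥0) / (m + 1))).toReal ≤ s}

lemma measurableSet_firstAbove (s : ℝ) (m i : ℕ) :
    MeasurableSet (firstAbove γ c y s m i) := by
  refine (measurableSet_lt measurable_const (measurable_eclock _).ennreal_toReal).inter ?_
  have : {I : Input | ∀ i' : ℕ, i' < i → (eclock γ c y I ((i' : ℝ≥0) / (m + 1))).toReal ≤ s}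
      = ⋂ i', ⋂ (_ : i' < i), {I | (eclock γ c y I ((i' : ℝ≥0) / (m + 1))).toReal ≤ s} := by
    ext I
    simp
  change MeasurableSet {I : Input | ∀ i' : ℕ, i' < i →
    (eclock γ c y I ((i' : ℝ≥0) / (m + 1))).toReal ≤ s}
  rw [this]
  exact MeasurableSet.iInter fun i' => MeasurableSet.iInter fun _ =>
    measurableSet_le (measurable_eclock _).ennreal_toReal measurable_const

lemma IsRegular.toReal_eclock {I : Input} (hI : IsRegular γ I) (hγ : ∀ x, 0 < γ x) (hc : 0 ≤ c)
    (t : ℝ≥0) : (eclock γ c y I t).toReal = clock γ c y I.1 I.2 t := by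
  rw [hI.eclock_eq hγ hc, ENNReal.toReal_ofReal (hI.clock_nonneg hγ hc t)]

lemma IsRegular.exists_firstAbove {I : Input} (hI : IsRegular γ I) (hγ : ∀ x, 0 < γ x)
    (hc : 0 ≤ c) (s : ℝ) (m : ℕ) : ∃ i, I ∈ firstAbove γ c y s m i := by
  classical
  have hex : ∃ i : ℕ, s < (eclock γ c y I ((i : ℝ≥0) / (m + 1))).toReal := by
    obtain ⟨t, ht⟩ := hI.clock_tendsto_atTop (y := y) hγ hc s
    obtain ⟨i, hi⟩ := exists_nat_ge (t * (m + 1))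
    refine ⟨i, ?_⟩
    rw [hI.toReal_eclock hγ hc]
    refine ht.trans_le ((hI.clock_strictMono hγ hc).monotone ?_)
    rw [le_div_iff₀ (by positivity)]
    exact hi
  exact ⟨Nat.find hex, Nat.find_spec hex, fun i' hi' => not_lt.1 (Nat.find_min hex hi')⟩

lemma firstAbove_unique {I : Input} {s : ℝ} {m i j : ℕ} (hi : I ∈ firstAbove γ c y s m i)
    (hj : I ∈ firstAbove γ c y s m j) : i = j := by
  rcases lt_trichotomy i j with h | h | h
  · exact absurd (hj.2 i h) (not_le.2 hi.1)
  · exact h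
  · exact absurd (hi.2 j h) (not_le.2 hj.1)

/-- The first grid time above s is a stopping time: whether it is the i-th one depends only on the
input up to that time. -/
lemma IsRegular.concat_firstAbove {I J : Input} (hI : IsRegular γ I) (hJ : IsRegular γ J)
    (hγ : ∀ x, 0 < γ x) (hc : 0 ≤ c) (s : ℝ) (m i : ℕ) :
    KConstruction.concat ((i : ℝ≥0) / (m + 1)) I J ∈ firstAbove γ c y s m i
      ↔ I ∈ firstAbove γ c y s m i := by
  have hle : ∀ i' : ℕ, i' ≤ i → (eclock γ c y (KConstruction.concat ((i : ℝ≥0) / (m + 1)) I J)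
      ((i' : ℝ≥0) / (m + 1))).toReal = (eclock γ c y I ((i' : ℝ≥0) / (m + 1))).toReal := by
    intro i' hi'
    rw [(hI.concat hJ _).toReal_eclock hγ hc, hI.toReal_eclock hγ hc]
    refine hI.concat_clock_of_le hJ ?_
    gcongr
  refine and_congr (by rw [hle i le_rfl]) (forall₂_congr fun i' hi' => by rw [hle i' hi'.le])

/-- The grid times of `firstAbove` converge from the right to the clock time at which the clock
passes `s`. -/
lemma IsRegular.tendsto_firstAbove {I : Input} (hI : IsRegular γ I) (hγ : ∀ x, 0 < γ x)
    (hc : 0 ≤ c) {s : ℝ} {v : ℝ≥0} (h1 : s ≤ clock γ c y I.1 I.2 v)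
    (h2 : ∀ w, w < v → clock γ c y I.1 I.2 w ≤ s) {i : ℕ → ℕ}
    (hi : ∀ m, I ∈ firstAbove γ c y s m (i m)) :
    Tendsto (fun m => (i m : ℝ≥0) / (m + 1)) atTop (𝓝[≥] v) := by
  have hmono : StrictMono (clock γ c y I.1 I.2) := hI.clock_strictMono hγ hc
  have hlow : ∀ m, v ≤ (i m : ℝ≥0) / (m + 1) := by
    intro m
    by_contra! hlt
    have := (hi m).1
    rw [hI.toReal_eclock hγ hc] at this
    exact absurd (h2 _ hlt) (not_le.2 this)
  -- The preceding grid point still has clock at most s ≤ Γ(v), so it is at most v, and one mesh is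
  -- the whole error.
  have hup : ∀ m, (i m : ℝ≥0) / (m + 1) ≤ v + 1 / (m + 1) := by
    intro m
    rcases Nat.eq_zero_or_eq_succ_pred (i m) with h0 | h0
    · rw [h0]
      simp
    · have h3 := (hi m).2 (i m).pred (by omega)
      rw [hI.toReal_eclock hγ hc] at h3
      have h4 := hmono.le_iff_le.1 (h3.trans h1)
      rw [h0]
      push_cast
      rw [add_div]
      gcongr
  refine tendsto_nhdsWithin_iff.2 ⟨?_, Eventually.of_forall hlow⟩
  refine tendsto_of_tendsto_of_tendsto_of_le_of_le tendsto_const_nhds ?_ hlow hup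
  have := (tendsto_one_div_add_atTop_nhds_zero_nat (𝕜 := ℝ≥0)).const_add v
  simpa using this

/-- Positive integers are isolated, so their singletons are clopen. This fails for ∞, so limits are
taken only of events {position = x}; the mass at ∞ follows by complement. -/
lemma eventually_eq_coe_iff {f : ℕ → State} {a : State} (hf : Tendsto f atTop (𝓝 a)) (x : ℕ+) :
    ∀ᶠ m in atTop, f m = x ↔ a = x := by
  have hopen : IsOpen ({(x : State)} : Set State) := by
    have := OnePoint.isOpenEmbedding_coe.isOpenMap {x} (isOpen_discrete _)
    simpa using this
  by_cases ha : a = x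
  · filter_upwards [hf.eventually (hopen.mem_nhds (by simpa using ha))] with m hm
    exact iff_of_true hm ha
  · filter_upwards [hf.eventually (isClosed_singleton.isOpen_compl.mem_nhds
      (show a ∈ ({(x : State)} : Set State)ᶜ from ha))] with m hm
    exact iff_of_false hm ha

/-- The Markov property of the input, transferred to the path: after the end `R I` of the holding
interval that contains `s`, the path is a fresh one started at `∞`. -/
lemma IsInput.lintegral_mul_indicator_position (h : IsInput N T P) (hγ : ∀ x, 0 < γ x)
    (hs : Summable γ) (hc : 0 ≤ c) {s t : ℝ} (hs0 : 0 ≤ s) (ht : 0 ≤ t) (x : ℕ+) (z : State)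
    {G : Input → ℝ≥0∞} (hG : Measurable G) (hG1 : ∀ I, G I ≤ 1) {R : Input → ℝ} (hR : Measurable R)
    (hconcat : ∀ I J, IsRegular γ I → IsRegular γ J → ∀ u, s < clock γ c y I.1 I.2 u →
      G (concat u I J) = G I ∧ (G I ≠ 0 → R (concat u I J) = R I))
    (hend : ∀ I, IsRegular γ I → G I ≠ 0 → s ≤ R I ∧
      (s + t < R I → position γ c y (s + t) I = z) ∧
      ∃ v, R I = clock γ c y I.1 I.2 v ∧ ∀ w, w < v → clock γ c y I.1 I.2 w ≤ s) :
    ∫⁻ ω, G (inputOf N T ω)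
        * {I | position γ c y (s + t) I = x}.indicator 1 (inputOf N T ω) ∂P
      = ∫⁻ ω, G (inputOf N T ω)
        * residual N T P γ c t x z (R (inputOf N T ω) - s) ∂P := by
  classical
  have hI := h.measurable_inputOf
  have hreg := h.ae_isRegular hγ hs
  -- Z replaces time s + t = R + (s + t - R) by Γ(u) + (s + t - R), with u the grid time. After Γ(u)
  -- the path is exactly a fresh one, which is not directly available at R.
  let Z : ℕ → ℕ → Input → ℝ≥0∞ := fun m i I =>
    if s + t < R I then ({(x : State)} : Set State).indicator 1 z
    else ({(x : State)} : Set State).indicator 1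
      (position γ c y ((eclock γ c y I ((i : ℝ≥0) / (m + 1))).toReal + (s + t - R I)) I)
  have hZ : ∀ m i, Measurable (Z m i) := by
    intro m i
    refine Measurable.ite (measurableSet_lt measurable_const hR) measurable_const ?_
    refine (measurable_one.indicator (measurableSet_singleton _)).comp
      (measurable_position_uncurry.comp (Measurable.prodMk ?_ measurable_id))
    exact (measurable_eclock _).ennreal_toReal.add (measurable_const.sub hR)
  have hZ1 : ∀ m i I, Z m i I ≤ 1 := by
    intro m i I
    simp only [Z]
    split_ifs
    · exact Set.indicator_le_self _ (1 : State → ℝ≥0∞) _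
    · exact Set.indicator_le_self _ (1 : State → ℝ≥0∞) _
  have hRes : Measurable fun I => residual N T P γ c t x z (R I - s) :=
    (h.measurable_residual t x z).comp (hR.sub measurable_const)
  have hGZ : ∀ m i, Measurable fun I => G I * Z m i I := fun m i => hG.mul (hZ m i)
  have hGR : Measurable fun I => G I * residual N T P γ c t x z (R I - s) := hG.mul hRes
  have hW : ∀ m i, MeasurableSet (firstAbove γ c y s m i) := measurableSet_firstAbove s
  -- the Markov property at a grid time
  have hgrid : ∀ m i,
      ∫⁻ ω, (firstAbove γ c y s m i).indicator (fun I => G I * Z m i I) (inputOf N T ω) ∂P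
        = ∫⁻ ω, (firstAbove γ c y s m i).indicator
          (fun I => G I * residual N T P γ c t x z (R I - s)) (inputOf N T ω) ∂P := by
    intro m i
    rw [h.lintegral_concat ((i : ℝ≥0) / (m + 1))
      (F := (firstAbove γ c y s m i).indicator fun I => G I * Z m i I)
      ((hGZ m i).indicator (hW m i))]
    refine lintegral_congr_ae ?_
    filter_upwards [hreg] with ω hω
    by_cases hmem : inputOf N T ω ∈ firstAbove γ c y s m i
    · have habove : s < clock γ c y (inputOf N T ω).1 (inputOf N T ω).2 ((i : ℝ≥0) / (m + 1)) := by
        rw [← hω.toReal_eclock hγ hc]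
        exact hmem.1
      rw [Set.indicator_of_mem hmem]
      by_cases hG0 : G (inputOf N T ω) = 0
      · rw [hG0, zero_mul]
        refine (lintegral_congr_ae ?_).trans lintegral_zero
        filter_upwards [hreg] with ω' hω'
        rw [Set.indicator_of_mem ((hω.concat_firstAbove hω' hγ hc s m i).2 hmem),
          (hconcat _ _ hω hω' _ habove).1, hG0, zero_mul]
      · have hRs := (hend _ hω hG0).1
        have hval : ∀ᵐ ω' ∂P, (firstAbove γ c y s m i).indicator (fun I => G I * Z m i I)
            (concat ((i : ℝ≥0) / (m + 1)) (inputOf N T ω) (inputOf N T ω'))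
            = G (inputOf N T ω) * (if t < R (inputOf N T ω) - s then
                ({(x : State)} : Set State).indicator 1 z
              else ({(x : State)} : Set State).indicator 1 (position γ c OnePoint.infty
                (t - (R (inputOf N T ω) - s)) (inputOf N T ω'))) := by
          filter_upwards [hreg] with ω' hω'
          obtain ⟨e1, e2⟩ := hconcat _ _ hω hω' _ habove
          rw [Set.indicator_of_mem ((hω.concat_firstAbove hω' hγ hc s m i).2 hmem), e1]
          congr 1
          simp only [Z, e2 hG0, lt_sub_iff_add_lt, add_comm t s]
          split_ifs with hlt
          · rfl
          · rw [(hω.concat hω' _).toReal_eclock hγ hc, hω.concat_clock_of_le hω' le_rfl,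
              hω.concat_position_after hω' hγ hc _ (by linarith)]
            congr 2
            ring
        rw [lintegral_congr_ae hval, lintegral_const_mul']
        · congr 1
          unfold residual
          split_ifs with hlt
          · simp
          · exact lintegral_indicator_one (hI (measurableSet_position_eq _ _))
        · exact ne_top_of_le_ne_top ENNReal.one_ne_top (hG1 _)
    · rw [Set.indicator_of_notMem hmem]
      refine (lintegral_congr_ae ?_).trans lintegral_zero
      filter_upwards [hreg] with ω' hω'
      rw [Set.indicator_of_notMem fun hc' => hmem ((hω.concat_firstAbove hω' hγ hc s m i).1 hc')]
  have htsum : ∀ m (f : ℕ → Input → ℝ≥0∞) {I : Input} {i : ℕ}, I ∈ firstAbove γ c y s m i →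
      ∑' i, (firstAbove γ c y s m i).indicator (f i) I = f i I := by
    intro m f I i hi
    rw [tsum_eq_single i, Set.indicator_of_mem hi]
    intro j hj
    exact Set.indicator_of_notMem (fun hj' => hj (firstAbove_unique hj' hi)) _
  have hsum : ∀ m, ∫⁻ ω, ∑' i, (firstAbove γ c y s m i).indicator (fun I => G I * Z m i I)
      (inputOf N T ω) ∂P = ∫⁻ ω, G (inputOf N T ω)
        * residual N T P γ c t x z (R (inputOf N T ω) - s) ∂P := by
    intro m
    have hm1 : ∀ i, AEMeasurable (fun ω => (firstAbove γ c y s m i).indicator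
        (fun I => G I * Z m i I) (inputOf N T ω)) P :=
      fun i => (((hGZ m i).indicator (hW m i)).comp hI).aemeasurable
    have hm2 : ∀ i, AEMeasurable (fun ω => (firstAbove γ c y s m i).indicator
        (fun I => G I * residual N T P γ c t x z (R I - s)) (inputOf N T ω)) P :=
      fun i => ((hGR.indicator (hW m i)).comp hI).aemeasurable
    rw [lintegral_tsum hm1]
    simp only [hgrid]
    rw [← lintegral_tsum hm2]
    refine lintegral_congr_ae ?_
    filter_upwards [hreg] with ω hω
    obtain ⟨i, hi⟩ := hω.exists_firstAbove (c := c) (y := y) hγ hc s m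
    exact htsum m (fun _ I => G I * residual N T P γ c t x z (R I - s)) hi
  -- As the mesh shrinks, the grid times tend to v from the right, so their clocks tend to Γ(v) = R
  -- from the right, and right continuity of the path at s + t applies. Everything is bounded by 1.
  have hlim : Tendsto (fun m : ℕ => ∫⁻ ω, ∑' i, (firstAbove γ c y s m i).indicator
      (fun I => G I * Z m i I) (inputOf N T ω) ∂P) atTop
      (𝓝 (∫⁻ ω, G (inputOf N T ω)
        * {I | position γ c y (s + t) I = x}.indicator 1 (inputOf N T ω) ∂P)) := by
    refine tendsto_lintegral_of_dominated_convergence (fun _ => 1) (fun m => ?_) (fun m => ?_)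
      (by simp) ?_
    · exact Measurable.tsum fun i => ((hGZ m i).indicator (hW m i)).comp hI
    · filter_upwards [hreg] with ω hω
      obtain ⟨i, hi⟩ := hω.exists_firstAbove (c := c) (y := y) hγ hc s m
      rw [htsum m (fun i I => G I * Z m i I) hi]
      exact mul_le_one' (hG1 _) (hZ1 _ _ _)
    · filter_upwards [hreg] with ω hω
      choose i hi using fun m => hω.exists_firstAbove (c := c) (y := y) hγ hc s m
      simp only [fun m => htsum m (fun i I => G I * Z m i I) (hi m)]
      by_cases hG0 : G (inputOf N T ω) = 0
      · simp [hG0]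
      · obtain ⟨hRs, hRz, v, hRv, hv⟩ := hend _ hω hG0
        refine tendsto_const_nhds.congr' ?_
        have hcompare : ∀ᶠ m in atTop, {I | position γ c y (s + t) I = x}.indicator
            (1 : Input → ℝ≥0∞) (inputOf N T ω) = Z m (i m) (inputOf N T ω) := by
          by_cases hlt : s + t < R (inputOf N T ω)
          · refine Eventually.of_forall fun m => ?_
            rw [indicator_position, hRz hlt]
            exact (if_pos hlt).symm
          · have hu := hω.tendsto_firstAbove hγ hc (hRv ▸ hRs) hv hi
            have hcl := (hω.clock_rightCont (c := c) (y := y) hγ v).tendsto.comp hu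
            have harg : Tendsto (fun m => clock γ c y (inputOf N T ω).1 (inputOf N T ω).2
                ((i m : ℝ≥0) / (m + 1)) + (s + t - R (inputOf N T ω))) atTop (𝓝[≥] (s + t)) := by
              refine tendsto_nhdsWithin_iff.2 ⟨?_, ?_⟩
              · have := hcl.add_const (s + t - R (inputOf N T ω))
                rw [← hRv, add_sub_cancel] at this
                exact this
              · filter_upwards [(tendsto_nhdsWithin_iff.1 hu).2] with m hm
                have := (hω.clock_strictMono (y := y) hγ hc).monotone hm
                rw [← hRv] at this
                simp only [Set.mem_Ici]
                linarith
            have hpos := (hω.position_rightCont (c := c) (y := y) hγ hc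
              (add_nonneg hs0 ht)).tendsto.comp harg
            filter_upwards [eventually_eq_coe_iff hpos x] with m hm
            rw [indicator_position]
            simp only [Z, if_neg hlt, hω.toReal_eclock hγ hc, Set.indicator_apply,
              Set.mem_singleton_iff]
            simp only [Function.comp] at hm
            simp only [hm]
            rfl
        filter_upwards [hcompare] with m hm
        rw [hm]
  -- The prelimit integrals do not depend on m, so they equal the limit.
  simp only [hsum] at hlim
  exact tendsto_nhds_unique hlim tendsto_const_nhds |>.symm ▸ rfl

end KConstruction

namespace KConstruction

variable {Ω : Type*} [MeasurableSpace Ω] {P : Measure Ω}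
  {N : ℕ+ → ℝ≥0 → Ω → ℕ} {T : Option (ℕ+ × ℕ) → Ω → ℝ} {γ : ℕ+ → ℝ} {c : ℝ} {y : State}

/-! ### The Markov property of the path -/

/-- The path up to time `s`. -/
noncomputable def past (γ : ℕ+ → ℝ) (c : ℝ) (y : State) (s : ℝ≥0) (I : Input) (r : Set.Iic s) :
    State :=
  position γ c y ((r : ℝ≥0) : ℝ) I

lemma measurable_past (s : ℝ≥0) : Measurable (past γ c y s) :=
  measurable_pi_lambda _ fun _ => measurable_position _

/-- The inputs for which `s` belongs to a given holding interval, or to none of them. -/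
def phase (γ : ℕ+ → ℝ) (c : ℝ) (y : State) (s : ℝ≥0) : Option (Option (ℕ+ × ℕ)) → Set Input
  | none => {I | ∀ k, ¬ Holds γ c y k s I}
  | some k => {I | Holds γ c y k s I}

/-- The state occupied during a phase. -/
def phaseLabel (y : State) : Option (Option (ℕ+ × ℕ)) → State
  | none => OnePoint.infty
  | some k => label y k

/-- The inputs for which the path up to time `s` lies in `A`, and `s` belongs to a given phase. -/
def pastPhase (γ : ℕ+ → ℝ) (c : ℝ) (y : State) (s : ℝ≥0) (A : Set (Set.Iic s → State))
    (d : Option (Option (ℕ+ × ℕ))) : Set Input :=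
  past γ c y s ⁻¹' A ∩ phase γ c y s d

lemma measurableSet_setOf_holds (k : Option (ℕ+ × ℕ)) (s : ℝ) :
    MeasurableSet {I : Input | Holds γ c y k s I} :=
  measurable_prodMk_left (measurableSet_holds k)

lemma measurableSet_pastPhase {s : ℝ≥0} {A : Set (Set.Iic s → State)} (hA : MeasurableSet A)
    (d : Option (Option (ℕ+ × ℕ))) : MeasurableSet (pastPhase γ c y s A d) := by
  refine (measurable_past s hA).inter ?_
  rcases d with _ | k
  · have : phase γ c y s none = ⋂ k, {I : Input | Holds γ c y k s I}ᶜ := by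
      ext I
      simp [phase]
    rw [this]
    exact MeasurableSet.iInter fun k => (measurableSet_setOf_holds k s).compl
  · exact measurableSet_setOf_holds k s

lemma weight_nonneg (hγ : ∀ x, 0 < γ x) (k : Option (ℕ+ × ℕ)) : 0 ≤ weight γ y k := by
  rw [weight_eq_gammaExt_label]
  exact gammaExt_nonneg hγ _

/-- The transition function: the law of the path started at `z` at time `t`. -/
noncomputable def transition (N : ℕ+ → ℝ≥0 → Ω → ℕ) (T : Option (ℕ+ × ℕ) → Ω → ℝ) (P : Measure Ω)
    (γ : ℕ+ → ℝ) (c : ℝ) (t : ℝ≥0) : Kernel State State :=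
  Kernel.ofFunOfCountable fun z => P.map fun ω => position γ c z t (inputOf N T ω)

lemma IsInput.measurable_position_inputOf (h : IsInput N T P) (t : ℝ) :
    Measurable fun ω => position γ c y t (inputOf N T ω) :=
  (measurable_position t).comp h.measurable_inputOf

lemma transition_apply (t : ℝ≥0) (z : State) :
    transition N T P γ c t z = P.map fun ω => position γ c z t (inputOf N T ω) := rfl

variable [IsProbabilityMeasure P]

lemma IsRegular.setHolding_past {I : Input} (hI : IsRegular γ I) (hγ : ∀ x, 0 < γ x)
    (hc : 0 ≤ c) {k : Option (ℕ+ × ℕ)} {e e' : ℝ} {s : ℝ≥0} (he : 0 < e) (he' : 0 < e')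
    (hs : s < start γ c y k I + weight γ y k * e)
    (hs' : s < start γ c y k I + weight γ y k * e') :
    past γ c y s (KConstruction.setHolding k e I) = past γ c y s (KConstruction.setHolding k e' I) :=
  funext fun r => hI.setHolding_position hγ hc he he' hs hs' (NNReal.coe_nonneg _)
    (NNReal.coe_le_coe.2 r.2)

/-- With all else frozen, the past event depends on variable k only through e > a, where a is the
time already spent in the interval divided by the weight; lack of memory then gives the product. If
the interval starts after s or has weight 0, the event is empty. -/
lemma IsRegular.lintegral_setHolding_pastPhase {I : Input} (hI : IsRegular γ I)
    (hγ : ∀ x, 0 < γ x) (hc : 0 ≤ c) {s : ℝ≥0} (A : Set (Set.Iic s → State))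
    (k : Option (ℕ+ × ℕ)) {f : ℝ → ℝ≥0∞} (hf : Measurable f) :
    ∫⁻ e, (pastPhase γ c y s A (some k)).indicator 1 (KConstruction.setHolding k e I)
        * f (finish γ c y k (KConstruction.setHolding k e I) - s) ∂expMeasure 1
      = (∫⁻ e, (pastPhase γ c y s A (some k)).indicator 1 (KConstruction.setHolding k e I)
        ∂expMeasure 1) * ∫⁻ e, f (weight γ y k * e) ∂expMeasure 1 := by
  have hholds : ∀ e, 0 < e → (Holds γ c y k s (KConstruction.setHolding k e I) ↔
      start γ c y k I ≤ s ∧ s < start γ c y k I + weight γ y k * e) := by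
    intro e he
    rw [Holds, hI.setHolding_start hγ hc k he, hI.setHolding_finish hγ hc k he]
  by_cases hgood : start γ c y k I ≤ s ∧ 0 < weight γ y k
  · obtain ⟨hst, hw⟩ := hgood
    set a : ℝ := (s - start γ c y k I) / weight γ y k with ha
    have ha0 : 0 ≤ a := div_nonneg (by linarith) hw.le
    have hwa : weight γ y k * a = s - start γ c y k I := by
      rw [ha]
      field_simp
    have hlt : ∀ e, s < start γ c y k I + weight γ y k * e ↔ a < e := by
      intro e
      rw [← sub_lt_iff_lt_add', ← hwa, mul_lt_mul_iff_right₀ hw]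
    -- The indicator is constant for e > a, so any value above a, here a + 1, computes it.
    set C : ℝ≥0∞ := (pastPhase γ c y s A (some k)).indicator 1
      (KConstruction.setHolding k (a + 1) I) with hC
    have hind : ∀ e, 0 < e → (pastPhase γ c y s A (some k)).indicator (1 : Input → ℝ≥0∞)
        (KConstruction.setHolding k e I) = (Set.Ioi a).indicator (fun _ => C) e := by
      intro e he
      have ha1 : 0 < a + 1 := by linarith
      by_cases hae : a < e
      · rw [Set.indicator_of_mem (show e ∈ Set.Ioi a from hae), hC]
        have hiff : KConstruction.setHolding k e I ∈ pastPhase γ c y s A (some k) ↔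
            KConstruction.setHolding k (a + 1) I ∈ pastPhase γ c y s A (some k) := by
          refine and_congr ?_ ?_
          · rw [Set.mem_preimage, Set.mem_preimage, hI.setHolding_past hγ hc he ha1
              ((hlt _).2 hae) ((hlt _).2 (by linarith))]
          · exact iff_of_true ((hholds e he).2 ⟨hst, (hlt _).2 hae⟩)
              ((hholds _ ha1).2 ⟨hst, (hlt _).2 (by linarith)⟩)
        by_cases hm : KConstruction.setHolding k e I ∈ pastPhase γ c y s A (some k)
        · rw [Set.indicator_of_mem hm, Set.indicator_of_mem (hiff.1 hm)]
          rfl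
        · rw [Set.indicator_of_notMem hm, Set.indicator_of_notMem fun h' => hm (hiff.2 h')]
      · rw [Set.indicator_of_notMem (show e ∉ Set.Ioi a from hae), Set.indicator_of_notMem]
        exact fun hm => hae ((hlt e).1 ((hholds e he).1 hm.2).2)
    have e1 : ∫⁻ e, (pastPhase γ c y s A (some k)).indicator 1 (KConstruction.setHolding k e I)
        ∂expMeasure 1 = C * expMeasure 1 (Set.Ioi a) := by
      rw [← lintegral_indicator_const measurableSet_Ioi]
      refine lintegral_congr_ae ?_
      filter_upwards [ae_pos_expMeasure] with e he using hind e he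
    have e2 : ∫⁻ e, (pastPhase γ c y s A (some k)).indicator 1 (KConstruction.setHolding k e I)
        * f (finish γ c y k (KConstruction.setHolding k e I) - s) ∂expMeasure 1
        = C * ∫⁻ e in Set.Ioi a, f (weight γ y k * (e - a)) ∂expMeasure 1 := by
      rw [← lintegral_const_mul C (by fun_prop), ← lintegral_indicator measurableSet_Ioi]
      refine lintegral_congr_ae ?_
      filter_upwards [ae_pos_expMeasure] with e he
      rw [hind e he, hI.setHolding_finish hγ hc k he]
      by_cases hae : a < e
      · rw [Set.indicator_of_mem (show e ∈ Set.Ioi a from hae),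
          Set.indicator_of_mem (show e ∈ Set.Ioi a from hae), mul_sub, hwa]
        congr 2
        ring
      · rw [Set.indicator_of_notMem (show e ∉ Set.Ioi a from hae),
          Set.indicator_of_notMem (show e ∉ Set.Ioi a from hae), zero_mul]
    rw [e1, e2, setLIntegral_expMeasure_sub ha0 (g := fun e => f (weight γ y k * e))
      (by fun_prop), mul_assoc]
  · have hzero : ∀ e, 0 < e → (pastPhase γ c y s A (some k)).indicator (1 : Input → ℝ≥0∞)
        (KConstruction.setHolding k e I) = 0 := by
      intro e he
      refine Set.indicator_of_notMem (fun hm => hgood ?_) _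
      obtain ⟨h1, h2⟩ := (hholds e he).1 hm.2
      refine ⟨h1, (weight_nonneg hγ k).lt_of_ne fun h0 => ?_⟩
      rw [← h0, zero_mul, add_zero] at h2
      exact absurd h1 (not_le.2 h2)
    have e1 : ∫⁻ e, (pastPhase γ c y s A (some k)).indicator 1 (KConstruction.setHolding k e I)
        ∂expMeasure 1 = 0 := by
      refine (lintegral_congr_ae ?_).trans lintegral_zero
      filter_upwards [ae_pos_expMeasure] with e he using hzero e he
    rw [e1, zero_mul]
    refine (lintegral_congr_ae ?_).trans lintegral_zero
    filter_upwards [ae_pos_expMeasure] with e he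
    rw [hzero e he, zero_mul]

/-- The remaining length of the holding interval that contains `s` is a fresh one, independent of
the path up to time `s`. -/
lemma IsInput.lintegral_pastPhase_some (h : IsInput N T P) (hγ : ∀ x, 0 < γ x) (hs : Summable γ)
    (hc : 0 ≤ c) {s : ℝ≥0} {A : Set (Set.Iic s → State)} (hA : MeasurableSet A)
    (k : Option (ℕ+ × ℕ)) {f : ℝ → ℝ≥0∞} (hf : Measurable f) :
    ∫⁻ ω, (pastPhase γ c y s A (some k)).indicator 1 (inputOf N T ω)
        * f (finish γ c y k (inputOf N T ω) - s) ∂P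
      = (∫⁻ ω, (pastPhase γ c y s A (some k)).indicator 1 (inputOf N T ω) ∂P)
        * ∫⁻ e, f (weight γ y k * e) ∂expMeasure 1 := by
  have hG : Measurable ((pastPhase γ c y s A (some k)).indicator (1 : Input → ℝ≥0∞)) :=
    measurable_one.indicator (measurableSet_pastPhase hA _)
  have hGf : Measurable fun I => (pastPhase γ c y s A (some k)).indicator (1 : Input → ℝ≥0∞) I
      * f (finish γ c y k I - s) :=
    hG.mul (hf.comp ((measurable_finish k).sub measurable_const))
  have hm : Measurable fun p : Ω × ℝ => (pastPhase γ c y s A (some k)).indicator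
      (1 : Input → ℝ≥0∞) (setHolding k p.2 (inputOf N T p.1)) :=
    hG.comp ((measurable_setHolding k).comp
      (measurable_snd.prodMk (h.measurable_inputOf.comp measurable_fst)))
  rw [h.lintegral_setHolding k hG, h.lintegral_setHolding k hGf,
    ← lintegral_mul_const _ hm.lintegral_prod_right']
  refine lintegral_congr_ae ?_
  filter_upwards [h.ae_isRegular hγ hs] with ω hω
  exact hω.lintegral_setHolding_pastPhase hγ hc A k hf

lemma IsRegular.concat_mem_pastPhase_iff {I J : Input} (hI : IsRegular γ I) (hJ : IsRegular γ J)
    (hγ : ∀ x, 0 < γ x) (hc : 0 ≤ c) {s u : ℝ≥0} (A : Set (Set.Iic s → State))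
    (d : Option (Option (ℕ+ × ℕ))) (hu : s < clock γ c y I.1 I.2 u) :
    KConstruction.concat u I J ∈ pastPhase γ c y s A d ↔ I ∈ pastPhase γ c y s A d := by
  have hpast : past γ c y s (KConstruction.concat u I J) = past γ c y s I :=
    funext fun r => hI.concat_position hJ hγ hc
      (lt_of_le_of_lt (NNReal.coe_le_coe.2 r.2) hu)
  refine and_congr (by rw [Set.mem_preimage, Set.mem_preimage, hpast]) ?_
  rcases d with _ | k
  · exact forall_congr' fun k => not_congr (hI.concat_holds_iff hJ hγ hc hu k)
  · exact hI.concat_holds_iff hJ hγ hc hu k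

lemma indicator_one_congr {α : Type*} {S : Set α} {a b : α} (h : a ∈ S ↔ b ∈ S) :
    S.indicator (1 : α → ℝ≥0∞) a = S.indicator 1 b := by
  by_cases ha : a ∈ S
  · rw [Set.indicator_of_mem ha, Set.indicator_of_mem (h.1 ha)]
    rfl
  · rw [Set.indicator_of_notMem ha, Set.indicator_of_notMem fun hb => ha (h.2 hb)]

/-- The Markov property on a phase. -/
lemma IsInput.lintegral_pastPhase (h : IsInput N T P) (hγ : ∀ x, 0 < γ x) (hs : Summable γ)
    (hc : 0 ≤ c) {s t : ℝ≥0} {A : Set (Set.Iic s → State)} (hA : MeasurableSet A)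
    (d : Option (Option (ℕ+ × ℕ))) (x : ℕ+) :
    ∫⁻ ω, (pastPhase γ c y s A d).indicator 1 (inputOf N T ω)
        * {I | position γ c y (s + t) I = x}.indicator 1 (inputOf N T ω) ∂P
      = (∫⁻ ω, (pastPhase γ c y s A d).indicator 1 (inputOf N T ω) ∂P)
        * P {ω | position γ c (phaseLabel y d) t (inputOf N T ω) = x} := by
  have hG : Measurable ((pastPhase γ c y s A d).indicator (1 : Input → ℝ≥0∞)) :=
    measurable_one.indicator (measurableSet_pastPhase hA _)
  have hG1 : ∀ I, (pastPhase γ c y s A d).indicator (1 : Input → ℝ≥0∞) I ≤ 1 :=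
    fun I => Set.indicator_le_self _ (1 : Input → ℝ≥0∞) I
  have ht : (0 : ℝ) ≤ t := t.coe_nonneg
  rcases d with _ | k
  · rw [h.lintegral_mul_indicator_position hγ hs hc s.coe_nonneg ht x OnePoint.infty hG hG1
      (R := fun _ => s) measurable_const]
    · have hres : residual N T P γ c t x OnePoint.infty ((s : ℝ) - s)
          = P {ω | position γ c (phaseLabel y none) t (inputOf N T ω) = x} := by
        rw [residual, if_neg (by simp), sub_self, sub_zero]
        rfl
      rw [hres]
      exact lintegral_mul_const _ (hG.comp h.measurable_inputOf)
    · intro I J hI hJ u hu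
      exact ⟨indicator_one_congr (hI.concat_mem_pastPhase_iff hJ hγ hc A none hu), fun _ => rfl⟩
    · intro I hI hGI
      have hmem := Set.mem_of_indicator_ne_zero hGI
      refine ⟨le_rfl, fun hlt => absurd hlt (by simp), ?_⟩
      rcases hI.holds_or hγ hc (y := y) s.coe_nonneg with ⟨k, hk⟩ | ⟨-, v, hv⟩
      · exact absurd hk (hmem.2 k)
      · exact ⟨v, hv.symm, fun w hw => hv ▸ (hI.clock_strictMono hγ hc).monotone hw.le⟩
  -- Here R is the end of the interval. Its distance from s is a fresh holding time with the mean of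
  -- the label, which reproduces the initial holding of the path started there.
  · rw [h.lintegral_mul_indicator_position hγ hs hc s.coe_nonneg ht x (label y k) hG hG1
      (R := finish γ c y k) (measurable_finish k)]
    · rw [h.lintegral_pastPhase_some hγ hs hc hA k (h.measurable_residual _ _ _),
        h.measure_position_eq hγ hs hc ht, weight_eq_gammaExt_label]
      rfl
    · intro I J hI hJ u hu
      exact ⟨indicator_one_congr (hI.concat_mem_pastPhase_iff hJ hγ hc A (some k) hu),
        fun hGI => hI.concat_finish hJ hγ hc hu (Set.mem_of_indicator_ne_zero hGI).2⟩
    · intro I hI hGI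
      have hmem : Holds γ c y k s I := (Set.mem_of_indicator_ne_zero hGI).2
      refine ⟨hmem.2.le, fun hlt => hI.position_of_holds hγ hc
        ⟨hmem.1.trans (le_add_of_nonneg_right ht), hlt⟩, hI.holds_finish hγ hc hmem⟩

lemma IsRegular.exists_mem_phase {I : Input} (hI : IsRegular γ I) (hγ : ∀ x, 0 < γ x)
    (hc : 0 ≤ c) (s : ℝ≥0) : ∃ d, I ∈ phase γ c y s d ∧
      (∀ d', I ∈ phase γ c y s d' → d' = d) ∧ position γ c y s I = phaseLabel y d := by
  by_cases hex : ∃ k, Holds γ c y k s I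
  · obtain ⟨k, hk⟩ := hex
    refine ⟨some k, hk, fun d' hd' => ?_, hI.position_of_holds hγ hc hk⟩
    rcases d' with _ | l
    · exact absurd hk (hd' k)
    · rw [hI.holds_unique hγ hc hk hd']
  · rw [not_exists] at hex
    refine ⟨none, hex, fun d' hd' => ?_, position_of_not_holds hex⟩
    rcases d' with _ | l
    · rfl
    · exact absurd hd' (hex l)

lemma IsRegular.tsum_pastPhase {I : Input} (hI : IsRegular γ I) (hγ : ∀ x, 0 < γ x)
    (hc : 0 ≤ c) {s : ℝ≥0} (A : Set (Set.Iic s → State))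
    (f : State → ℝ≥0∞) : ∑' d, (pastPhase γ c y s A d).indicator 1 I * f (phaseLabel y d)
      = (past γ c y s ⁻¹' A).indicator 1 I * f (position γ c y s I) := by
  obtain ⟨d, hd, huniq, hpos⟩ := hI.exists_mem_phase (y := y) hγ hc s
  rw [tsum_eq_single d, hpos]
  · congr 1
    by_cases hA : I ∈ past γ c y s ⁻¹' A
    · rw [Set.indicator_of_mem hA, Set.indicator_of_mem
        (show I ∈ pastPhase γ c y s A d from ⟨hA, hd⟩)]
    · rw [Set.indicator_of_notMem hA, Set.indicator_of_notMem fun hm => hA hm.1]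
  · intro d' hd'
    rw [Set.indicator_of_notMem fun hm => hd' (huniq d' hm.2), zero_mul]

/-- Phases form a countable partition. The factor obtained on each one depends only on its label,
which is the position at s, so the sum collapses to a function of that position. -/
lemma IsInput.measure_past_inter (h : IsInput N T P) (hγ : ∀ x, 0 < γ x) (hs : Summable γ)
    (hc : 0 ≤ c) (s t : ℝ≥0) {A : Set (Set.Iic s → State)} (hA : MeasurableSet A) (x : ℕ+) :
    P {ω | past γ c y s (inputOf N T ω) ∈ A ∧ position γ c y (s + t) (inputOf N T ω) = x}
      = ∫⁻ ω in {ω | past γ c y s (inputOf N T ω) ∈ A},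
        P {ω' | position γ c (position γ c y s (inputOf N T ω)) t (inputOf N T ω') = x} ∂P := by
  have hI := h.measurable_inputOf
  have hreg := h.ae_isRegular hγ hs
  let q : State → ℝ≥0∞ := fun z => P {ω' | position γ c z t (inputOf N T ω') = x}
  have hA' : MeasurableSet {ω | past γ c y s (inputOf N T ω) ∈ A} :=
    hI (measurable_past s hA)
  have hG : ∀ d, Measurable fun ω =>
      (pastPhase γ c y s A d).indicator (1 : Input → ℝ≥0∞) (inputOf N T ω) :=
    fun d => (measurable_one.indicator (measurableSet_pastPhase hA d)).comp hI
  have hX : Measurable fun ω =>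
      {I | position γ c y (s + t) I = x}.indicator (1 : Input → ℝ≥0∞) (inputOf N T ω) :=
    (measurable_one.indicator (measurableSet_position_eq _ _)).comp hI
  have hGX : ∀ d, AEMeasurable (fun ω =>
      (pastPhase γ c y s A d).indicator (1 : Input → ℝ≥0∞) (inputOf N T ω)
        * {I | position γ c y (s + t) I = x}.indicator (1 : Input → ℝ≥0∞) (inputOf N T ω)) P :=
    fun d => ((hG d).mul hX).aemeasurable
  have hGq : ∀ d, AEMeasurable (fun ω =>
      (pastPhase γ c y s A d).indicator (1 : Input → ℝ≥0∞) (inputOf N T ω)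
        * q (phaseLabel y d)) P :=
    fun d => ((hG d).mul_const _).aemeasurable
  calc P {ω | past γ c y s (inputOf N T ω) ∈ A ∧ position γ c y (s + t) (inputOf N T ω) = x}
      = ∫⁻ ω, (past γ c y s ⁻¹' A).indicator 1 (inputOf N T ω)
          * {I | position γ c y (s + t) I = x}.indicator 1 (inputOf N T ω) ∂P := by
        rw [show {ω | past γ c y s (inputOf N T ω) ∈ A ∧
            position γ c y (s + t) (inputOf N T ω) = x}
            = inputOf N T ⁻¹' (past γ c y s ⁻¹' A ∩ {I | position γ c y (s + t) I = x}) from rfl,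
          ← lintegral_indicator_one (hI ((measurable_past s hA).inter
            (measurableSet_position_eq _ _)))]
        refine lintegral_congr fun ω => ?_
        exact congrFun (Set.inter_indicator_one (M₀ := ℝ≥0∞) (s := past γ c y s ⁻¹' A)
          (t := {I | position γ c y (s + t) I = x})) (inputOf N T ω)
    _ = ∫⁻ ω, ∑' d, (pastPhase γ c y s A d).indicator 1 (inputOf N T ω)
          * {I | position γ c y (s + t) I = x}.indicator 1 (inputOf N T ω) ∂P := by
        refine lintegral_congr_ae ?_
        filter_upwards [hreg] with ω hω
        exact (hω.tsum_pastPhase hγ hc A fun _ =>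
          {I | position γ c y (s + t) I = x}.indicator 1 (inputOf N T ω)).symm
    _ = ∑' d, (∫⁻ ω, (pastPhase γ c y s A d).indicator 1 (inputOf N T ω) ∂P)
          * q (phaseLabel y d) := by
        rw [lintegral_tsum hGX]
        exact tsum_congr fun d => h.lintegral_pastPhase hγ hs hc hA d x
    _ = ∫⁻ ω, ∑' d, (pastPhase γ c y s A d).indicator 1 (inputOf N T ω)
          * q (phaseLabel y d) ∂P := by
        rw [lintegral_tsum hGq]
        exact tsum_congr fun d => (lintegral_mul_const _ (hG d)).symm
    _ = ∫⁻ ω, (past γ c y s ⁻¹' A).indicator 1 (inputOf N T ω)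
          * q (position γ c y s (inputOf N T ω)) ∂P := by
        refine lintegral_congr_ae ?_
        filter_upwards [hreg] with ω hω
        exact hω.tsum_pastPhase hγ hc A q
    _ = _ := by
        rw [← lintegral_indicator hA']
        refine lintegral_congr fun ω => ?_
        by_cases hm : past γ c y s (inputOf N T ω) ∈ A
        · rw [Set.indicator_of_mem (show inputOf N T ω ∈ past γ c y s ⁻¹' A from hm),
            Set.indicator_of_mem (show ω ∈ {ω | past γ c y s (inputOf N T ω) ∈ A} from hm)]
          exact one_mul _
        · rw [Set.indicator_of_notMem (show inputOf N T ω ∉ past γ c y s ⁻¹' A from hm),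
            Set.indicator_of_notMem (show ω ∉ {ω | past γ c y s (inputOf N T ω) ∈ A} from hm),
            zero_mul]

/-! ### The transition function -/

/-- Finite measures on the state space with the same mass are equal if they agree on the positive
integers. -/
lemma measure_ext_coe {μ ν : Measure State} [IsFiniteMeasure μ] [IsFiniteMeasure ν]
    (huniv : μ Set.univ = ν Set.univ) (h : ∀ x : ℕ+, μ {(x : State)} = ν {(x : State)}) :
    μ = ν := by
  have hrange : ∀ ρ : Measure State,
      ρ (⋃ x : ℕ+, {(x : State)}) = ∑' x : ℕ+, ρ {(x : State)} := fun ρ =>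
    measure_iUnion (fun x x' hx => by simpa using hx) fun x => measurableSet_singleton _
  have hm : MeasurableSet (⋃ x : ℕ+, {(x : State)}) :=
    MeasurableSet.iUnion fun x => measurableSet_singleton _
  have hinfty : ({OnePoint.infty} : Set State) = (⋃ x : ℕ+, {(x : State)})ᶜ := by
    ext z
    induction z using OnePoint.rec <;> simp
  refine Measure.ext_of_singleton fun z => ?_
  induction z using OnePoint.rec with
  | coe x => exact h x
  | infty =>
    rw [hinfty, measure_compl hm (measure_ne_top _ _), measure_compl hm (measure_ne_top _ _),
      hrange, hrange, huniv]
    simp only [h]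

lemma IsInput.isMarkovKernel_transition (h : IsInput N T P) (t : ℝ≥0) :
    IsMarkovKernel (transition N T P γ c t) :=
  ⟨fun _ => Measure.isProbabilityMeasure_map (h.measurable_position_inputOf t).aemeasurable⟩

/-- The Markov property of the measurable version of the path. -/
lemma IsInput.measure_past_inter_preimage (h : IsInput N T P) (hγ : ∀ x, 0 < γ x)
    (hs : Summable γ) (hc : 0 ≤ c) (s t : ℝ≥0) {A : Set (Set.Iic s → State)}
    (hA : MeasurableSet A) {B : Set State} (hB : MeasurableSet B) :
    P {ω | past γ c y s (inputOf N T ω) ∈ A ∧ position γ c y (s + t) (inputOf N T ω) ∈ B}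
      = ∫⁻ ω in {ω | past γ c y s (inputOf N T ω) ∈ A},
        transition N T P γ c t (position γ c y s (inputOf N T ω)) B ∂P := by
  have := h.isMarkovKernel_transition (γ := γ) (c := c) t
  set A' : Set Ω := {ω | past γ c y s (inputOf N T ω) ∈ A} with hA'
  have hX : Measurable fun ω => position γ c y (s + t) (inputOf N T ω) :=
    h.measurable_position_inputOf _
  have hXs : Measurable fun ω => position γ c y s (inputOf N T ω) :=
    h.measurable_position_inputOf _
  have h1 : ∀ B, MeasurableSet B →
      (P.restrict A').map (fun ω => position γ c y (s + t) (inputOf N T ω)) B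
        = P {ω | past γ c y s (inputOf N T ω) ∈ A ∧
          position γ c y (s + t) (inputOf N T ω) ∈ B} := by
    intro B hB
    rw [Measure.map_apply hX hB, Measure.restrict_apply (hX hB), Set.inter_comm]
    rfl
  have h2 : ∀ B, MeasurableSet B →
      ((P.restrict A').map fun ω => position γ c y s (inputOf N T ω)).bind
        (transition N T P γ c t) B
        = ∫⁻ ω in A', transition N T P γ c t (position γ c y s (inputOf N T ω)) B ∂P := by
    intro B hB
    rw [Measure.bind_apply hB (Kernel.aemeasurable _),
      lintegral_map (Kernel.measurable_coe _ hB) hXs]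
  -- Both sides are finite measures in B with the same mass, so the singletons of positive integers
  -- decide.
  rw [← h1 B hB, ← h2 B hB]
  congr 1
  refine measure_ext_coe ?_ fun x => ?_
  · rw [h1 _ MeasurableSet.univ, h2 _ MeasurableSet.univ]
    simp [hA']
  · rw [h1 _ (measurableSet_singleton _), h2 _ (measurableSet_singleton _)]
    refine (h.measure_past_inter hγ hs hc s t hA x).trans ?_
    refine lintegral_congr fun ω => ?_
    rw [transition_apply, Measure.map_apply (h.measurable_position_inputOf _)
      (measurableSet_singleton _)]
    rfl

/-- For y = ∞, an interval containing 0 would keep the clock at most 0 up to a positive event time,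
against strict monotonicity. -/
lemma IsRegular.position_zero {I : Input} (hI : IsRegular γ I) (hγ : ∀ x, 0 < γ x) (hc : 0 ≤ c) :
    position γ c y 0 I = y := by
  induction y using OnePoint.rec with
  | coe x => exact hI.position_of_lt hγ hc le_rfl (mul_pos (hγ x) (hI.pos none))
  | infty =>
    refine position_of_not_holds fun k hk => ?_
    rcases k with _ | ⟨x, j⟩
    · exact not_holds_none_infty hk
    · obtain ⟨w, hw0, hw⟩ := exists_between (hI.eventTime_pos x j)
      have h1 := ((hI.holds_some_iff hγ hc x j 0).1 hk).1 w hw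
      have h2 := hI.clock_strictMono (y := OnePoint.infty) hγ hc hw0
      have h3 := hI.clock_nonneg (y := OnePoint.infty) hγ hc 0
      linarith

lemma IsInput.isTransitionSemigroup (h : IsInput N T P) (hγ : ∀ x, 0 < γ x) (hs : Summable γ)
    (hc : 0 ≤ c) : IsTransitionSemigroup (transition N T P γ c) where
  isMarkovKernel := h.isMarkovKernel_transition
  zero := by
    refine Kernel.ext fun z => ?_
    rw [transition_apply, Kernel.id_apply]
    have : (fun ω => position γ c z (0 : ℝ≥0) (inputOf N T ω)) =ᵐ[P] fun _ => z := by
      filter_upwards [h.ae_isRegular hγ hs] with ω hω using hω.position_zero hγ hc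
    rw [Measure.map_congr this, Measure.map_const, measure_univ, one_smul]
  add s t := by
    refine Kernel.ext fun z => Measure.ext fun B hB => ?_
    have hm := h.measure_past_inter_preimage (y := z) hγ hs hc s t MeasurableSet.univ hB
    simp only [Set.mem_univ, true_and, Set.ofPred_true, Measure.restrict_univ] at hm
    rw [Kernel.comp_apply' _ _ _ hB, transition_apply, transition_apply,
      Measure.map_apply (h.measurable_position_inputOf _) hB,
      lintegral_map (Kernel.measurable_coe _ hB) (h.measurable_position_inputOf _), ← hm]
    push_cast
    rfl

/-! ### From the measurable version back to the process. -/

/-- The construction agrees almost surely with its measurable version, at all times. -/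
lemma IsInput.ae_process_eq (h : IsInput N T P) (hγ : ∀ x, 0 < γ x) (hs : Summable γ)
    (hc : 0 ≤ c) : ∀ᵐ ω ∂P, ∀ t : ℝ≥0,
      process γ c N T y t ω = position γ c y t (inputOf N T ω) := by
  filter_upwards [h.ae_isRegular hγ hs] with ω hω t using hω.path_eq hγ hc t

/-- The σ-algebra of the past is the pullback of the product σ-algebra under the restricted path. -/
lemma exists_of_measurableSet_past {α E : Type*} [MeasurableSpace E] {X : ℝ≥0 → α → E} {s : ℝ≥0}
    {A : Set α} (hA : MeasurableSet[pastSigmaAlgebra X s] A) :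
    ∃ A' : Set (Set.Iic s → E), MeasurableSet A' ∧
      A = {a | (fun r : Set.Iic s => X r a) ∈ A'} := by
  have heq : pastSigmaAlgebra X s
      = MeasurableSpace.comap (fun a (r : Set.Iic s) => X r a) MeasurableSpace.pi := by
    simp only [MeasurableSpace.pi, MeasurableSpace.comap_iSup, MeasurableSpace.comap_comp]
    rfl
  rw [heq] at hA
  obtain ⟨A', hA', rfl⟩ := hA
  exact ⟨A', hA', rfl⟩

lemma IsInput.aemeasurable_process (h : IsInput N T P) (hγ : ∀ x, 0 < γ x) (hs : Summable γ)
    (hc : 0 ≤ c) (t : ℝ≥0) : AEMeasurable (process γ c N T y t) P :=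
  ⟨_, h.measurable_position_inputOf t, (h.ae_process_eq hγ hs hc).mono fun _ hω => hω t⟩

lemma IsInput.hasLaw_process (h : IsInput N T P) (hγ : ∀ x, 0 < γ x) (hs : Summable γ)
    (hc : 0 ≤ c) (t : ℝ≥0) :
    HasLaw (process γ c N T y t) (transition N T P γ c t y) P where
  aemeasurable := h.aemeasurable_process hγ hs hc t
  map_eq := Measure.map_congr ((h.ae_process_eq hγ hs hc).mono fun _ hω => hω t)

lemma IsInput.isMarkov_process (h : IsInput N T P) (hγ : ∀ x, 0 < γ x) (hs : Summable γ)
    (hc : 0 ≤ c) : IsMarkov (process γ c N T y) (transition N T P γ c) P where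
  aemeasurable := h.aemeasurable_process hγ hs hc
  markov s t A hA B hB := by
    obtain ⟨A', hA', rfl⟩ := exists_of_measurableSet_past hA
    have hae := h.ae_process_eq (y := y) hγ hs hc
    have hpast : ∀ᵐ ω ∂P, (fun r : Set.Iic s => process γ c N T y r ω)
        = past γ c y s (inputOf N T ω) := by
      filter_upwards [hae] with ω hω using funext fun r => hω r
    -- Past events of the process are replaced by those of the measurable version, almost surely
    -- equal since the two paths agree at all times at once.
    have hset : {ω | (fun r : Set.Iic s => process γ c N T y r ω) ∈ A'}
        =ᵐ[P] {ω | past γ c y s (inputOf N T ω) ∈ A'} := by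
      refine eventuallyEq_set.2 ?_
      filter_upwards [hpast] with ω hω
      change _ ∈ A' ↔ _ ∈ A'
      rw [hω]
    have hleft : P ({ω | (fun r : Set.Iic s => process γ c N T y r ω) ∈ A'}
        ∩ process γ c N T y (s + t) ⁻¹' B) = P {ω | past γ c y s (inputOf N T ω) ∈ A' ∧
          position γ c y (s + t) (inputOf N T ω) ∈ B} := by
      refine measure_congr (eventuallyEq_set.2 ?_)
      filter_upwards [hpast, hae] with ω hω hω'
      change _ ∈ A' ∧ _ ∈ B ↔ _ ∈ A' ∧ _ ∈ B
      rw [hω, hω', NNReal.coe_add]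
    rw [hleft, h.measure_past_inter_preimage hγ hs hc s t hA' hB, setLIntegral_congr hset]
    refine lintegral_congr_ae (ae_restrict_of_ae ?_)
    filter_upwards [hae] with ω hω
    rw [hω]

end KConstruction

/-- For every starting point `y` the K-process is almost surely càdlàg, and the K-processes started
at the various `y` are Markov with one common transition function `κ`, where `κ t y` is the law of
the process started at `y` at time `t`. -/
theorem proposition3p6 {Ω : Type*} [MeasurableSpace Ω] (P : Measure Ω) [IsProbabilityMeasure P]
    (γ : ℕ+ → ℝ) (hγ_pos : ∀ x, 0 < γ x) (hγ_sum : Summable γ) (c : ℝ) (hc : 0 ≤ c)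
    (N : ℕ+ → ℝ≥0 → Ω → ℕ) (T : Option (ℕ+ × ℕ) → Ω → ℝ) (hinput : KConstruction.IsInput N T P) :
    (∀ y : KConstruction.State, ∀ᵐ ω ∂P,
      KConstruction.IsCadlag fun t => KConstruction.process γ c N T y t ω) ∧
    ∃ κ : ℝ≥0 → Kernel KConstruction.State KConstruction.State,
      KConstruction.IsTransitionSemigroup κ ∧
      ∀ y : KConstruction.State,
        (∀ t, HasLaw (KConstruction.process γ c N T y t) (κ t y) P) ∧
        KConstruction.IsMarkov (KConstruction.process γ c N T y) κ P := by
  exact ⟨fun y => (hinput.ae_isRegular hγ_pos hγ_sum).mono fun _ hω => hω.isCadlag_path hγ_pos hc,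
    KConstruction.transition N T P γ c, hinput.isTransitionSemigroup hγ_pos hγ_sum hc,
    fun _ => ⟨hinput.hasLaw_process hγ_pos hγ_sum hc, hinput.isMarkov_process hγ_pos hγ_sum hc⟩⟩
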